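/- Let $M$ be a smooth manifold with (possibly empty) boundary of dimension $n\ge 1$ (Hausdorff, second countable), and let $E=\bigoplus_i E_i\to M$ be a $\mathbb Z$-graded smooth real vector bundle of finite total rank, with sheaf of sections $\mathscr E$ and compactly supported sections $\mathscr E_c(U)$ (supports may meet $\partial M$). Let $D_M$ be the sheaf of algebras of differential operators on $C^\infty_M$. The sheaf of distributions $\mathcal D_M(U)=C^\infty_c(U)'$ (test functions are smooth up to the boundary, and their supports may meet $\partial M$) is a right $D_M$-module by $(T\cdot D)(f)=T(Df)$. Let $\Omega^{n,n-1}_{M,tw}\subset\mathcal D_M$ be the smallest subsheaf of right $D_M$-modules containing all smooth densities $f\mapsto\int_U f\mu$. Let $\mathscr J(\mathscr E)$ be the sheaf of sections of the infinite jet bundle $J(\mathscr E)$ of $E$, let $\mathscr J(\mathscr E)^\vee$ be its continuous $C^\infty_M$-linear dual, and let $$\mathcal O(\mathscr J(\mathscr E))=\prod_{k\ge 0}\mathrm{Sym}^k_{C^\infty_M}\,\mathscr J(\mathscr E)^\vee ,$$ where the $k$-th factor is the sheaf of graded symmetric polydifferential operators $P_k$ with $k$ arguments in $\mathscr E$ and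 values in $C^\infty_M$, of locally finite order; this is a left $D_M$-module by composition, $(D\cdot P)_k=D\circ P_k$. For $k\ge1$ let $\mathcal O^{k}_{loc}(\mathscr E)(U)$ be the space of graded symmetric $k$-linear functionals on $\mathscr E_c(U)$ which vanish on $k$-tuples of fields whose supports have no common point and which near every point of $U$ are finite linear combinations of functionals $$(\varphi_1,\dots,\varphi_k)\mapsto \int D_1\varphi_1\cdots D_k\varphi_k\, d\mu,$$ with differential operators $D_i:\mathscr E\to C^\infty_M$ and a smooth density $d\mu$. Let $\mathcal O_{loc}(\mathscr E)/\{\text{constants}\}=\prod_{k\ge1}\mathcal O_{loc}^k(\mathscr E)$ be the presheaf of local functionals modulo constant functionals, restricted along extension by zero of compactly supported fields. Then $\mathcal O_{loc}(\mathscr E)/\{\text{constants}\}$ is a sheaf on $M$; the assignment $$\omega\otimes (P_k)_{k\ge0}\longmapsto \Big((\varphi_1,\dots,\varphi_k)\mapsto \omega\big(P_k(\varphi_1,\dots,\varphi_k)\big)\Big)_{k\ge1}$$ is a well-defined morphism from the presheaf $U\mapsto \Omega^{n,n-1}_{M,tw}(U)\otimes_{D_M(U)}\mathcal O(\mathscr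 J(\mathscr E))(U)$ to it; and the induced morphism $$\digamma:\ \Omega^{n,n-1}_{M,tw}\otimes_{D_M}\mathcal O(\mathscr J(\mathscr E))\longrightarrow \mathcal O_{loc}(\mathscr E)/\{\text{constants}\}$$ from the tensor product of sheaves (the sheafification of that presheaf) is an isomorphism of sheaves of real vector spaces on $M$. -/

import Mathlib

open scoped Manifold ContDiff TensorProduct
open TopologicalSpace

universe u

noncomputable section

namespace BoundaryDMod

/-! ### Smooth functions, test functions, differential operators -/

section Functions

variable (n : ℕ) [NeZero n] {M : Type u} [TopologicalSpace M]
  [ChartedSpace (EuclideanHalfSpace n) M]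

/-- `C^∞(U)`: smooth real functions (up to the boundary) on an open subset `U` of the
manifold with boundary `M`. -/
abbrev Fn (U : Opens M) : Type u := C^∞⟮𝓡∂ n, U; 𝓘(ℝ, ℝ), ℝ⟯

variable {n}

/-- Restriction of smooth functions to a smaller open set. -/
def Fn.res {U V : Opens M} (h : V ≤ U) : Fn n U →ₗ[ℝ] Fn n V where
  toFun f := ContMDiffMap.restrictRingHom (𝓡∂ n) 𝓘(ℝ, ℝ) ℝ h f
  map_add' f g := map_add _ f g
  map_smul' _ _ := rfl

@[simp] theorem Fn.res_apply {U V : Opens M} (h : V ≤ U) (f : Fn n U) (x : V) :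
    Fn.res h f x = f ⟨x, h x.2⟩ := rfl

/-- A smooth function on `U`, extended by zero to a function on `M`. -/
def Fn.zext {U : Opens M} (f : Fn n U) : M → ℝ := by
  classical exact fun x => if h : x ∈ U then f ⟨x, h⟩ else 0

variable (n)

/-- `C^∞_c(U)`: smooth functions on `U` with compact support in `U` (the support may meet the
boundary of `M`). -/
def TestFn (U : Opens M) : Submodule ℝ (Fn n U) where
  carrier := {f | ∃ K : Set M, IsCompact K ∧ K ⊆ U ∧ ∀ x : U, (x : M) ∉ K → f x = 0}
  zero_mem' := ⟨∅, isCompact_empty, Set.empty_subset _, fun _ _ => rfl⟩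
  add_mem' := by
    rintro f g ⟨K, hK, hKU, hf⟩ ⟨L, hL, hLU, hg⟩
    refine ⟨K ∪ L, hK.union hL, Set.union_subset hKU hLU, fun x hx => ?_⟩
    simp only [Set.mem_union, not_or] at hx
    simp [hf x hx.1, hg x hx.2]
  smul_mem' := by
    rintro c f ⟨K, hK, hKU, hf⟩
    exact ⟨K, hK, hKU, fun x hx => by simp [hf x hx]⟩

variable {n}

/-- Differential operators in the algebraic sense, on `C^∞(W)`: the zero operator has order `< 0`,
and `D` has order `< r + 1` iff all commutators `[f, D]`, `f ∈ C^∞(W)`, have order `< r`. -/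
def HasOrderLT {W : Opens M} : ℕ → Module.End ℝ (Fn n W) → Prop
  | 0, D => D = 0
  | r + 1, D => ∀ f : Fn n W, HasOrderLT r (LinearMap.mulLeft ℝ f * D - D * LinearMap.mulLeft ℝ f)

section OrderLemmas

variable {W : Opens M}

theorem HasOrderLT.zero (r : ℕ) : HasOrderLT r (0 : Module.End ℝ (Fn n W)) := by
  induction r with
  | zero => rfl
  | succ r ih => intro f; simpa using ih

theorem HasOrderLT.succ {r : ℕ} {D : Module.End ℝ (Fn n W)} (h : HasOrderLT r D) :
    HasOrderLT (r + 1) D := by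
  induction r generalizing D with
  | zero =>
    have h' : D = 0 := h
    subst h'
    exact HasOrderLT.zero _
  | succ r ih => intro f; exact ih (h f)

theorem HasOrderLT.mono {r s : ℕ} (hrs : r ≤ s) {D : Module.End ℝ (Fn n W)}
    (h : HasOrderLT r D) : HasOrderLT s D := by
  induction hrs with
  | refl => exact h
  | step _ ih => exact ih.succ

theorem HasOrderLT.add {r : ℕ} {D D' : Module.End ℝ (Fn n W)} (h : HasOrderLT r D)
    (h' : HasOrderLT r D') : HasOrderLT r (D + D') := by
  induction r generalizing D D' with
  | zero =>
    have e : D = 0 := h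
    have e' : D' = 0 := h'
    subst e e'
    rw [add_zero]
    exact HasOrderLT.zero 0
  | succ r ih =>
    intro f
    have := ih (h f) (h' f)
    rwa [show LinearMap.mulLeft ℝ f * (D + D') - (D + D') * LinearMap.mulLeft ℝ f
      = (LinearMap.mulLeft ℝ f * D - D * LinearMap.mulLeft ℝ f)
        + (LinearMap.mulLeft ℝ f * D' - D' * LinearMap.mulLeft ℝ f) by noncomm_ring]

theorem HasOrderLT.const (c : ℝ) :
    HasOrderLT 1 (algebraMap ℝ (Module.End ℝ (Fn n W)) c) := by
  intro f
  change _ - _ = 0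
  rw [Algebra.commutes, sub_self]

theorem HasOrderLT.mul {r s : ℕ} {D D' : Module.End ℝ (Fn n W)} (h : HasOrderLT r D)
    (h' : HasOrderLT s D') : HasOrderLT (r + s) (D * D') := by
  obtain ⟨N, hN⟩ : ∃ N, N = r + s := ⟨_, rfl⟩
  induction N generalizing r s D D' with
  | zero =>
    obtain ⟨rfl, rfl⟩ : r = 0 ∧ s = 0 := by omega
    have e : D = 0 := h
    subst e
    rw [zero_mul]
    exact HasOrderLT.zero _
  | succ N ih =>
    rcases r with _ | r
    · have e : D = 0 := h
      subst e
      rw [zero_mul]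
      exact HasOrderLT.zero _
    rcases s with _ | s
    · have e : D' = 0 := h'
      subst e
      rw [mul_zero]
      exact HasOrderLT.zero _
    have key : HasOrderLT (r + s + 1 + 1) (D * D') := by
      intro f
      have h1 : HasOrderLT (r + s + 1) _ := ih (r := r) (s := s + 1) (h f) h' (by omega)
      have h2 : HasOrderLT (r + s + 1) _ :=
        (ih (r := r + 1) (s := s) h (h' f) (by omega)).mono (by omega)
      have h3 := h1.add h2
      rwa [show LinearMap.mulLeft ℝ f * (D * D') - (D * D') * LinearMap.mulLeft ℝ f
        = (LinearMap.mulLeft ℝ f * D - D * LinearMap.mulLeft ℝ f) * D'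
          + D * (LinearMap.mulLeft ℝ f * D' - D' * LinearMap.mulLeft ℝ f) by
          simp only [mul_sub, sub_mul, mul_assoc]; abel]
    exact key.mono (by omega)

end OrderLemmas

variable (n)

/-- The algebra `D_M(U)` of differential operators on `U`, as endomorphisms of the sheaf
`C^∞_M|_U`: families of linear maps `C^∞(W) → C^∞(W)`, `W ⊆ U` open, compatible with
restriction and locally of finite order. -/
def diffOps (U : Opens M) : Subalgebra ℝ (∀ W : Set.Iic U, Module.End ℝ (Fn n W.1)) where
  carrier := {D |
    (∀ (V W : Set.Iic U) (h : V.1 ≤ W.1) (f : Fn n W.1),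
      D V (Fn.res h f) = Fn.res h (D W f)) ∧
    ∀ x ∈ U, ∃ V : Opens M, x ∈ V ∧ ∃ r : ℕ, ∀ W : Set.Iic U, W.1 ≤ V → HasOrderLT r (D W)}
  mul_mem' := by
    rintro D D' ⟨hD, hr⟩ ⟨hD', hr'⟩
    refine ⟨fun V W h f => ?_, fun x hx => ?_⟩
    · simp only [Pi.mul_apply, Module.End.mul_apply, hD', hD]
    · obtain ⟨V, hV, r, h⟩ := hr x hx
      obtain ⟨V', hV', r', h'⟩ := hr' x hx
      exact ⟨V ⊓ V', ⟨hV, hV'⟩, r + r', fun W hW =>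
        (h W (hW.trans inf_le_left)).mul (h' W (hW.trans inf_le_right))⟩
  add_mem' := by
    rintro D D' ⟨hD, hr⟩ ⟨hD', hr'⟩
    refine ⟨fun V W h f => ?_, fun x hx => ?_⟩
    · simp only [Pi.add_apply, LinearMap.add_apply, hD', hD, map_add]
    · obtain ⟨V, hV, r, h⟩ := hr x hx
      obtain ⟨V', hV', r', h'⟩ := hr' x hx
      exact ⟨V ⊓ V', ⟨hV, hV'⟩, r + r', fun W hW =>
        ((h W (hW.trans inf_le_left)).mono (by omega)).add
          ((h' W (hW.trans inf_le_right)).mono (by omega))⟩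
  algebraMap_mem' := by
    intro c
    refine ⟨fun V W h f => ?_, fun x hx => ⟨⊤, trivial, 1, fun W _ => HasOrderLT.const c⟩⟩
    simp only [Pi.algebraMap_apply, Module.algebraMap_end_apply, map_smul]

/-- Differential operators on `U`. -/
abbrev DiffOp (U : Opens M) : Type u := diffOps n U

variable {n}

/-- Restriction of differential operators. -/
def DiffOp.res {U V : Opens M} (h : V ≤ U) (D : DiffOp n U) : DiffOp n V :=
  ⟨fun W => D.1 ⟨W.1, le_trans (show W.1 ≤ V from W.2) h⟩,
    fun V' W hVW f => D.2.1 ⟨V'.1, le_trans (show V'.1 ≤ V from V'.2) h⟩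
      ⟨W.1, le_trans (show W.1 ≤ V from W.2) h⟩ hVW f,
    fun x hx => by
      obtain ⟨V', hV', r, hr⟩ := D.2.2 x (h hx)
      exact ⟨V', hV', r, fun W hW => hr _ hW⟩⟩

/-- The action of a differential operator on `U` on smooth functions on `U`. -/
def DiffOp.app {U : Opens M} (D : DiffOp n U) : Fn n U →ₗ[ℝ] Fn n U :=
  D.1 ⟨U, le_refl U⟩

theorem DiffOp.app_res {U V : Opens M} (h : V ≤ U) (D : DiffOp n U) (f : Fn n U) :
    (D.res h).app (Fn.res h f) = Fn.res h (D.app f) :=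
  D.2.1 ⟨V, h⟩ ⟨U, le_refl U⟩ h f

/-- Differential operators do not enlarge supports. -/
theorem DiffOp.app_eq_zero {U : Opens M} (D : DiffOp n U) {f : Fn n U} {K : Set M}
    (hK : IsClosed K) (hf : ∀ x : U, (x : M) ∉ K → f x = 0) (x : U) (hx : (x : M) ∉ K) :
    D.app f x = 0 := by
  let W : Opens M := U ⊓ ⟨Kᶜ, hK.isOpen_compl⟩
  have hW : W ≤ U := inf_le_left
  have h0 : Fn.res hW f = 0 := by
    ext y
    exact hf ⟨y, hW y.2⟩ y.2.2
  have h1 := D.app_res hW f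
  rw [h0, map_zero] at h1
  have h2 := congrArg (fun g : Fn n W => g ⟨x, x.2, hx⟩) h1
  exact h2.symm

variable [T2Space M]

/-- Extension by zero `C^∞_c(V) → C^∞_c(U)` for `V ⊆ U`. -/
def TestFn.ext {U V : Opens M} (h : V ≤ U) : TestFn n V →ₗ[ℝ] TestFn n U where
  toFun f := ⟨⟨fun x => Fn.zext f.1 x, by
      obtain ⟨K, hK, hKV, hf⟩ := f.2
      have hz : ContMDiff (𝓡∂ n) 𝓘(ℝ, ℝ) ∞ (Fn.zext f.1) := by
        intro x
        by_cases hx : x ∈ V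
        · rw [← contMDiffAt_subtype_iff (U := V) (x := ⟨x, hx⟩)]
          have : (fun y : V => Fn.zext f.1 y) = f.1 := by
            funext y
            simp [Fn.zext]
          rw [this]
          exact f.1.contMDiff _
        · have hx' : x ∈ Kᶜ := fun hxK => hx (hKV hxK)
          refine (contMDiffAt_const (c := (0 : ℝ))).congr_of_eventuallyEq ?_
          filter_upwards [hK.isClosed.isOpen_compl.mem_nhds hx'] with y hy
          by_cases hyV : y ∈ V
          · simpa [Fn.zext, hyV] using hf ⟨y, hyV⟩ hy
          · simp [Fn.zext, hyV]
      exact fun x => contMDiffAt_subtype_iff.2 (hz x.1)⟩, by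
      obtain ⟨K, hK, hKV, hf⟩ := f.2
      refine ⟨K, hK, hKV.trans h, fun x hx => ?_⟩
      change Fn.zext f.1 x = 0
      by_cases hxV : (x : M) ∈ V
      · simpa [Fn.zext, hxV] using hf ⟨x, hxV⟩ hx
      · simp [Fn.zext, hxV]⟩
  map_add' f g := by
    ext x
    change Fn.zext (f.1 + g.1) x = Fn.zext f.1 x + Fn.zext g.1 x
    by_cases hxV : (x : M) ∈ V <;> simp [Fn.zext, hxV]
  map_smul' c f := by
    ext x
    change Fn.zext (c • f.1) x = c * Fn.zext f.1 x
    by_cases hxV : (x : M) ∈ V <;> simp [Fn.zext, hxV]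

@[simp] theorem TestFn.ext_apply {U V : Opens M} (h : V ≤ U) (f : TestFn n V) (x : U) :
    (TestFn.ext h f).1 x = Fn.zext f.1 x := rfl

theorem TestFn.res_ext {U V : Opens M} (h : V ≤ U) (f : TestFn n V) :
    Fn.res h (TestFn.ext h f).1 = f.1 := by
  ext x
  simp [Fn.zext]

theorem TestFn.zext_ext {U V : Opens M} (h : V ≤ U) (f : TestFn n V) :
    Fn.zext (TestFn.ext h f).1 = Fn.zext f.1 := by
  funext x
  by_cases hxU : x ∈ U
  · simp [Fn.zext, hxU]
  · have hxV : x ∉ V := fun hx => hxU (h hx)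
    simp [Fn.zext, hxU, hxV]

theorem TestFn.ext_refl {U : Opens M} (f : TestFn n U) : TestFn.ext (le_refl U) f = f := by
  ext x
  simp [Fn.zext]

theorem TestFn.ext_ext {U V W : Opens M} (h : V ≤ U) (h' : W ≤ V) (f : TestFn n W) :
    TestFn.ext h (TestFn.ext h' f) = TestFn.ext (h'.trans h) f := by
  apply Subtype.ext
  ext x
  simp only [TestFn.ext_apply, TestFn.zext_ext]

/-- The action of a differential operator on test functions. -/
def DiffOp.testMap {U : Opens M} (D : DiffOp n U) : TestFn n U →ₗ[ℝ] TestFn n U :=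
  D.app.restrict (by
    rintro f ⟨K, hK, hKU, hf⟩
    exact ⟨K, hK, hKU, D.app_eq_zero hK.isClosed hf⟩)

@[simp] theorem DiffOp.testMap_coe {U : Opens M} (D : DiffOp n U) (f : TestFn n U) :
    (D.testMap f : Fn n U) = D.app f := rfl

theorem DiffOp.testMap_ext {U V : Opens M} (h : V ≤ U) (D : DiffOp n U) (f : TestFn n V) :
    D.testMap (TestFn.ext h f) = TestFn.ext h ((D.res h).testMap f) := by
  apply Subtype.ext
  ext x
  obtain ⟨K, hK, hKV, hf⟩ := f.2
  by_cases hx : (x : M) ∈ V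
  · have h1 := D.app_res h (TestFn.ext h f).1
    rw [TestFn.res_ext] at h1
    have h2 := congrArg (fun g : Fn n V => g ⟨x, hx⟩) h1
    simpa [Fn.zext, hx] using h2.symm
  · have h3 : D.app (TestFn.ext h f).1 x = 0 := by
      refine D.app_eq_zero hK.isClosed (fun y hy => ?_) x (fun hxK => hx (hKV hxK))
      by_cases hyV : (y : M) ∈ V
      · simpa [Fn.zext, hyV] using hf ⟨y, hyV⟩ hy
      · simp [Fn.zext, hyV]
    simpa [Fn.zext, hx] using h3

end Functions

/-! ### Distributions and `∂`-smooth densities -/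

section Distributions

variable (n : ℕ) [NeZero n] {M : Type u} [TopologicalSpace M]
  [ChartedSpace (EuclideanHalfSpace n) M] [T2Space M]

/-- Distributions on `U`: linear functionals on `C^∞_c(U)` which, on the functions supported in
any given compact subset of `U`, are bounded by finitely many of the seminorms `sup |D f|`, where
`D` is a differential operator on `U`. -/
def distributions (U : Opens M) : Submodule ℝ (TestFn n U →ₗ[ℝ] ℝ) where
  carrier := {T | ∀ K : Set M, IsCompact K → K ⊆ U →
    ∃ (s : Finset (DiffOp n U)) (C : ℝ), ∀ f : TestFn n U,
      (∀ x : U, (x : M) ∉ K → f.1 x = 0) →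
      ∀ B : ℝ, 0 ≤ B → (∀ D ∈ s, ∀ x : U, |D.app f.1 x| ≤ B) → |T f| ≤ C * B}
  zero_mem' := fun K _ _ => ⟨∅, 0, fun f _ B _ _ => by simp⟩
  add_mem' := by
    classical
    intro T T' hT hT' K hK hKU
    obtain ⟨s, C, h⟩ := hT K hK hKU
    obtain ⟨s', C', h'⟩ := hT' K hK hKU
    refine ⟨s ∪ s', C + C', fun f hf B hB hs => ?_⟩
    have h1 := h f hf B hB (fun D hD => hs D (Finset.mem_union_left _ hD))
    have h2 := h' f hf B hB (fun D hD => hs D (Finset.mem_union_right _ hD))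
    calc |(T + T') f| ≤ |T f| + |T' f| := abs_add_le _ _
      _ ≤ (C + C') * B := by linarith
  smul_mem' := by
    intro c T hT K hK hKU
    obtain ⟨s, C, h⟩ := hT K hK hKU
    refine ⟨s, |c| * C, fun f hf B hB hs => ?_⟩
    have h1 := h f hf B hB hs
    calc |(c • T) f| = |c| * |T f| := by simp [abs_mul]
      _ ≤ |c| * (C * B) := by gcongr
      _ = |c| * C * B := by ring

/-- Distributions on `U`. -/
abbrev Distribution (U : Opens M) : Type u := distributions n U

variable {n}

/-- Restriction of distributions. -/
def Distribution.res {U V : Opens M} (h : V ≤ U) : Distribution n U →ₗ[ℝ] Distribution n V :=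
  LinearMap.restrict (LinearMap.lcomp ℝ ℝ (TestFn.ext h)) (by
    classical
    intro T hT K hK hKV
    obtain ⟨s, C, hs⟩ := hT K hK (hKV.trans h)
    refine ⟨s.image (DiffOp.res h), C, fun f hf B hB hB' => ?_⟩
    refine hs (TestFn.ext h f) (fun x hx => ?_) B hB (fun D hD x => ?_)
    · by_cases hxV : (x : M) ∈ V
      · simpa [Fn.zext, hxV] using hf ⟨x, hxV⟩ hx
      · simp [Fn.zext, hxV]
    · have h1 : D.app (TestFn.ext h f).1 x = Fn.zext ((D.res h).app f.1) x :=
        congrArg (fun g : TestFn n U => g.1 x) (D.testMap_ext h f)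
      rw [h1]
      by_cases hxV : (x : M) ∈ V
      · simpa [Fn.zext, hxV] using hB' _ (Finset.mem_image_of_mem _ hD) ⟨x, hxV⟩
      · simpa [Fn.zext, hxV] using hB)

@[simp] theorem Distribution.res_apply {U V : Opens M} (h : V ≤ U) (T : Distribution n U)
    (f : TestFn n V) : (Distribution.res h T).1 f = T.1 (TestFn.ext h f) := rfl

/-- The right action of `D_M(U)` on distributions: `(T · D)(f) = T(D f)`. -/
def Distribution.rmul {U : Opens M} (T : Distribution n U) (D : DiffOp n U) : Distribution n U :=
  ⟨T.1 ∘ₗ D.testMap, by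
    classical
    intro K hK hKU
    obtain ⟨s, C, hs⟩ := T.2 K hK hKU
    refine ⟨s.image (fun D' => D' * D), C, fun f hf B hB hB' => ?_⟩
    refine hs (D.testMap f) (fun x hx => D.app_eq_zero hK.isClosed hf x hx) B hB
      (fun D' hD' x => ?_)
    exact hB' _ (Finset.mem_image_of_mem _ hD') x⟩

@[simp] theorem Distribution.rmul_apply {U : Opens M} (T : Distribution n U) (D : DiffOp n U)
    (f : TestFn n U) : (T.rmul D).1 f = T.1 (D.testMap f) := rfl

theorem Distribution.res_rmul {U V : Opens M} (h : V ≤ U) (T : Distribution n U)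
    (D : DiffOp n U) :
    Distribution.res h (T.rmul D) = (Distribution.res h T).rmul (D.res h) := by
  apply Subtype.ext
  apply LinearMap.ext
  intro f
  simp [DiffOp.testMap_ext]

/-- `T` is (the distribution `f ↦ ∫ f w` given by) a smooth density `w` on `U`: in every smooth
chart `e` of `M` there is a smooth function `ρ` on the part of the chart domain lying in `U`, such
that for `f` compactly supported in that part, `T f` is the integral of `ρ f` with respect to
Lebesgue measure in the coordinates of `e`. -/
def IsSmoothDensity {U : Opens M} (T : Distribution n U) : Prop :=
  ∀ e ∈ IsManifold.maximalAtlas (𝓡∂ n) ∞ M, ∃ ρ : M → ℝ,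
    ContMDiffOn (𝓡∂ n) 𝓘(ℝ, ℝ) ∞ ρ (U ∩ e.source) ∧
    ∀ f : TestFn n U,
      (∃ K : Set M, IsCompact K ∧ K ⊆ U ∩ e.source ∧ ∀ x : U, (x : M) ∉ K → f.1 x = 0) →
      T.1 f = ∫ y in (e.extend (𝓡∂ n)).target,
        ρ ((e.extend (𝓡∂ n)).symm y) * Fn.zext f.1 ((e.extend (𝓡∂ n)).symm y)

theorem IsSmoothDensity.res {U V : Opens M} (h : V ≤ U) {T : Distribution n U}
    (hT : IsSmoothDensity T) : IsSmoothDensity (Distribution.res h T) := by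
  intro e he
  obtain ⟨ρ, hρ, hT⟩ := hT e he
  refine ⟨ρ, hρ.mono (Set.inter_subset_inter_left _ h), ?_⟩
  rintro f ⟨K, hK, hKV, hf⟩
  rw [Distribution.res_apply, hT (TestFn.ext h f) ⟨K, hK, hKV.trans
    (Set.inter_subset_inter_left _ h), fun x hx => ?_⟩, TestFn.zext_ext]
  by_cases hxV : (x : M) ∈ V
  · simpa [Fn.zext, hxV] using hf ⟨x, hxV⟩ hx
  · simp [Fn.zext, hxV]

variable (n M)

/-- A subsheaf of right `D_M`-modules of the sheaf of distributions on `M`. -/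
structure SubDModule where
  sections : ∀ U : Opens M, Submodule ℝ (Distribution n U)
  res_mem : ∀ {U V : Opens M} (h : V ≤ U) {T : Distribution n U}, T ∈ sections U →
    Distribution.res h T ∈ sections V
  rmul_mem : ∀ {U : Opens M} {T : Distribution n U} (D : DiffOp n U), T ∈ sections U →
    T.rmul D ∈ sections U
  glue : ∀ {U : Opens M} (T : Distribution n U),
    (∀ x ∈ U, ∃ (V : Opens M) (h : V ≤ U), x ∈ V ∧ Distribution.res h T ∈ sections V) →
      T ∈ sections U

variable {M}

/-- The sheaf of `∂`-smooth densities: sections over `U` of the smallest subsheaf of right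
`D_M`-modules of the sheaf of distributions which contains all smooth densities. -/
def bdrySmoothDensities (U : Opens M) : Submodule ℝ (Distribution n U) :=
  ⨅ S : {S : SubDModule n M //
    ∀ (V : Opens M) (T : Distribution n V), IsSmoothDensity T → T ∈ S.sections V},
    S.1.sections U

/-- `∂`-smooth densities on `U`. -/
abbrev BdrySmoothDensity (U : Opens M) : Type u := bdrySmoothDensities n U

instance (U : Opens M) : AddCommGroup (BdrySmoothDensity n U) :=
  Submodule.addCommGroup (M := Distribution n U) _

variable {n}

/-- Restriction of `∂`-smooth densities. -/
def BdrySmoothDensity.res {U V : Opens M} (h : V ≤ U) :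
    BdrySmoothDensity n U →ₗ[ℝ] BdrySmoothDensity n V :=
  (Distribution.res h).restrict fun T hT => by
    simp only [bdrySmoothDensities, Submodule.mem_iInf] at hT ⊢
    exact fun S => S.1.res_mem h (hT S)

@[simp] theorem BdrySmoothDensity.res_coe {U V : Opens M} (h : V ≤ U)
    (w : BdrySmoothDensity n U) :
    (BdrySmoothDensity.res h w : Distribution n V) = Distribution.res h w := rfl

/-- The right action of `D_M(U)` on `∂`-smooth densities. -/
def BdrySmoothDensity.rmul {U : Opens M} (w : BdrySmoothDensity n U) (D : DiffOp n U) :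
    BdrySmoothDensity n U :=
  ⟨Distribution.rmul w.1 D, by
    have hT := w.2
    simp only [bdrySmoothDensities, Submodule.mem_iInf] at hT ⊢
    exact fun S => S.1.rmul_mem D (hT S)⟩

end Distributions

/-! ### Graded bundles and polydifferential operators -/

/-- A `ℤ`-graded smooth real vector bundle of finite total rank on `M`, given as a finite direct
sum of smooth vector bundles `E i`, with `E i` placed in degree `deg i`. -/
structure GradedBundle (n : ℕ) [NeZero n] (M : Type u) [TopologicalSpace M]
    [ChartedSpace (EuclideanHalfSpace n) M] where
  ι : Type
  finite_ι : Finite ι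
  deg : ι → ℤ
  rank : ι → ℕ
  E : ι → M → Type u
  [addCommGroup : ∀ i x, AddCommGroup (E i x)]
  [module : ∀ i x, Module ℝ (E i x)]
  [topFiber : ∀ i x, TopologicalSpace (E i x)]
  [topTotal : ∀ i, TopologicalSpace (Bundle.TotalSpace (EuclideanSpace ℝ (Fin (rank i))) (E i))]
  [fiberBundle : ∀ i, FiberBundle (EuclideanSpace ℝ (Fin (rank i))) (E i)]
  [vectorBundle : ∀ i, VectorBundle ℝ (EuclideanSpace ℝ (Fin (rank i))) (E i)]
  [smooth : ∀ i, ContMDiffVectorBundle ∞ (EuclideanSpace ℝ (Fin (rank i))) (E i) (𝓡∂ n)]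

attribute [instance] GradedBundle.addCommGroup GradedBundle.module GradedBundle.topFiber
  GradedBundle.topTotal GradedBundle.fiberBundle GradedBundle.vectorBundle GradedBundle.smooth

section Fields

variable {n : ℕ} [NeZero n] {M : Type u} [TopologicalSpace M]
  [ChartedSpace (EuclideanHalfSpace n) M] (𝓔 : GradedBundle n M)

/-- Families of vectors over `U`, extended by zero to `M`. -/
def vecZext {U : Opens M} {i : 𝓔.ι} (s : ∀ x : U, 𝓔.E i x) : ∀ x : M, 𝓔.E i x := by
  classical exact fun x => if h : x ∈ U then s ⟨x, h⟩ else 0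

/-- `ℰ(U)`: smooth sections over `U` of the total bundle `⨁ i, E i`. -/
def Fields (U : Opens M) : Submodule ℝ (∀ (i : 𝓔.ι) (x : U), 𝓔.E i x) where
  carrier := {φ | ∀ i, ContMDiffOn (𝓡∂ n)
    ((𝓡∂ n).prod 𝓘(ℝ, EuclideanSpace ℝ (Fin (𝓔.rank i)))) ∞
    (fun x : M => (⟨x, vecZext 𝓔 (φ i) x⟩ :
      Bundle.TotalSpace (EuclideanSpace ℝ (Fin (𝓔.rank i))) (𝓔.E i))) U}
  zero_mem' := by
    intro i
    refine (Bundle.contMDiffOn_zeroSection ℝ (𝓔.E i)).congr fun x hx => ?_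
    simp [vecZext, Bundle.zeroSection]
  add_mem' := by
    intro φ ψ hφ hψ i
    refine ((hφ i).add_section (hψ i)).congr fun x hx => ?_
    have hx' : x ∈ U := hx
    simp [vecZext, hx']
  smul_mem' := by
    intro c φ hφ i
    refine ((hφ i).const_smul_section (a := c)).congr fun x hx => ?_
    have hx' : x ∈ U := hx
    simp [vecZext, hx']

variable {𝓔}

/-- Restriction of fields. -/
def Fields.res {U V : Opens M} (h : V ≤ U) : Fields 𝓔 U →ₗ[ℝ] Fields 𝓔 V where
  toFun φ := ⟨fun i x => φ.1 i ⟨x, h x.2⟩, by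
    intro i
    refine ((φ.2 i).mono h).congr fun x hx => ?_
    have hx' : x ∈ V := hx
    have hx'' : x ∈ U := h hx
    simp [vecZext, hx', hx'']⟩
  map_add' _ _ := rfl
  map_smul' _ _ := rfl

/-- Multiplication of fields by a smooth function. -/
def Fields.mulFn {U : Opens M} (f : Fn n U) : Fields 𝓔 U →ₗ[ℝ] Fields 𝓔 U where
  toFun φ := ⟨fun i x => f x • φ.1 i x, by
    intro i
    have hf : ContMDiffOn (𝓡∂ n) 𝓘(ℝ, ℝ) ∞ (Fn.zext f) U := by
      intro x hx
      refine ContMDiffAt.contMDiffWithinAt ?_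
      rw [← contMDiffAt_subtype_iff (U := U) (x := ⟨x, hx⟩)]
      have : (fun y : U => Fn.zext f y) = f := by
        funext y
        simp [Fn.zext]
      rw [this]
      exact f.contMDiff _
    refine (hf.smul_section (φ.2 i)).congr fun x hx => ?_
    have hx' : x ∈ U := hx
    simp [vecZext, Fn.zext, hx']⟩
  map_add' φ ψ := by
    ext i x
    simp
  map_smul' c φ := by
    ext i x
    exact smul_comm (f x) c (φ.1 i x)

variable (𝓔) in
/-- Multilinear maps taking `k` fields on `W` to a function on `W`. -/
abbrev MultiOp (k : ℕ) (W : Opens M) : Type u :=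
  MultilinearMap ℝ (fun _ : Fin k => Fields 𝓔 W) (Fn n W)

/-- The commutator of `P` with multiplication by `f` in the `a`-th argument:
`f P(…, φ_a, …) - P(…, f φ_a, …)`. -/
def slotComm {k : ℕ} {W : Opens M} (a : Fin k) (f : Fn n W) (P : MultiOp 𝓔 k W) :
    MultiOp 𝓔 k W :=
  (LinearMap.mulLeft ℝ f).compMultilinearMap P -
    P.compLinearMap (Function.update (fun _ => LinearMap.id) a (Fields.mulFn f))

/-- `P` is a differential operator of order `< r` in its `a`-th argument. -/
def HasOrderLTAt {k : ℕ} {W : Opens M} (a : Fin k) : ℕ → MultiOp 𝓔 k W → Prop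
  | 0, P => P = 0
  | r + 1, P => ∀ f : Fn n W, HasOrderLTAt a r (slotComm a f P)

/-- The field `φ` is homogeneous of degree `d`. -/
def IsHomogeneous {U : Opens M} (d : ℤ) (φ : Fields 𝓔 U) : Prop :=
  ∀ i, 𝓔.deg i ≠ d → φ.1 i = 0

section OrderLemmas

variable {k : ℕ} {W : Opens M} {a : Fin k}

theorem slotComm_add (f : Fn n W) (P Q : MultiOp 𝓔 k W) :
    slotComm a f (P + Q) = slotComm a f P + slotComm a f Q := by
  ext φ x
  simp [slotComm]
  ring

theorem slotComm_smul (f : Fn n W) (c : ℝ) (P : MultiOp 𝓔 k W) :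
    slotComm a f (c • P) = c • slotComm a f P := by
  ext φ x
  simp [slotComm]
  ring

theorem slotComm_comp (f : Fn n W) (D : Module.End ℝ (Fn n W)) (P : MultiOp 𝓔 k W) :
    slotComm a f (D.compMultilinearMap P) =
      (LinearMap.mulLeft ℝ f * D - D * LinearMap.mulLeft ℝ f).compMultilinearMap P +
        D.compMultilinearMap (slotComm a f P) := by
  ext φ x
  simp [slotComm]

theorem HasOrderLTAt.zero (r : ℕ) : HasOrderLTAt a r (0 : MultiOp 𝓔 k W) := by
  induction r with
  | zero => rfl
  | succ r ih =>
    intro f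
    have : slotComm a f (0 : MultiOp 𝓔 k W) = 0 := by
      ext φ x
      simp [slotComm]
    rwa [this]

theorem HasOrderLTAt.succ {r : ℕ} {P : MultiOp 𝓔 k W} (h : HasOrderLTAt a r P) :
    HasOrderLTAt a (r + 1) P := by
  induction r generalizing P with
  | zero =>
    have h' : P = 0 := h
    subst h'
    exact HasOrderLTAt.zero _
  | succ r ih => intro f; exact ih (h f)

theorem HasOrderLTAt.mono {r s : ℕ} (hrs : r ≤ s) {P : MultiOp 𝓔 k W}
    (h : HasOrderLTAt a r P) : HasOrderLTAt a s P := by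
  induction hrs with
  | refl => exact h
  | step _ ih => exact ih.succ

theorem HasOrderLTAt.add {r : ℕ} {P Q : MultiOp 𝓔 k W} (h : HasOrderLTAt a r P)
    (h' : HasOrderLTAt a r Q) : HasOrderLTAt a r (P + Q) := by
  induction r generalizing P Q with
  | zero =>
    have e : P = 0 := h
    have e' : Q = 0 := h'
    subst e e'
    rw [add_zero]
    exact HasOrderLTAt.zero 0
  | succ r ih =>
    intro f
    rw [slotComm_add]
    exact ih (h f) (h' f)

theorem HasOrderLTAt.smul {r : ℕ} {P : MultiOp 𝓔 k W} (c : ℝ) (h : HasOrderLTAt a r P) :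
    HasOrderLTAt a r (c • P) := by
  induction r generalizing P with
  | zero =>
    have e : P = 0 := h
    subst e
    rw [smul_zero]
    exact HasOrderLTAt.zero 0
  | succ r ih =>
    intro f
    rw [slotComm_smul]
    exact ih (h f)

theorem HasOrderLTAt.comp {r s : ℕ} {D : Module.End ℝ (Fn n W)} {P : MultiOp 𝓔 k W}
    (h : HasOrderLT r D) (h' : HasOrderLTAt a s P) :
    HasOrderLTAt a (r + s) (D.compMultilinearMap P) := by
  obtain ⟨N, hN⟩ : ∃ N, N = r + s := ⟨_, rfl⟩
  have hz : (0 : Module.End ℝ (Fn n W)).compMultilinearMap P = 0 := by ext; rfl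
  have hz' : D.compMultilinearMap (0 : MultiOp 𝓔 k W) = 0 := by ext; simp
  induction N generalizing r s D P with
  | zero =>
    obtain ⟨rfl, rfl⟩ : r = 0 ∧ s = 0 := by omega
    have e : D = 0 := h
    subst e
    rw [hz]
    exact HasOrderLTAt.zero _
  | succ N ih =>
    rcases r with _ | r
    · have e : D = 0 := h
      subst e
      rw [hz]
      exact HasOrderLTAt.zero _
    rcases s with _ | s
    · have e : P = 0 := h'
      subst e
      rw [hz']
      exact HasOrderLTAt.zero _
    have key : HasOrderLTAt a (r + s + 1 + 1) (D.compMultilinearMap P) := by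
      intro f
      rw [slotComm_comp]
      refine HasOrderLTAt.add ?_ ?_
      · exact ih (r := r) (s := s + 1) (h f) h' (by omega) (by ext; rfl) (by ext; simp)
      · exact (ih (r := r + 1) (s := s) h (h' f) (by omega) (by ext; rfl)
          (by ext; simp)).mono (by omega)
    exact key.mono (by omega)

end OrderLemmas

variable (𝓔) in
/-- Polydifferential operators on `U` with `k` arguments in `ℰ` and values in smooth functions:
morphisms of sheaves `ℰ|_U × ⋯ × ℰ|_U → C^∞_M|_U` which are multilinear over `ℝ`, and locally a
differential operator of finite order in each argument. Equivalently, such an operator is a smooth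
family, locally of finite order, of multilinear forms on the fibres of the jet bundle `J(ℰ)`, i.e.
a section over `U` of the `k`-fold tensor power over `C^∞_M` of `J(ℰ)^∨`. For `k = 0` this is
`C^∞_M(U)`, and for `k = 1` these are the differential operators `ℰ|_U → C^∞_M|_U`. -/
def polyDiffOps (k : ℕ) (U : Opens M) : Submodule ℝ (∀ W : Set.Iic U, MultiOp 𝓔 k W.1) where
  carrier := {P |
    (∀ (V W : Set.Iic U) (h : V.1 ≤ W.1) (φ : Fin k → Fields 𝓔 W.1),
      P V (fun a => Fields.res h (φ a)) = Fn.res h (P W φ)) ∧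
    ∀ x ∈ U, ∃ V : Opens M, x ∈ V ∧ ∃ r : ℕ,
      ∀ W : Set.Iic U, W.1 ≤ V → ∀ a, HasOrderLTAt a r (P W)}
  zero_mem' := ⟨fun V W h φ => by simp, fun x _ => ⟨⊤, trivial, 0, fun W _ a => rfl⟩⟩
  add_mem' := by
    rintro P Q ⟨hP, hr⟩ ⟨hQ, hr'⟩
    refine ⟨fun V W h φ => ?_, fun x hx => ?_⟩
    · simp only [Pi.add_apply, add_apply, hP, hQ, map_add]
    · obtain ⟨V, hV, r, h⟩ := hr x hx
      obtain ⟨V', hV', r', h'⟩ := hr' x hx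
      exact ⟨V ⊓ V', ⟨hV, hV'⟩, r + r', fun W hW a =>
        ((h W (hW.trans inf_le_left) a).mono (by omega)).add
          ((h' W (hW.trans inf_le_right) a).mono (by omega))⟩
  smul_mem' := by
    rintro c P ⟨hP, hr⟩
    refine ⟨fun V W h φ => ?_, fun x hx => ?_⟩
    · simp only [Pi.smul_apply, smul_apply, hP, map_smul]
    · obtain ⟨V, hV, r, h⟩ := hr x hx
      exact ⟨V, hV, r, fun W hW a => (h W hW a).smul c⟩

variable (𝓔) in
/-- Polydifferential operators on `U` with `k` arguments. -/
abbrev PolyDiffOp (k : ℕ) (U : Opens M) : Type u := polyDiffOps 𝓔 k U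

/-- Restriction of polydifferential operators. -/
def PolyDiffOp.res {k : ℕ} {U V : Opens M} (h : V ≤ U) :
    PolyDiffOp 𝓔 k U →ₗ[ℝ] PolyDiffOp 𝓔 k V where
  toFun P := ⟨fun W => P.1 ⟨W.1, le_trans (show W.1 ≤ V from W.2) h⟩,
    fun V' W hVW φ => P.2.1 ⟨V'.1, le_trans (show V'.1 ≤ V from V'.2) h⟩
      ⟨W.1, le_trans (show W.1 ≤ V from W.2) h⟩ hVW φ,
    fun x hx => by
      obtain ⟨V', hV', r, hr⟩ := P.2.2 x (h hx)
      exact ⟨V', hV', r, fun W hW => hr _ hW⟩⟩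
  map_add' _ _ := rfl
  map_smul' _ _ := rfl

/-- Evaluation of a polydifferential operator on `U` on fields on `U`. -/
def PolyDiffOp.app {k : ℕ} {U : Opens M} (P : PolyDiffOp 𝓔 k U) : MultiOp 𝓔 k U :=
  P.1 ⟨U, le_refl U⟩

theorem PolyDiffOp.app_res {k : ℕ} {U V : Opens M} (h : V ≤ U) (P : PolyDiffOp 𝓔 k U)
    (φ : Fin k → Fields 𝓔 U) :
    (PolyDiffOp.res h P).app (fun a => Fields.res h (φ a)) = Fn.res h (P.app φ) :=
  P.2.1 ⟨V, h⟩ ⟨U, le_refl U⟩ h φ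

/-- Polydifferential operators do not enlarge supports. -/
theorem PolyDiffOp.app_eq_zero {k : ℕ} {U : Opens M} (P : PolyDiffOp 𝓔 k U)
    {φ : Fin k → Fields 𝓔 U} {K : Set M} (hK : IsClosed K) (a : Fin k)
    (hφ : ∀ x : U, (x : M) ∉ K → ∀ i, (φ a).1 i x = 0) (x : U) (hx : (x : M) ∉ K) :
    P.app φ x = 0 := by
  let W : Opens M := U ⊓ ⟨Kᶜ, hK.isOpen_compl⟩
  have hW : W ≤ U := inf_le_left
  have h0 : Fields.res hW (φ a) = 0 := by
    ext i y
    exact hφ ⟨y, hW y.2⟩ y.2.2 i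
  have h1 := P.app_res hW φ
  rw [MultilinearMap.map_coord_zero _ a h0] at h1
  have h2 := congrArg (fun g : Fn n W => g ⟨x, x.2, hx⟩) h1
  exact h2.symm

/-- A multilinear map on fields is graded symmetric if exchanging two neighbouring homogeneous
arguments of degrees `p` and `q` multiplies the value by the Koszul sign `(-1)^{pq}`. -/
def GradedSymmetric {k : ℕ} {U : Opens M} {X : Type*} [AddCommGroup X]
    (P : (Fin k → Fields 𝓔 U) → X) : Prop :=
  ∀ (a b : Fin k), (b : ℕ) = a + 1 → ∀ (p q : ℤ) (φ : Fin k → Fields 𝓔 U),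
    IsHomogeneous p (φ a) → IsHomogeneous q (φ b) →
      P (φ ∘ Equiv.swap a b) = ((p * q).negOnePow : ℤ) • P φ

variable (𝓔) in
/-- `Sym^k_{C^∞_M} J(ℰ)^∨` over `U`: graded symmetric polydifferential operators in `k`
arguments. -/
def SymPolyDiffOp (k : ℕ) (U : Opens M) : Submodule ℝ (PolyDiffOp 𝓔 k U) where
  carrier := {P | ∀ W : Set.Iic U, GradedSymmetric (P.1 W)}
  zero_mem' := by
    intro W a b hab p q φ hp hq
    simp
  add_mem' := by
    intro P Q hP hQ W a b hab p q φ hp hq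
    have h1 := hP W a b hab p q φ hp hq
    have h2 := hQ W a b hab p q φ hp hq
    simp only [Submodule.coe_add, Pi.add_apply, add_apply, smul_add]
    rw [h1, h2]
  smul_mem' := by
    intro c P hP W a b hab p q φ hp hq
    have h1 := hP W a b hab p q φ hp hq
    simp only [Submodule.coe_smul, Pi.smul_apply, smul_apply]
    rw [h1, smul_comm]

instance (k : ℕ) (U : Opens M) : AddCommGroup (SymPolyDiffOp 𝓔 k U) :=
  Submodule.addCommGroup (M := PolyDiffOp 𝓔 k U) _

variable (𝓔) in
/-- Functions on jets, `𝒪(J(ℰ))(U) = ∏_{k ≥ 0} Sym^k_{C^∞_M} J(ℰ)^∨ (U)`. -/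
def JetFn (U : Opens M) : Type u := ∀ k : ℕ, SymPolyDiffOp 𝓔 k U

instance (U : Opens M) : AddCommGroup (JetFn 𝓔 U) :=
  inferInstanceAs (AddCommGroup (∀ k : ℕ, SymPolyDiffOp 𝓔 k U))

instance (U : Opens M) : Module ℝ (JetFn 𝓔 U) :=
  inferInstanceAs (Module ℝ (∀ k : ℕ, SymPolyDiffOp 𝓔 k U))

/-- Restriction of functions on jets. -/
def JetFn.res {U V : Opens M} (h : V ≤ U) : JetFn 𝓔 U →ₗ[ℝ] JetFn 𝓔 V where
  toFun P k := ⟨PolyDiffOp.res h (P k).1,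
    fun W => (P k).2 ⟨W.1, le_trans (show W.1 ≤ V from W.2) h⟩⟩
  map_add' _ _ := rfl
  map_smul' _ _ := rfl

/-- The left action of a differential operator on polydifferential operators, by composition:
`(D · P)(φ_1, …, φ_k) = D (P(φ_1, …, φ_k))`. -/
def PolyDiffOp.lmul {k : ℕ} {U : Opens M} (D : DiffOp n U) (P : PolyDiffOp 𝓔 k U) :
    PolyDiffOp 𝓔 k U :=
  ⟨fun W => LinearMap.compMultilinearMap (D.1 W) (P.1 W),
    fun V W h φ => by
      simp only [LinearMap.compMultilinearMap_apply]
      rw [P.2.1 V W h φ, D.2.1 V W h],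
    fun x hx => by
      obtain ⟨V, hV, r, h⟩ := D.2.2 x hx
      obtain ⟨V', hV', r', h'⟩ := P.2.2 x hx
      exact ⟨V ⊓ V', ⟨hV, hV'⟩, r + r', fun W hW a =>
        HasOrderLTAt.comp (h W (hW.trans inf_le_left)) (h' W (hW.trans inf_le_right) a)⟩⟩

/-- The left action of `D_M(U)` on functions on jets. -/
def JetFn.lmul {U : Opens M} (D : DiffOp n U) (P : JetFn 𝓔 U) : JetFn 𝓔 U :=
  fun k => ⟨PolyDiffOp.lmul D (P k).1, by
    intro W a b hab p q φ hp hq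
    have h1 := (P k).2 W a b hab p q φ hp hq
    change D.1 W ((P k).1.1 W _) = _ • D.1 W ((P k).1.1 W φ)
    rw [h1, map_zsmul]⟩

theorem JetFn.res_lmul {U V : Opens M} (h : V ≤ U) (D : DiffOp n U) (P : JetFn 𝓔 U) :
    JetFn.res h (JetFn.lmul D P) = JetFn.lmul (D.res h) (JetFn.res h P) := rfl

/-! ### Local functionals -/

variable (𝓔) in
/-- `ℰ_c(U)`: fields on `U` with compact support in `U` (the support may meet the boundary). -/
def CFields (U : Opens M) : Submodule ℝ (Fields 𝓔 U) where
  carrier := {φ | ∃ K : Set M, IsCompact K ∧ K ⊆ U ∧ ∀ x : U, (x : M) ∉ K → ∀ i, φ.1 i x = 0}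
  zero_mem' := ⟨∅, isCompact_empty, Set.empty_subset _, fun _ _ _ => rfl⟩
  add_mem' := by
    rintro f g ⟨K, hK, hKU, hf⟩ ⟨L, hL, hLU, hg⟩
    refine ⟨K ∪ L, hK.union hL, Set.union_subset hKU hLU, fun x hx i => ?_⟩
    simp only [Set.mem_union, not_or] at hx
    simp [hf x hx.1 i, hg x hx.2 i]
  smul_mem' := by
    rintro c f ⟨K, hK, hKU, hf⟩
    exact ⟨K, hK, hKU, fun x hx i => by simp [hf x hx i]⟩

variable [T2Space M]

/-- Extension by zero `ℰ_c(V) → ℰ_c(U)` for `V ⊆ U`. -/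
def CFields.ext {U V : Opens M} (h : V ≤ U) : CFields 𝓔 V →ₗ[ℝ] CFields 𝓔 U where
  toFun φ := ⟨⟨fun i x => vecZext 𝓔 (φ.1.1 i) x, by
      obtain ⟨K, hK, hKV, hφ⟩ := φ.2
      intro i x hxU
      refine ContMDiffAt.contMDiffWithinAt ?_
      by_cases hx : x ∈ V
      · have h1 := (φ.1.2 i).contMDiffAt (V.isOpen.mem_nhds hx)
        refine h1.congr_of_eventuallyEq ?_
        filter_upwards [V.isOpen.mem_nhds hx] with y hy
        have hy' : y ∈ V := hy
        simp [vecZext, hy', h hy']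
      · have hx' : x ∈ Kᶜ := fun hxK => hx (hKV hxK)
        refine (Bundle.contMDiffAt_zeroSection ℝ (𝓔.E i)).congr_of_eventuallyEq ?_
        filter_upwards [hK.isClosed.isOpen_compl.mem_nhds hx', U.isOpen.mem_nhds hxU] with y hy hyU
        have hyU' : y ∈ U := hyU
        by_cases hyV : y ∈ V
        · simp [vecZext, hyV, hyU', Bundle.zeroSection, hφ ⟨y, hyV⟩ hy i]
        · simp [vecZext, hyV, hyU', Bundle.zeroSection]⟩, by
      obtain ⟨K, hK, hKV, hφ⟩ := φ.2
      refine ⟨K, hK, hKV.trans h, fun x hx i => ?_⟩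
      by_cases hxV : (x : M) ∈ V
      · simpa [vecZext, hxV] using hφ ⟨x, hxV⟩ hx i
      · simp [vecZext, hxV]⟩
  map_add' φ ψ := by
    ext i x
    change vecZext 𝓔 (φ.1.1 i + ψ.1.1 i) x = vecZext 𝓔 (φ.1.1 i) x + vecZext 𝓔 (ψ.1.1 i) x
    by_cases hxV : (x : M) ∈ V <;> simp [vecZext, hxV]
  map_smul' c φ := by
    ext i x
    change vecZext 𝓔 (c • φ.1.1 i) x = c • vecZext 𝓔 (φ.1.1 i) x
    by_cases hxV : (x : M) ∈ V <;> simp [vecZext, hxV]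

@[simp] theorem CFields.ext_apply {U V : Opens M} (h : V ≤ U) (φ : CFields 𝓔 V) (i : 𝓔.ι)
    (x : U) : (CFields.ext h φ).1.1 i x = vecZext 𝓔 (φ.1.1 i) x := rfl

theorem CFields.res_ext {U V : Opens M} (h : V ≤ U) (φ : CFields 𝓔 V) :
    Fields.res h (CFields.ext h φ).1 = φ.1 := by
  ext i x
  change vecZext 𝓔 (φ.1.1 i) x = φ.1.1 i x
  simp [vecZext]

theorem CFields.ext_refl {U : Opens M} (φ : CFields 𝓔 U) :
    CFields.ext (le_refl U) φ = φ := by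
  ext i x
  simp [vecZext]

theorem CFields.ext_ext {U V W : Opens M} (h : V ≤ U) (h' : W ≤ V) (φ : CFields 𝓔 W) :
    CFields.ext h (CFields.ext h' φ) = CFields.ext (h'.trans h) φ := by
  ext i x
  simp only [CFields.ext_apply]
  by_cases hxV : (x : M) ∈ V
  · simp [vecZext, hxV]
  · have hxW : (x : M) ∉ W := fun hx => hxV (h' hx)
    simp [vecZext, hxV, hxW]

theorem CFields.isHomogeneous_ext {U V : Opens M} (h : V ≤ U) {φ : CFields 𝓔 V} {d : ℤ}
    (hφ : IsHomogeneous d φ.1) : IsHomogeneous d (CFields.ext h φ).1 := by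
  intro i hi
  funext x
  have h0 := hφ i hi
  simp [vecZext, h0]

/-- A polydifferential operator with at least one argument, applied to compactly supported
fields, gives a test function. -/
def PolyDiffOp.testFn {k : ℕ} {U : Opens M} (P : PolyDiffOp 𝓔 (k + 1) U)
    (φ : Fin (k + 1) → CFields 𝓔 U) : TestFn n U :=
  ⟨P.app fun a => (φ a).1, by
    obtain ⟨K, hK, hKU, hφ⟩ := (φ 0).2
    exact ⟨K, hK, hKU, P.app_eq_zero hK.isClosed 0 hφ⟩⟩

theorem PolyDiffOp.testFn_ext {k : ℕ} {U V : Opens M} (h : V ≤ U)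
    (P : PolyDiffOp 𝓔 (k + 1) U) (φ : Fin (k + 1) → CFields 𝓔 V) :
    P.testFn (fun a => CFields.ext h (φ a)) = TestFn.ext h ((PolyDiffOp.res h P).testFn φ) := by
  apply Subtype.ext
  ext x
  rw [TestFn.ext_apply]
  change P.app (fun a => (CFields.ext h (φ a)).1) x =
    Fn.zext ((PolyDiffOp.res h P).app fun a => (φ a).1) x
  by_cases hx : (x : M) ∈ V
  · have h1 := P.app_res h (fun a => (CFields.ext h (φ a)).1)
    simp only [CFields.res_ext] at h1
    have h2 := congrArg (fun g : Fn n V => g ⟨x, hx⟩) h1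
    simpa [Fn.zext, hx] using h2.symm
  · obtain ⟨K, hK, hKV, hφ⟩ := (φ 0).2
    have h3 : P.app (fun a => (CFields.ext h (φ a)).1) x = 0 := by
      refine P.app_eq_zero hK.isClosed 0 (fun y hy i => ?_) x (fun hxK => hx (hKV hxK))
      by_cases hyV : (y : M) ∈ V
      · simpa [vecZext, hyV] using hφ ⟨y, hyV⟩ hy i
      · simp [vecZext, hyV]
    simpa [Fn.zext, hx] using h3

variable (𝓔) in
/-- Multilinear functionals of `k` compactly supported fields on `U`. -/
abbrev Functional (k : ℕ) (U : Opens M) : Type u :=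
  MultilinearMap ℝ (fun _ : Fin k => CFields 𝓔 U) ℝ

/-- Restriction of functionals to compactly supported fields on a smaller open set. -/
def Functional.res {k : ℕ} {U V : Opens M} (h : V ≤ U) :
    Functional 𝓔 k U →ₗ[ℝ] Functional 𝓔 k V where
  toFun I := I.compLinearMap fun _ => CFields.ext h
  map_add' _ _ := rfl
  map_smul' _ _ := rfl

@[simp] theorem Functional.res_apply {k : ℕ} {U V : Opens M} (h : V ≤ U) (I : Functional 𝓔 k U)
    (φ : Fin k → CFields 𝓔 V) :
    Functional.res h I φ = I (fun a => CFields.ext h (φ a)) := rfl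

variable (𝓔) in
/-- The (polarized) functionals `(φ_0, …, φ_k) ↦ ∫_U (D_0 φ_0) ⋯ (D_k φ_k) dμ`, where
`D_0, …, D_k : ℰ → C^∞_M` are differential operators on `U` and `dμ` is a smooth density on `U`. -/
def basicLocal (k : ℕ) (U : Opens M) : Set (Functional 𝓔 (k + 1) U) :=
  {I | ∃ (μ : Distribution n U) (D : Fin (k + 1) → PolyDiffOp 𝓔 1 U), IsSmoothDensity μ ∧
    ∀ φ : Fin (k + 1) → CFields 𝓔 U, ∃ g : TestFn n U,
      g.1 = ∏ a, (D a).app (fun _ => (φ a).1) ∧ I φ = μ.1 g}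

theorem basicLocal_res {k : ℕ} {U V : Opens M} (h : V ≤ U) {I : Functional 𝓔 (k + 1) U}
    (hI : I ∈ basicLocal 𝓔 k U) : Functional.res h I ∈ basicLocal 𝓔 k V := by
  obtain ⟨μ, D, hμ, hI⟩ := hI
  refine ⟨Distribution.res h μ, fun a => PolyDiffOp.res h (D a), hμ.res h, fun φ => ?_⟩
  obtain ⟨g, hg, hIg⟩ := hI fun a => CFields.ext h (φ a)
  have hD : ∀ a, (D a).app (fun _ => (CFields.ext h (φ a)).1) =
      (TestFn.ext h ((PolyDiffOp.res h (D a)).testFn fun _ => φ a)).1 := fun a =>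
    congrArg Subtype.val ((D a).testFn_ext h fun _ => φ a)
  obtain ⟨K, hK, hKV, h0⟩ := ((PolyDiffOp.res h (D 0)).testFn fun _ => φ 0).2
  let g' : TestFn n V := ⟨∏ a, ((PolyDiffOp.res h (D a)).testFn fun _ => φ a).1, K, hK, hKV,
    fun x hx => by
      rw [Fin.prod_univ_succ]
      simp [h0 x hx]⟩
  have hgg : g = TestFn.ext h g' := by
    apply Subtype.ext
    rw [hg]
    ext x
    rw [TestFn.ext_apply]
    have hprod : ∀ {X : Opens M} (F : Fin (k + 1) → Fn n X) (y : X),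
        (∏ a, F a) y = ∏ a, F a y := by
      intro X F y
      exact map_prod ((Pi.evalRingHom (fun _ : X => ℝ) y).comp ContMDiffMap.coeFnRingHom) F _
    rw [hprod]
    by_cases hx : (x : M) ∈ V
    · simp only [hD, TestFn.ext_apply, Fn.zext, hx, dif_pos]
      exact (hprod _ _).symm
    · simp only [hD, TestFn.ext_apply, Fn.zext, hx]
      simp
  refine ⟨g', rfl, ?_⟩
  rw [Functional.res_apply, hIg, hgg, Distribution.res_apply]

variable (𝓔) in
/-- The homogeneous local functionals on `U` of polynomial degree `k + 1` in the fields (the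
sections over `U` of the sheaf they form): graded symmetric multilinear functionals on `ℰ_c(U)`
which vanish on tuples of fields whose supports have no common point, and which, near every point
of `U`, are finite linear combinations of functionals `∫ (D_0 φ_0) ⋯ (D_k φ_k) dμ`. -/
def LocalFunctional (k : ℕ) (U : Opens M) : Submodule ℝ (Functional 𝓔 (k + 1) U) where
  carrier := {I |
    (∀ (a b : Fin (k + 1)), (b : ℕ) = a + 1 → ∀ (p q : ℤ) (φ : Fin (k + 1) → CFields 𝓔 U),
      IsHomogeneous p (φ a).1 → IsHomogeneous q (φ b).1 →
        I (φ ∘ Equiv.swap a b) = ((p * q).negOnePow : ℤ) • I φ) ∧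
    (∀ φ : Fin (k + 1) → CFields 𝓔 U,
      (∀ x ∈ U, ∃ a, ∃ W : Opens M, x ∈ W ∧ ∀ y : U, (y : M) ∈ W → ∀ i, (φ a).1.1 i y = 0) →
        I φ = 0) ∧
    ∀ x ∈ U, ∃ (V : Opens M) (h : V ≤ U), x ∈ V ∧
      Functional.res h I ∈ Submodule.span ℝ (basicLocal 𝓔 k V)}
  zero_mem' := ⟨fun _ _ _ _ _ _ _ _ => by simp, fun _ _ => rfl,
    fun x hx => ⟨U, le_refl U, hx, by rw [map_zero]; exact zero_mem _⟩⟩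
  add_mem' := by
    rintro I J ⟨hI1, hI2, hI3⟩ ⟨hJ1, hJ2, hJ3⟩
    refine ⟨fun a b hab p q φ hp hq => ?_, fun φ hφ => ?_, fun x hx => ?_⟩
    · rw [add_apply, add_apply, hI1 a b hab p q φ hp hq,
        hJ1 a b hab p q φ hp hq, smul_add]
    · rw [add_apply, hI2 φ hφ, hJ2 φ hφ, add_zero]
    · obtain ⟨V, hV, hxV, hI⟩ := hI3 x hx
      obtain ⟨V', hV', hxV', hJ⟩ := hJ3 x hx
      have hres : ∀ {V W : Opens M} (h : V ≤ U) (h' : W ≤ V) (L : Functional 𝓔 (k + 1) U),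
          Functional.res h L ∈ Submodule.span ℝ (basicLocal 𝓔 k V) →
          Functional.res (h'.trans h) L ∈ Submodule.span ℝ (basicLocal 𝓔 k W) := by
        intro V W h h' L hL
        have h1 : Functional.res (h'.trans h) L = Functional.res h' (Functional.res h L) := by
          ext φ
          simp [CFields.ext_ext]
        rw [h1]
        have h2 := Submodule.mem_map_of_mem (f := Functional.res h') hL
        rw [Submodule.map_span] at h2
        refine Submodule.span_mono ?_ h2
        rintro _ ⟨L', hL', rfl⟩
        exact basicLocal_res h' hL'
      refine ⟨V ⊓ V', inf_le_left.trans hV, ⟨hxV, hxV'⟩, ?_⟩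
      rw [map_add]
      exact add_mem (hres hV inf_le_left I hI) (hres hV' inf_le_right J hJ)
  smul_mem' := by
    rintro c I ⟨hI1, hI2, hI3⟩
    refine ⟨fun a b hab p q φ hp hq => ?_, fun φ hφ => ?_, fun x hx => ?_⟩
    · rw [smul_apply, smul_apply, hI1 a b hab p q φ hp hq,
        smul_comm]
    · rw [smul_apply, hI2 φ hφ, smul_zero]
    · obtain ⟨V, hV, hxV, hI⟩ := hI3 x hx
      exact ⟨V, hV, hxV, by rw [map_smul]; exact Submodule.smul_mem _ c hI⟩

theorem LocalFunctional.res_mem {k : ℕ} {U V : Opens M} (h : V ≤ U)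
    {I : Functional 𝓔 (k + 1) U} (hI : I ∈ LocalFunctional 𝓔 k U) :
    Functional.res h I ∈ LocalFunctional 𝓔 k V := by
  obtain ⟨hI1, hI2, hI3⟩ := hI
  refine ⟨fun a b hab p q φ hp hq => ?_, fun φ hφ => ?_, fun x hx => ?_⟩
  · exact hI1 a b hab p q (fun a => CFields.ext h (φ a)) (CFields.isHomogeneous_ext h hp)
      (CFields.isHomogeneous_ext h hq)
  · refine hI2 _ fun x _ => ?_
    by_cases hx : x ∈ V
    · obtain ⟨a, W, hxW, hW⟩ := hφ x hx
      refine ⟨a, W ⊓ V, ⟨hxW, hx⟩, fun y hy i => ?_⟩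
      have hyV : (y : M) ∈ V := hy.2
      simpa [vecZext, hyV] using hW ⟨y, hyV⟩ hy.1 i
    · obtain ⟨K, hK, hKV, h0⟩ := (φ 0).2
      refine ⟨0, ⟨Kᶜ, hK.isClosed.isOpen_compl⟩, fun hxK => hx (hKV hxK), fun y hy i => ?_⟩
      by_cases hyV : (y : M) ∈ V
      · simpa [vecZext, hyV] using h0 ⟨y, hyV⟩ hy i
      · simp [vecZext, hyV]
  · obtain ⟨W, hW, hxW, hIW⟩ := hI3 x (h hx)
    refine ⟨W ⊓ V, inf_le_right, ⟨hxW, hx⟩, ?_⟩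
    have h1 : Functional.res (inf_le_right : W ⊓ V ≤ V) (Functional.res h I) =
        Functional.res (inf_le_left : W ⊓ V ≤ W) (Functional.res hW I) := by
      ext φ
      simp [CFields.ext_ext]
    rw [h1]
    have h2 := Submodule.mem_map_of_mem (f := Functional.res (inf_le_left : W ⊓ V ≤ W)) hIW
    rw [Submodule.map_span] at h2
    refine Submodule.span_mono ?_ h2
    rintro _ ⟨L', hL', rfl⟩
    exact basicLocal_res _ hL'

/-! ### The two presheaves -/

variable (𝓔) in
/-- The relations `(w · D) ⊗ P = w ⊗ (D · P)` of the tensor product over `D_M(U)`. -/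
def tensorRelations (U : Opens M) : Submodule ℝ (BdrySmoothDensity n U ⊗[ℝ] JetFn 𝓔 U) :=
  Submodule.span ℝ {t | ∃ (w : BdrySmoothDensity n U) (D : DiffOp n U) (P : JetFn 𝓔 U),
    t = (w.rmul D) ⊗ₜ[ℝ] P - w ⊗ₜ[ℝ] (JetFn.lmul D P)}

variable (𝓔) in
/-- The tensor product over `D_M(U)` of the `∂`-smooth densities on `U` and the functions on jets
on `U`. -/
abbrev DTensor (U : Opens M) : Type u :=
  (BdrySmoothDensity n U ⊗[ℝ] JetFn 𝓔 U) ⧸ tensorRelations 𝓔 U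

variable (𝓔) in
/-- The pure tensor `w ⊗ P` in the tensor product over `D_M(U)`. -/
def DTensor.tmul {U : Opens M} (w : BdrySmoothDensity n U) (P : JetFn 𝓔 U) : DTensor 𝓔 U :=
  Submodule.Quotient.mk (w ⊗ₜ[ℝ] P)

/-- Restriction in the tensor product. -/
def DTensor.res {U V : Opens M} (h : V ≤ U) : DTensor 𝓔 U →ₗ[ℝ] DTensor 𝓔 V :=
  Submodule.mapQ _ _ (TensorProduct.map (BdrySmoothDensity.res h) (JetFn.res h)) (by
    refine Submodule.span_le.2 ?_
    rintro _ ⟨w, D, P, rfl⟩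
    refine Submodule.subset_span ⟨BdrySmoothDensity.res h w, D.res h, JetFn.res h P, ?_⟩
    rw [map_sub, TensorProduct.map_tmul, TensorProduct.map_tmul, JetFn.res_lmul]
    congr 2
    exact Subtype.ext (Distribution.res_rmul h w.1 D))

theorem DTensor.hom_ext {U : Opens M} {X : Type*} [AddCommGroup X] [Module ℝ X]
    {f g : DTensor 𝓔 U →ₗ[ℝ] X}
    (h : ∀ w P, f (DTensor.tmul 𝓔 w P) = g (DTensor.tmul 𝓔 w P)) : f = g :=
  Submodule.linearMap_qext _ (TensorProduct.ext' h)

theorem DTensor.res_tmul {U V : Opens M} (h : V ≤ U) (w : BdrySmoothDensity n U)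
    (P : JetFn 𝓔 U) : DTensor.res h (DTensor.tmul 𝓔 w P) =
      DTensor.tmul 𝓔 (BdrySmoothDensity.res h w) (JetFn.res h P) := rfl

open CategoryTheory Opposite

variable (𝓔) in
/-- The presheaf `U ↦ Ω^{n,n-1}_{M,tw}(U) ⊗_{D_M(U)} 𝒪(J(ℰ))(U)`; its sheafification is the sheaf
tensor product over `D_M`. -/
def tensorPresheaf : (Opens M)ᵒᵖ ⥤ ModuleCat.{u} ℝ where
  obj U := ModuleCat.of ℝ (DTensor 𝓔 U.unop)
  map f := ModuleCat.ofHom (DTensor.res (leOfHom f.unop))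
  map_id U := by
    apply ModuleCat.hom_ext
    apply DTensor.hom_ext
    intro w P
    refine (DTensor.res_tmul _ w P).trans ?_
    have h1 : BdrySmoothDensity.res (le_refl U.unop) w = w := by
      apply Subtype.ext
      apply Subtype.ext
      apply LinearMap.ext
      intro f
      simp [TestFn.ext_refl]
    exact congrArg (fun t => DTensor.tmul 𝓔 t P) h1
  map_comp {U V W} f g := by
    apply ModuleCat.hom_ext
    apply DTensor.hom_ext
    intro w P
    refine (DTensor.res_tmul _ w P).trans ?_
    refine Eq.trans ?_ (congrArg (DTensor.res (leOfHom g.unop))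
      (DTensor.res_tmul (leOfHom f.unop) w P)).symm
    rw [DTensor.res_tmul]
    have h1 : BdrySmoothDensity.res (leOfHom (f ≫ g).unop) w =
        BdrySmoothDensity.res (leOfHom g.unop) (BdrySmoothDensity.res (leOfHom f.unop) w) := by
      apply Subtype.ext
      apply Subtype.ext
      apply LinearMap.ext
      intro f
      simp [TestFn.ext_ext]
    rw [h1]
    rfl

variable (𝓔) in
/-- Local functionals modulo constant functionals, as a presheaf on `M`: over `U`, these are the
formal power series on `ℰ_c(U)` without constant term all of whose homogeneous components are
local functionals. -/
def localFunctionals : (Opens M)ᵒᵖ ⥤ ModuleCat.{u} ℝ where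
  obj U := ModuleCat.of ℝ (∀ k : ℕ, LocalFunctional 𝓔 k U.unop)
  map f := ModuleCat.ofHom (LinearMap.pi fun k =>
    ((Functional.res (leOfHom f.unop)).restrict fun _ hI =>
      LocalFunctional.res_mem (leOfHom f.unop) hI) ∘ₗ LinearMap.proj k)
  map_id U := by
    apply ModuleCat.hom_ext
    apply LinearMap.ext
    intro I
    funext k
    apply Subtype.ext
    apply MultilinearMap.ext
    intro φ
    change (I k).1 (fun a => CFields.ext _ (φ a)) = (I k).1 φ
    simp only [CFields.ext_refl]
  map_comp f g := by
    apply ModuleCat.hom_ext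
    apply LinearMap.ext
    intro I
    funext k
    apply Subtype.ext
    apply MultilinearMap.ext
    intro φ
    change (I k).1 (fun a => CFields.ext _ (φ a)) =
      (I k).1 (fun a => CFields.ext _ (CFields.ext _ (φ a)))
    simp only [CFields.ext_ext]

end Fields

end BoundaryDMod

end

/-!
The target is a sheaf because a local functional is supported on the diagonal. If `χ` is a partition
of unity and `ψ i` is one near the support of `χ i`, then such a functional satisfies
`I(φ_0, …, φ_k) = ∑ i, I(χ_i φ_0, ψ_i φ_1, …, ψ_i φ_k)`. Hence it is determined by its restrictions to
the members of a cover (`DiagonalSupport.eq_zero_of_local`), and compatible functionals on these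
members are glued by the same formula (`BumpPartition.glue`, `BumpPartition.res_glue`,
`isSheaf_localFunctionals`).

For the map `w ⊗ P ↦ (φ ↦ w(P_k(φ)))`, work near a point, in a chart with boundary coordinate `x_0`
and coordinate density `dx`. The distributions which are locally of the form `dx · D` with a differential
operator `D` form a subsheaf of right modules containing all smooth densities, so every `∂`-smooth
density has this form (`MChart.exists_eq_dx_rmul`), and every element of the tensor product is locally
a pure tensor `dx ⊗ P` (`DTensor.exists_res_eq_tmul`). Over a local frame, a polydifferential operator
of bounded order is a finite sum of products of differential operators in one argument
(`PolyDiffOp.mem_sumsOfProducts`), so the values of the map are local functionals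
(`DTensor.functional_mem`). It remains to show that the map is locally surjective and locally
injective.

*Surjectivity.* Near each point the `k`-th component of a local functional is `φ ↦ ∫ P(φ) dx` for some
polydifferential operator `P`, but the size of the neighbourhood depends on `k`. On a fixed relatively
compact set the operators are glued by a partition of unity (`PolyDiffOp.exists_eq_pairing_of_cover`),
and graded symmetrization makes the result graded symmetric without changing the functional
(`LocalFunctional.exists_eq_pairing`).

*Injectivity.* Suppose that `∫ P(φ) dx = 0` for all compactly supported `φ`. By induction on the order of
`P` in its first argument, integration by parts gives `P = L + ∑ i, ∂_i ∘ Q_i`, where `L` is linear over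
the smooth functions in the first argument. The underlying identity is that of the Euler operator of a
Weyl algebra (`exists_eq_add_sum_range`). For arguments supported in the interior only `L` contributes
to the integral. Its values may be multiplied by arbitrary polynomials in the coordinates, so they
vanish by the Stone–Weierstrass theorem, and `L = 0` (`PolyDiffOp.eq_zero_of_integral`). What remains of
the hypothesis is that the boundary integrals of `Q_0` vanish. A second integration by parts, in the
tangential directions, gives `Q_0 = R + ∑ i ≠ 0, ∂_i ∘ S_i`, where `R` is linear over the tangential
coordinates in its first argument. The values of `R` vanish on the boundary, again by the
Stone–Weierstrass theorem (`PolyDiffOp.eq_zero_of_boundary_integral`), so `R = x_0 R'` by Hadamard's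
lemma. Altogether
`P = ∂_0 x_0 ∘ R' + ∑ i ≠ 0, ∂_i ∘ Q_i + ∑ i ≠ 0, ∂_0 ∂_i ∘ S_i`
(`PolyDiffOp.exists_eq_sum_lmul`). Each operator `D` among `∂_0 x_0`, `∂_i` and `∂_0 ∂_i` with `i ≠ 0`
satisfies `dx · D = 0`, so `dx ⊗ P = 0`. In degree zero there is no condition, and indeed every
function is locally of the form `∂_0 (x_0 g)`. On a relatively compact set the order of each component
is bounded, so that all degrees can be treated on the same neighbourhood
(`DTensor.exists_res_eq_zero`).
-/

noncomputable section

namespace BoundaryDMod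

/-! ### Integration by parts in a Weyl algebra

In the applications `X` consists of polydifferential operators and, for one fixed argument, `c j` is
the commutator with the coordinate `x_j`, `n j` is composition with `∂_j` in that argument, and
`d j` is composition of the values with `∂_j`. -/

section Weyl

variable {X : Type*} [AddCommGroup X] [Module ℝ X] {J : Type*} (c : J → Module.End ℝ X)

/-- The vectors killed by all `r`-fold products of the operators `c j`, that is, the operators of
order less than `r`. -/
def killed : ℕ → Submodule ℝ X
  | 0 => ⊥
  | r + 1 => ⨅ j, (killed r).comap (c j)

variable {c}

theorem mem_killed_zero {P : X} : P ∈ killed c 0 ↔ P = 0 := Submodule.mem_bot ℝ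

theorem mem_killed_succ {r : ℕ} {P : X} : P ∈ killed c (r + 1) ↔ ∀ j, c j P ∈ killed c r := by
  simp [killed]

theorem mem_killed_one {P : X} : P ∈ killed c 1 ↔ ∀ j, c j P = 0 := by
  simp [mem_killed_succ, mem_killed_zero]

theorem killed_le_succ (r : ℕ) : killed c r ≤ killed c (r + 1) := by
  induction r with
  | zero => exact bot_le
  | succ r ih =>
    intro P hP
    exact mem_killed_succ.2 fun j => ih (mem_killed_succ.1 hP j)

theorem killed_le_comp {J' : Type*} (f : J' → J) (r : ℕ) : killed c r ≤ killed (c ∘ f) r := by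
  induction r with
  | zero => exact le_rfl
  | succ r ih =>
    intro P hP
    exact mem_killed_succ.2 fun j => ih (mem_killed_succ.1 hP (f j))

theorem killed_of_commute {A : Module.End ℝ X} (hA : ∀ j, A * c j = c j * A) {r : ℕ} {P : X}
    (hP : P ∈ killed c r) : A P ∈ killed c r := by
  induction r generalizing P with
  | zero =>
    rw [mem_killed_zero] at hP ⊢
    rw [hP, map_zero]
  | succ r ih =>
    refine mem_killed_succ.2 fun j => ?_
    have h := ih (mem_killed_succ.1 hP j)
    rwa [← Module.End.mul_apply, hA j] at h

variable [Fintype J] [DecidableEq J] {n d : J → Module.End ℝ X}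

/-- The Euler operator `∑ n_j c_j` acts as `-r` on elements of order `r`, up to elements of lower
order. -/
theorem euler_add_mem_killed (hc : ∀ i j, c i * c j = c j * c i)
    (hn : ∀ i j, n i * c j - c j * n i = if i = j then 1 else 0) {r : ℕ} {P : X}
    (hP : P ∈ killed c (r + 1)) : (∑ i, n i (c i P)) + (r : ℝ) • P ∈ killed c r := by
  induction r generalizing P with
  | zero =>
    rw [mem_killed_one] at hP
    simp [hP]
  | succ r ih =>
    refine mem_killed_succ.2 fun j => ?_
    have h := ih (mem_killed_succ.1 hP j)
    have h1 : ∀ i, c j (n i (c i P)) = n i (c i (c j P)) - if i = j then c j P else 0 := by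
      intro i
      have h2 := congrArg (fun A : Module.End ℝ X => A (c i P)) (hn i j)
      have h3 := congrArg (fun A : Module.End ℝ X => n i (A P)) (hc i j)
      simp only [LinearMap.sub_apply, Module.End.mul_apply] at h2 h3
      rw [h3]
      split_ifs at h2 ⊢ with hij
      · subst hij
        simp only [Module.End.one_apply] at h2
        exact eq_sub_of_add_eq ((add_comm _ _).trans (sub_eq_iff_eq_add.1 h2).symm)
      · simp only [LinearMap.zero_apply] at h2
        rw [sub_eq_zero.1 h2, sub_zero]
    have h4 : c j ((∑ i, n i (c i P)) + ((r + 1 : ℕ) : ℝ) • P) =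
        (∑ i, n i (c i (c j P))) + (r : ℝ) • c j P := by
      simp only [map_add, map_sum, h1, Finset.sum_sub_distrib, Finset.sum_ite_eq',
        Finset.mem_univ, if_true, map_smul]
      push_cast
      rw [add_smul, one_smul]
      abel
    rwa [h4]

/-- Integration by parts: modulo the ranges of the `d j`, an element of finite order is equivalent
to one which commutes with all coordinates. -/
theorem exists_eq_add_sum_range (hc : ∀ i j, c i * c j = c j * c i)
    (hn : ∀ i j, n i * c j - c j * n i = if i = j then 1 else 0)
    (hd : ∀ i j, d i * c j - c j * d i = if i = j then 1 else 0) {r : ℕ} {P : X}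
    (hP : P ∈ killed c (r + 1)) :
    ∃ (L : X) (Q : J → X), L ∈ killed c 1 ∧ (∀ i, Q i ∈ killed c r) ∧
      P = L + ∑ i, d i (Q i) := by
  induction r generalizing P with
  | zero => exact ⟨P, 0, hP, fun i => zero_mem _, by simp⟩
  | succ r ih =>
    -- The Euler operator expresses `P` by `∑ n_i c_i P` up to lower order. As `d_i - n_i` commutes
    -- with all `c_j`, replacing `n_i` by `d_i` again costs only terms of lower order.
    have h1 := euler_add_mem_killed hc hn hP
    have h2 : ∑ i, (d i - n i) (c i P) ∈ killed c (r + 1) := by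
      refine sum_mem fun i _ => killed_of_commute (fun j => ?_) (mem_killed_succ.1 hP i)
      have h3 := (hd i j).trans (hn i j).symm
      rw [sub_mul, mul_sub]
      rw [sub_eq_sub_iff_add_eq_add] at h3 ⊢
      rw [h3]
      abel
    obtain ⟨L, Q, hL, hQ, hPQ⟩ := ih (Submodule.smul_mem _ ((r + 1 : ℕ) : ℝ)⁻¹ (add_mem h1 h2))
    refine ⟨L, fun i => Q i - ((r + 1 : ℕ) : ℝ)⁻¹ • c i P, hL, fun i =>
      sub_mem (killed_le_succ _ (hQ i)) (Submodule.smul_mem _ _ (mem_killed_succ.1 hP i)), ?_⟩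
    have hr : ((r + 1 : ℕ) : ℝ) ≠ 0 := Nat.cast_ne_zero.2 (Nat.succ_ne_zero r)
    simp only [map_sub, Finset.sum_sub_distrib, ← add_sub_assoc]
    rw [← hPQ]
    simp only [LinearMap.sub_apply, Finset.sum_sub_distrib, map_smul, ← Finset.smul_sum]
    rw [← smul_sub, show (∑ i, n i (c i P)) + ((r + 1 : ℕ) : ℝ) • P +
      (∑ i, d i (c i P) - ∑ i, n i (c i P)) - ∑ i, d i (c i P) = ((r + 1 : ℕ) : ℝ) • P by abel,
      inv_smul_smul₀ hr]

/-- Elements of finite order in `G` are obtained from those which commute with all coordinates by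
applying the `n j` and taking linear combinations: a subspace `S` which is stable under the `n j`
and contains the latter contains the former. -/
theorem killed_inf_le (hc : ∀ i j, c i * c j = c j * c i)
    (hn : ∀ i j, n i * c j - c j * n i = if i = j then 1 else 0) {G S : Submodule ℝ X}
    (hGc : ∀ j, ∀ P ∈ G, c j P ∈ G) (hGn : ∀ j, ∀ P ∈ G, n j P ∈ G)
    (hS : killed c 1 ⊓ G ≤ S) (hSn : ∀ j, ∀ P ∈ S, n j P ∈ S) (r : ℕ) :
    killed c r ⊓ G ≤ S := by
  induction r with
  | zero =>
    rintro P ⟨hP, -⟩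
    rw [SetLike.mem_coe, mem_killed_zero] at hP
    rw [hP]
    exact zero_mem _
  | succ r ih =>
    rcases r with _ | r
    · exact hS
    rintro P ⟨hP, hG⟩
    have h1 : ∑ i, n i (c i P) ∈ S := sum_mem fun i _ =>
      hSn i _ (ih ⟨mem_killed_succ.1 hP i, hGc i _ hG⟩)
    have h2 : (∑ i, n i (c i P)) + ((r + 1 : ℕ) : ℝ) • P ∈ S :=
      ih ⟨euler_add_mem_killed hc hn hP, add_mem (sum_mem fun i _ => hGn i _ (hGc i _ hG))
        (Submodule.smul_mem _ _ hG)⟩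
    have h3 := sub_mem h2 h1
    rw [add_sub_cancel_left] at h3
    have hr : ((r + 1 : ℕ) : ℝ) ≠ 0 := Nat.cast_ne_zero.2 (Nat.succ_ne_zero r)
    have h4 := Submodule.smul_mem S ((r + 1 : ℕ) : ℝ)⁻¹ h3
    rwa [inv_smul_smul₀ hr] at h4

end Weyl

/-! ### Parametric integrals on convex sets -/

section Param

open Set Filter Topology

variable {E : Type} [NormedAddCommGroup E] [NormedSpace ℝ E]

omit [NormedSpace ℝ E] in
theorem continuousOn_integral_param {G : Type} [NormedAddCommGroup G] [NormedSpace ℝ G]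
    {s : Set E} {F : E × ℝ → G} (hF : ContinuousOn F (s ×ˢ Icc 0 1)) :
    ContinuousOn (fun x => ∫ t in (0 : ℝ)..1, F (x, t)) s := by
  have hint : ∀ x ∈ s, IntervalIntegrable (fun t => F (x, t)) MeasureTheory.volume 0 1 := by
    intro x hx
    refine ContinuousOn.intervalIntegrable ?_
    rw [uIcc_of_le zero_le_one]
    exact hF.comp (by fun_prop) fun t ht => ⟨hx, ht⟩
  intro x hx
  rw [ContinuousWithinAt, Metric.tendsto_nhds]
  intro ε hε
  obtain ⟨v, hv, h⟩ := IsCompact.mem_uniformity_of_prod (f := fun x t => F (x, t))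
    (isCompact_Icc (a := (0 : ℝ)) (b := 1)) hF hx (Metric.dist_mem_uniformity (half_pos hε))
  filter_upwards [hv, self_mem_nhdsWithin] with y hy hys
  rw [dist_eq_norm, ← intervalIntegral.integral_sub (hint y hys) (hint x hx)]
  refine lt_of_le_of_lt (intervalIntegral.norm_integral_le_of_norm_le_const (C := ε / 2)
    fun t ht => ?_) (by rw [sub_zero, abs_one, mul_one]; exact half_lt_self hε)
  rw [uIoc_of_le zero_le_one] at ht
  have := h y hy t (Ioc_subset_Icc_self ht)
  rw [← dist_eq_norm]
  exact le_of_lt this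

/-- Differentiation under the integral sign, within a convex set: the derivatives `F'` are uniformly
close to those at `x`, so the mean value inequality bounds the remainder uniformly in `t`. -/
theorem hasFDerivWithinAt_integral_param {G : Type} [NormedAddCommGroup G] [NormedSpace ℝ G]
    [CompleteSpace G]
    {s : Set E} (hs : Convex ℝ s) {F : E × ℝ → G} {F' : E × ℝ → E →L[ℝ] G}
    (hF : ContinuousOn F (s ×ˢ Icc 0 1)) (hF' : ContinuousOn F' (s ×ˢ Icc 0 1))
    (hd : ∀ x ∈ s, ∀ t ∈ Icc (0 : ℝ) 1,
      HasFDerivWithinAt (fun y => F (y, t)) (F' (x, t)) s x) {x : E} (hx : x ∈ s) :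
    HasFDerivWithinAt (fun y => ∫ t in (0 : ℝ)..1, F (y, t)) (∫ t in (0 : ℝ)..1, F' (x, t)) s x := by
  have hint : ∀ x ∈ s, IntervalIntegrable (fun t => F (x, t)) MeasureTheory.volume 0 1 := by
    intro x hx
    refine ContinuousOn.intervalIntegrable ?_
    rw [uIcc_of_le zero_le_one]
    exact hF.comp (by fun_prop) fun t ht => ⟨hx, ht⟩
  have hint' : IntervalIntegrable (fun t => F' (x, t)) MeasureTheory.volume 0 1 := by
    refine ContinuousOn.intervalIntegrable ?_
    rw [uIcc_of_le zero_le_one]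
    exact hF'.comp (by fun_prop) fun t ht => ⟨hx, ht⟩
  rw [hasFDerivWithinAt_iff_isLittleO, Asymptotics.isLittleO_iff]
  intro ε hε
  obtain ⟨v, hv, h⟩ := IsCompact.mem_uniformity_of_prod (f := fun x t => F' (x, t))
    (isCompact_Icc (a := (0 : ℝ)) (b := 1)) hF' hx (Metric.dist_mem_uniformity hε)
  obtain ⟨δ, hδ, hball⟩ := Metric.mem_nhdsWithin_iff.1 hv
  filter_upwards [inter_mem_nhdsWithin s (Metric.ball_mem_nhds x hδ)] with y hy
  have hconv : Convex ℝ (s ∩ Metric.ball x δ) := hs.inter (convex_ball _ _)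
  have key : ∀ t ∈ Icc (0 : ℝ) 1, ‖F (y, t) - F (x, t) - F' (x, t) (y - x)‖ ≤ ε * ‖y - x‖ := by
    intro t ht
    refine hconv.norm_image_sub_le_of_norm_hasFDerivWithin_le' (f := fun y => F (y, t))
      (f' := fun z => F' (z, t)) (fun z hz => (hd z hz.1 t ht).mono inter_subset_left)
      (fun z hz => ?_) ⟨hx, Metric.mem_ball_self hδ⟩ hy
    rw [← dist_eq_norm]
    exact le_of_lt (h z (hball ⟨hz.2, hz.1⟩) t ht)
  have h1 : (∫ t in (0 : ℝ)..1, F' (x, t)) (y - x) = ∫ t in (0 : ℝ)..1, F' (x, t) (y - x) :=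
    ContinuousLinearMap.intervalIntegral_apply hint' _
  have hint'' : IntervalIntegrable (fun t => F' (x, t) (y - x)) MeasureTheory.volume 0 1 := by
    refine ContinuousOn.intervalIntegrable ?_
    rw [uIcc_of_le zero_le_one]
    exact (hF'.comp (by fun_prop) fun t ht => ⟨hx, ht⟩).clm_apply continuousOn_const
  rw [h1, ← intervalIntegral.integral_sub (hint y hy.1) (hint x hx),
    ← intervalIntegral.integral_sub ((hint y hy.1).sub (hint x hx)) hint'']
  refine (intervalIntegral.norm_integral_le_of_norm_le_const (C := ε * ‖y - x‖)
    fun t ht => ?_).trans (by rw [sub_zero, abs_one, mul_one])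
  rw [uIoc_of_le zero_le_one] at ht
  exact key t (Ioc_subset_Icc_self ht)

theorem contDiffOn_integral_param {s : Set E} (hs : Convex ℝ s) (hs' : (interior s).Nonempty)
    (m : ℕ) {G : Type} [NormedAddCommGroup G] [NormedSpace ℝ G] [CompleteSpace G] {F : E × ℝ → G}
    (hF : ContDiffOn ℝ m F (s ×ˢ Icc 0 1)) :
    ContDiffOn ℝ m (fun x => ∫ t in (0 : ℝ)..1, F (x, t)) s := by
  have hu : UniqueDiffOn ℝ s := uniqueDiffOn_convex hs hs'
  have hu' : UniqueDiffOn ℝ (s ×ˢ Icc (0 : ℝ) 1) := hu.prod (uniqueDiffOn_Icc zero_lt_one)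
  induction m generalizing G with
  | zero =>
    rw [Nat.cast_zero, contDiffOn_zero] at hF ⊢
    exact continuousOn_integral_param hF
  | succ m ih =>
    let F' : E × ℝ → E →L[ℝ] G := fun p =>
      (fderivWithin ℝ F (s ×ˢ Icc 0 1) p).comp (ContinuousLinearMap.inl ℝ E ℝ)
    have hF' : ContDiffOn ℝ m F' (s ×ˢ Icc 0 1) :=
      (hF.fderivWithin hu' (by norm_cast)).clm_comp contDiffOn_const
    have hd : ∀ x ∈ s, ∀ t ∈ Icc (0 : ℝ) 1,
        HasFDerivWithinAt (fun y => F (y, t)) (F' (x, t)) s x := by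
      intro x hx t ht
      have h1 : HasFDerivWithinAt F (fderivWithin ℝ F (s ×ˢ Icc 0 1) (x, t)) (s ×ˢ Icc 0 1) (x, t) :=
        ((hF.differentiableOn (by norm_cast)) (x, t) ⟨hx, ht⟩).hasFDerivWithinAt
      exact h1.comp x (hasFDerivAt_prodMk_left x t).hasFDerivWithinAt
        (show MapsTo (fun y => (y, t)) s (s ×ˢ Icc 0 1) from fun y hy => ⟨hy, ht⟩)
    have hder : ∀ x ∈ s, HasFDerivWithinAt (fun y => ∫ t in (0 : ℝ)..1, F (y, t))
        (∫ t in (0 : ℝ)..1, F' (x, t)) s x := fun x hx =>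
      hasFDerivWithinAt_integral_param hs hF.continuousOn hF'.continuousOn hd hx
    push_cast
    rw [contDiffOn_succ_iff_fderivWithin hu]
    refine ⟨fun x hx => (hder x hx).differentiableWithinAt, fun h => by simp at h, ?_⟩
    exact (ih hF').congr fun x hx => (hder x hx).fderivWithin (hu x hx)

theorem contDiffOn_infty_integral_param {s : Set E} (hs : Convex ℝ s)
    (hs' : (interior s).Nonempty) {G : Type} [NormedAddCommGroup G] [NormedSpace ℝ G]
    [CompleteSpace G]
    {F : E × ℝ → G} (hF : ContDiffOn ℝ ∞ F (s ×ˢ Icc 0 1)) :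
    ContDiffOn ℝ ∞ (fun x => ∫ t in (0 : ℝ)..1, F (x, t)) s :=
  contDiffOn_infty.2 fun m => contDiffOn_integral_param hs hs' m (hF.of_le (by exact_mod_cast le_top))

end Param

/-! ### Smooth functions on the half-space -/

section HalfSpace

open Set Filter Topology

variable (n : ℕ) [NeZero n]

/-- The closed half-space `y 0 ≥ 0` of `ℝⁿ`. -/
abbrev HS : Set (EuclideanSpace ℝ (Fin n)) := Set.range (𝓡∂ n)

variable {n}

theorem mem_HS {y : EuclideanSpace ℝ (Fin n)} : y ∈ HS n ↔ 0 ≤ y 0 := by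
  rw [HS, range_modelWithCornersEuclideanHalfSpace]
  rfl

theorem HS_eq : HS n = {y | 0 ≤ y 0} := range_modelWithCornersEuclideanHalfSpace n

theorem convex_HS : Convex ℝ (HS n) := by
  rw [HS_eq]
  exact EuclideanHalfSpace.convex

theorem isClosed_HS : IsClosed (HS n) := (𝓡∂ n).isClosed_range

theorem uniqueDiffOn_HS : UniqueDiffOn ℝ (HS n) := (𝓡∂ n).uniqueDiffOn

theorem interior_HS_nonempty : (interior (HS n)).Nonempty := (𝓡∂ n).nonempty_interior

/-- The partial derivative in the `i`-th coordinate direction of a function on the half-space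
(one-sided at the boundary if `i = 0`). -/
def pd (i : Fin n) (f : EuclideanSpace ℝ (Fin n) → ℝ) (x : EuclideanSpace ℝ (Fin n)) : ℝ :=
  fderivWithin ℝ f (HS n) x (EuclideanSpace.single i 1)

variable {f g : EuclideanSpace ℝ (Fin n) → ℝ} {x : EuclideanSpace ℝ (Fin n)} {i : Fin n}

theorem pd_contDiffWithinAt (hf : ContDiffWithinAt ℝ ∞ f (HS n) x) (hx : x ∈ HS n) :
    ContDiffWithinAt ℝ ∞ (pd i f) (HS n) x :=
  (hf.fderivWithin_right (m := ∞) uniqueDiffOn_HS (by simp) hx).clm_apply contDiffWithinAt_const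

theorem pd_contDiffOn (hf : ContDiffOn ℝ ∞ f (HS n)) : ContDiffOn ℝ ∞ (pd i f) (HS n) :=
  fun x hx => pd_contDiffWithinAt (hf x hx) hx

theorem pd_congr (h : f =ᶠ[𝓝[HS n] x] g) (hx : x ∈ HS n) : pd i f x = pd i g x := by
  rw [pd, pd, h.fderivWithin_eq (h.self_of_nhdsWithin hx)]

theorem pd_add (hf : ContDiffWithinAt ℝ ∞ f (HS n) x) (hg : ContDiffWithinAt ℝ ∞ g (HS n) x)
    (hx : x ∈ HS n) : pd i (fun y => f y + g y) x = pd i f x + pd i g x := by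
  rw [pd, fderivWithin_fun_add (uniqueDiffOn_HS x hx) (hf.differentiableWithinAt (by simp))
    (hg.differentiableWithinAt (by simp))]
  rfl

theorem pd_const_mul (c : ℝ) (hf : ContDiffWithinAt ℝ ∞ f (HS n) x) (hx : x ∈ HS n) :
    pd i (fun y => c * f y) x = c * pd i f x := by
  rw [pd, fderivWithin_const_mul (uniqueDiffOn_HS x hx) (hf.differentiableWithinAt (by simp)) c]
  rfl

theorem pd_mul (hf : ContDiffWithinAt ℝ ∞ f (HS n) x) (hg : ContDiffWithinAt ℝ ∞ g (HS n) x)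
    (hx : x ∈ HS n) : pd i (fun y => f y * g y) x = pd i f x * g x + f x * pd i g x := by
  rw [pd, fderivWithin_fun_mul (uniqueDiffOn_HS x hx) (hf.differentiableWithinAt (by simp))
    (hg.differentiableWithinAt (by simp))]
  simp only [pd, add_apply, smul_apply, smul_eq_mul]
  ring

theorem pd_const (c : ℝ) : pd i (fun _ => c) x = 0 := by
  simp [pd]

theorem pd_coord (j : Fin n) (hx : x ∈ HS n) :
    pd i (fun y => y j) x = if i = j then 1 else 0 := by
  have h : HasFDerivWithinAt (fun y : EuclideanSpace ℝ (Fin n) => y j)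
      (EuclideanSpace.proj j : EuclideanSpace ℝ (Fin n) →L[ℝ] ℝ) (HS n) x :=
    (EuclideanSpace.proj j : EuclideanSpace ℝ (Fin n) →L[ℝ] ℝ).hasFDerivWithinAt
  rw [pd, h.fderivWithin (uniqueDiffOn_HS x hx)]
  simp [eq_comm]

theorem fderivWithin_apply_eq_sum (v : EuclideanSpace ℝ (Fin n)) :
    fderivWithin ℝ f (HS n) x v = ∑ i, v i * pd i f x := by
  conv_lhs => rw [← (EuclideanSpace.basisFun (Fin n) ℝ).sum_repr v]
  simp [pd, map_sum]

theorem segment_mem_HS {a b : EuclideanSpace ℝ (Fin n)} (ha : a ∈ HS n) (hb : b ∈ HS n) {t : ℝ}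
    (ht : t ∈ Icc (0 : ℝ) 1) : a + t • (b - a) ∈ HS n :=
  convex_HS.add_smul_sub_mem ha hb ht

theorem hasDerivAt_segment (hf : ContDiffOn ℝ ∞ f (HS n)) {a b : EuclideanSpace ℝ (Fin n)}
    (ha : a ∈ HS n) (hb : b ∈ HS n) {t : ℝ} (ht : t ∈ Ioo (0 : ℝ) 1) :
    HasDerivAt (fun t : ℝ => f (a + t • (b - a)))
      (fderivWithin ℝ f (HS n) (a + t • (b - a)) (b - a)) t := by
  have h1 := ((hf.differentiableOn (by simp)) _
    (segment_mem_HS ha hb (Ioo_subset_Icc_self ht))).hasFDerivWithinAt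
  have h2 : HasDerivWithinAt (fun t : ℝ => a + t • (b - a)) (b - a) (Icc 0 1) t := by
    have := ((hasDerivAt_id t).smul_const (b - a)).const_add a
    simpa using this.hasDerivWithinAt
  exact (h1.comp_hasDerivWithinAt t h2 fun s hs => segment_mem_HS ha hb hs).hasDerivAt
    (Icc_mem_nhds ht.1 ht.2)

theorem continuousOn_segment {G : Type*} [TopologicalSpace G] {F : EuclideanSpace ℝ (Fin n) → G}
    (hF : ContinuousOn F (HS n)) {a b : EuclideanSpace ℝ (Fin n)} (ha : a ∈ HS n) (hb : b ∈ HS n) :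
    ContinuousOn (fun t : ℝ => F (a + t • (b - a))) (Icc 0 1) :=
  hF.comp (by fun_prop) fun _ ht => segment_mem_HS ha hb ht

theorem sub_eq_integral_segment (hf : ContDiffOn ℝ ∞ f (HS n)) {a b : EuclideanSpace ℝ (Fin n)}
    (ha : a ∈ HS n) (hb : b ∈ HS n) :
    f b - f a = ∑ i, (b i - a i) * ∫ t in (0 : ℝ)..1, pd i f (a + t • (b - a)) := by
  have hc : ∀ i, IntervalIntegrable (fun t : ℝ => pd i f (a + t • (b - a)))
      MeasureTheory.volume 0 1 := fun i => by
    refine ContinuousOn.intervalIntegrable ?_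
    rw [uIcc_of_le zero_le_one]
    exact continuousOn_segment (pd_contDiffOn hf).continuousOn ha hb
  have h := intervalIntegral.integral_eq_sub_of_hasDerivAt_of_le zero_le_one
    (continuousOn_segment hf.continuousOn ha hb)
    (fun t ht => hasDerivAt_segment hf ha hb ht) (by
      simp only [fderivWithin_apply_eq_sum]
      have := IntervalIntegrable.sum Finset.univ fun i _ => (hc i).const_mul ((b - a) i)
      simpa only [Finset.sum_fn] using this)
  simp only [one_smul, add_sub_cancel, zero_smul, add_zero, fderivWithin_apply_eq_sum] at h
  rw [← h, intervalIntegral.integral_finsetSum fun i _ => (hc i).const_mul _]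
  simp

/-- Hadamard's lemma on the half-space, by integration along segments, which stay in the half-space
as it is convex. -/
theorem exists_hadamard (hf : ContDiffOn ℝ ∞ f (HS n)) {p : EuclideanSpace ℝ (Fin n)}
    (hp : p ∈ HS n) : ∃ g : Fin n → EuclideanSpace ℝ (Fin n) → ℝ,
      (∀ i, ContDiffOn ℝ ∞ (g i) (HS n)) ∧
      ∀ y ∈ HS n, f y = f p + ∑ i, (y i - p i) * g i y := by
  refine ⟨fun i y => ∫ t in (0 : ℝ)..1, pd i f (p + t • (y - p)), fun i => ?_, fun y hy => ?_⟩
  · refine contDiffOn_infty_integral_param (F := fun q => pd i f (p + q.2 • (q.1 - p)))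
      convex_HS interior_HS_nonempty ?_
    exact (pd_contDiffOn hf).comp (by fun_prop) fun q hq => segment_mem_HS hp hq.1 hq.2
  · rw [← sub_eq_integral_segment hf hp hy]
    ring

/-- The projection of `ℝⁿ` to the boundary of the half-space. -/
def bdryProj (x : EuclideanSpace ℝ (Fin n)) : EuclideanSpace ℝ (Fin n) :=
  x - x 0 • EuclideanSpace.single 0 1

@[simp] theorem bdryProj_zero : bdryProj x 0 = 0 := by simp [bdryProj]

theorem bdryProj_mem : bdryProj x ∈ HS n := mem_HS.2 bdryProj_zero.ge

theorem sub_bdryProj : x - bdryProj x = x 0 • EuclideanSpace.single 0 1 := by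
  simp [bdryProj]

theorem bdryProj_contDiff :
    ContDiff ℝ ∞ (bdryProj : EuclideanSpace ℝ (Fin n) → EuclideanSpace ℝ (Fin n)) := by
  unfold bdryProj
  fun_prop

/-- The average of `g` over the segment joining a point to its projection to the boundary. -/
def segAvg (g : EuclideanSpace ℝ (Fin n) → ℝ) (x : EuclideanSpace ℝ (Fin n)) : ℝ :=
  ∫ t in (0 : ℝ)..1, g (bdryProj x + t • (x - bdryProj x))

theorem segAvg_contDiffOn (hg : ContDiffOn ℝ ∞ g (HS n)) : ContDiffOn ℝ ∞ (segAvg g) (HS n) := by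
  refine contDiffOn_infty_integral_param
    (F := fun q => g (bdryProj q.1 + q.2 • (q.1 - bdryProj q.1)))
    convex_HS interior_HS_nonempty ?_
  refine hg.comp (ContDiff.contDiffOn ?_) fun q hq => segment_mem_HS bdryProj_mem hq.1 hq.2
  have := (bdryProj_contDiff (n := n))
  fun_prop

/-- Division of a function vanishing on the boundary by the boundary coordinate. -/
theorem eq_coord_mul_segAvg_pd (hf : ContDiffOn ℝ ∞ f (HS n)) (h0 : ∀ y, y 0 = 0 → f y = 0)
    (hx : x ∈ HS n) : f x = x 0 * segAvg (pd 0 f) x := by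
  have h := sub_eq_integral_segment hf (bdryProj_mem (x := x)) hx
  rw [h0 _ bdryProj_zero, sub_zero] at h
  rw [h, Finset.sum_eq_single 0]
  · simp [segAvg]
  · intro i _ hi
    have : x i - bdryProj x i = 0 := by simp [bdryProj, hi]
    rw [this, zero_mul]
  · simp

/-- The function `x_0 · segAvg g` is a primitive of `g` in the direction of the boundary
coordinate. -/
theorem pd_coord_mul_segAvg (hg : ContDiffOn ℝ ∞ g (HS n)) (hx : x ∈ HS n) :
    pd 0 (fun y => y 0 * segAvg g y) x = g x := by
  -- `x ↦ x 0 * segAvg g x` is the integral of `g` along the segment from the boundary to `x`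
  have hA := segAvg_contDiffOn hg
  have hcoord : ContDiffOn ℝ ∞ (fun y : EuclideanSpace ℝ (Fin n) => y 0) (HS n) :=
    ContDiff.contDiffOn (by fun_prop)
  rw [pd_mul (hcoord x hx) (hA x hx) hx, pd_coord 0 hx, if_pos rfl, one_mul]
  have hS : ∀ y ∈ HS n, ∀ t ∈ Icc (0 : ℝ) 1, bdryProj y + t • (y - bdryProj y) ∈ HS n :=
    fun y hy t ht => segment_mem_HS bdryProj_mem hy ht
  let S' : ℝ → EuclideanSpace ℝ (Fin n) →L[ℝ] EuclideanSpace ℝ (Fin n) := fun t =>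
    ContinuousLinearMap.id ℝ _ + (t - 1) • (EuclideanSpace.proj 0 :
      EuclideanSpace ℝ (Fin n) →L[ℝ] ℝ).smulRight (EuclideanSpace.single 0 1)
  have hSeq : ∀ (y : EuclideanSpace ℝ (Fin n)) (t : ℝ),
      bdryProj y + t • (y - bdryProj y) = S' t y := by
    intro y t
    rw [sub_bdryProj]
    simp only [bdryProj, S', add_apply, ContinuousLinearMap.id_apply,
      smul_apply, ContinuousLinearMap.smulRight_apply]
    change _ = y + (t - 1) • y 0 • EuclideanSpace.single 0 1
    rw [smul_smul, smul_smul, sub_mul, one_mul, sub_smul]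
    abel
  have hS'c : Continuous S' := by
    unfold S'
    fun_prop
  have hder := hasFDerivWithinAt_integral_param (convex_HS (n := n))
    (F := fun q => g (bdryProj q.1 + q.2 • (q.1 - bdryProj q.1)))
    (F' := fun q => (fderivWithin ℝ g (HS n) (bdryProj q.1 + q.2 • (q.1 - bdryProj q.1))).comp
      (S' q.2)) (x := x)
    (hg.continuousOn.comp (by have := (bdryProj_contDiff (n := n)).continuous; fun_prop)
      fun q hq => hS _ hq.1 _ hq.2)
    (((hg.continuousOn_fderivWithin uniqueDiffOn_HS (by simp)).comp
      (by have := (bdryProj_contDiff (n := n)).continuous; fun_prop)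
      fun q hq => hS _ hq.1 _ hq.2).clm_comp (hS'c.comp continuous_snd).continuousOn)
    (fun y hy t ht => by
      have h1 := ((hg.differentiableOn (by simp)) _ (hS y hy t ht)).hasFDerivWithinAt
      have h2 : HasFDerivWithinAt (fun y => bdryProj y + t • (y - bdryProj y)) (S' t) (HS n) y := by
        simp only [hSeq]
        exact (S' t).hasFDerivWithinAt
      exact h1.comp y h2 (fun z hz => hS z hz t ht)) hx
  have hI : ContinuousOn (fun t : ℝ => (fderivWithin ℝ g (HS n)
      (bdryProj x + t • (x - bdryProj x))).comp (S' t)) (Icc 0 1) :=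
    (continuousOn_segment (hg.continuousOn_fderivWithin uniqueDiffOn_HS (by simp)) bdryProj_mem
      hx).clm_comp hS'c.continuousOn
  have hpd : pd 0 (segAvg g) x =
      ∫ t in (0 : ℝ)..1, t * pd 0 g (bdryProj x + t • (x - bdryProj x)) := by
    rw [pd]
    unfold segAvg
    rw [hder.fderivWithin (uniqueDiffOn_HS x hx),
      ContinuousLinearMap.intervalIntegral_apply (by
        refine ContinuousOn.intervalIntegrable ?_
        rwa [uIcc_of_le zero_le_one])]
    refine intervalIntegral.integral_congr fun t _ => ?_
    have : S' t (EuclideanSpace.single 0 1) = t • EuclideanSpace.single 0 1 := by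
      simp [S', sub_smul]
    simp only [ContinuousLinearMap.comp_apply, this, map_smul, pd, smul_eq_mul]
  have hc1 := continuousOn_segment hg.continuousOn (bdryProj_mem (x := x)) hx
  have hc2 := continuousOn_segment (pd_contDiffOn (i := 0) hg).continuousOn
    (bdryProj_mem (x := x)) hx
  have hftc := intervalIntegral.integral_eq_sub_of_hasDerivAt_of_le
    (f := fun t : ℝ => t * g (bdryProj x + t • (x - bdryProj x)))
    (f' := fun t : ℝ => g (bdryProj x + t • (x - bdryProj x)) +
      x 0 * (t * pd 0 g (bdryProj x + t • (x - bdryProj x)))) zero_le_one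
    (continuousOn_id.mul hc1) (fun t ht => by
      have h := (hasDerivAt_id t).mul (hasDerivAt_segment hg (bdryProj_mem (x := x)) hx ht)
      refine h.congr_deriv ?_
      have e : fderivWithin ℝ g (HS n) (bdryProj x + t • (x - bdryProj x)) (x - bdryProj x) =
          x 0 * pd 0 g (bdryProj x + t • (x - bdryProj x)) := by
        conv_lhs => rw [sub_bdryProj, map_smul, smul_eq_mul]
        rw [pd, sub_bdryProj]
      simp only [e, id]
      ring) (by
      refine ContinuousOn.intervalIntegrable ?_
      rw [uIcc_of_le zero_le_one]
      exact hc1.add (continuousOn_const.mul (continuousOn_id.mul hc2)))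
  rw [intervalIntegral.integral_add (by
      refine ContinuousOn.intervalIntegrable ?_
      rwa [uIcc_of_le zero_le_one]) (by
      refine ContinuousOn.intervalIntegrable ?_
      rw [uIcc_of_le zero_le_one]
      exact continuousOn_const.mul (continuousOn_id.mul hc2)),
    intervalIntegral.integral_const_mul, ← hpd] at hftc
  simpa [segAvg] using hftc

end HalfSpace

/-! ### Integration on the half-space -/

section HalfSpaceIntegral

open Set Filter Topology MeasureTheory

variable {n : ℕ} [NeZero n]

/-- Test functions on the half-space, smooth up to the boundary, as functions on `ℝⁿ` which vanish
outside the half-space. -/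
structure HalfTest (f : EuclideanSpace ℝ (Fin n) → ℝ) : Prop where
  contDiffOn : ContDiffOn ℝ ∞ f (HS n)
  compactSupport : HasCompactSupport f
  eq_zero : ∀ y ∉ HS n, f y = 0

variable {f g : EuclideanSpace ℝ (Fin n) → ℝ} {i : Fin n}

theorem pd_eq_zero_of_notMem {x : EuclideanSpace ℝ (Fin n)} (hx : x ∉ HS n) : pd i f x = 0 := by
  rw [pd, fderivWithin_zero_of_notMem_closure (by rwa [isClosed_HS.closure_eq])]
  rfl

theorem HalfTest.pd (hf : HalfTest f) : HalfTest (pd i f) where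
  contDiffOn := pd_contDiffOn hf.contDiffOn
  compactSupport := by
    refine HasCompactSupport.intro hf.compactSupport fun x hx => ?_
    by_cases hxs : x ∈ HS n
    · have h0 : f =ᶠ[𝓝[HS n] x] fun _ => 0 :=
        ((isClosed_tsupport f).isOpen_compl.eventually_mem hx |>.mono fun y hy =>
          image_eq_zero_of_notMem_tsupport hy).filter_mono nhdsWithin_le_nhds
      rw [pd_congr h0 hxs, pd_const]
    · exact pd_eq_zero_of_notMem hxs
  eq_zero := fun _ hy => pd_eq_zero_of_notMem hy

theorem HalfTest.continuousOn (hf : HalfTest f) : ContinuousOn f (HS n) :=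
  hf.contDiffOn.continuousOn

theorem HalfTest.eq_indicator (hf : HalfTest f) : (HS n ∩ tsupport f).indicator f = f := by
  funext y
  by_cases hy : y ∈ HS n ∩ tsupport f
  · rw [indicator_of_mem hy]
  · rw [indicator_of_notMem hy]
    by_cases hys : y ∈ HS n
    · exact (image_eq_zero_of_notMem_tsupport fun h => hy ⟨hys, h⟩).symm
    · exact (hf.eq_zero y hys).symm

theorem HalfTest.isCompact (hf : HalfTest f) : IsCompact (HS n ∩ tsupport f) :=
  hf.compactSupport.isCompact.inter_left isClosed_HS

theorem HalfTest.integrable (hf : HalfTest f) (μ : Measure (EuclideanSpace ℝ (Fin n)))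
    [IsFiniteMeasureOnCompacts μ] : Integrable f μ := by
  rw [← hf.eq_indicator, integrable_indicator_iff hf.isCompact.measurableSet]
  exact (hf.continuousOn.mono inter_subset_left).integrableOn_compact hf.isCompact

theorem integral_lineDeriv_eq_zero {E : Type*} [NormedAddCommGroup E] [NormedSpace ℝ E]
    [FiniteDimensional ℝ E] [MeasurableSpace E] [BorelSpace E] {μ : Measure E}
    [μ.IsAddHaarMeasure] {F F' : E → ℝ} {v : E} (hF : Integrable F μ) (hF' : Integrable F' μ)
    (h : ∀ x, HasLineDerivAt ℝ F (F' x) x v) : ∫ x, F' x ∂μ = 0 := by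
  have := integral_bilinear_hasLineDerivAt_right_eq_neg_left_of_integrable (μ := μ) (f := F)
    (f' := F') (g := fun _ => (1 : ℝ)) (g' := fun _ => (0 : ℝ)) (v := v)
    (B := ContinuousLinearMap.mul ℝ ℝ) (by simpa using hF') (by simp) (by simpa using hF)
    (fun x _ => h x) (fun x _ => by
      simpa [HasLineDerivAt] using hasDerivAt_const (0 : ℝ) (1 : ℝ))
  simpa using this.symm

/-- In tangential directions the extension by zero remains differentiable, since the lines stay
either in the half-space or in its complement. -/
theorem HalfTest.hasLineDerivAt (hf : HalfTest f) (hi : i ≠ 0) (x : EuclideanSpace ℝ (Fin n)) :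
    HasLineDerivAt ℝ f (BoundaryDMod.pd i f x) x (EuclideanSpace.single i 1) := by
  have hline : ∀ t : ℝ, x + t • EuclideanSpace.single i 1 ∈ HS n ↔ x ∈ HS n := by
    intro t
    rw [mem_HS, mem_HS]
    simp [hi.symm]
  by_cases hx : x ∈ HS n
  · have h1 : HasFDerivWithinAt f (fderivWithin ℝ f (HS n) x) (HS n)
        (x + (0 : ℝ) • EuclideanSpace.single i 1) := by
      rw [zero_smul, add_zero]
      exact ((hf.contDiffOn.differentiableOn (by simp)) x hx).hasFDerivWithinAt
    have h2 : HasDerivWithinAt (fun t : ℝ => x + t • (EuclideanSpace.single i 1 :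
        EuclideanSpace ℝ (Fin n))) (EuclideanSpace.single i 1) univ 0 := by
      have := ((hasDerivAt_id (0 : ℝ)).smul_const (EuclideanSpace.single i 1 :
        EuclideanSpace ℝ (Fin n))).const_add x
      simpa using this
    have h3 := h1.comp_hasDerivWithinAt 0 h2 (fun t _ => (hline t).2 hx)
    exact hasDerivWithinAt_univ.1 h3
  · rw [pd_eq_zero_of_notMem hx]
    have : (fun t : ℝ => f (x + t • EuclideanSpace.single i 1)) = fun _ => 0 := by
      funext t
      exact hf.eq_zero _ (mt (hline t).1 hx)
    rw [HasLineDerivAt, this]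
    exact hasDerivAt_const _ _

theorem HalfTest.integral_pd (hf : HalfTest f) (hi : i ≠ 0) :
    ∫ y, BoundaryDMod.pd i f y = 0 :=
  integral_lineDeriv_eq_zero (hf.integrable _) (hf.pd.integrable _) (hf.hasLineDerivAt hi)

variable (n) in
/-- There is a measure on the boundary hyperplane for which the divergence theorem holds, both on the
half-space and along the boundary, and which detects nonnegative functions on the boundary. -/
theorem exists_boundary_measure : ∃ σ : Measure (EuclideanSpace ℝ (Fin n)),
    IsFiniteMeasureOnCompacts σ ∧ (∀ᵐ y ∂σ, y 0 = 0) ∧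
    (∀ f, HalfTest f → ∫ y, pd 0 f y = -∫ y, f y ∂σ) ∧
    (∀ f (i : Fin n), i ≠ 0 → HalfTest f → ∫ y, pd i f y ∂σ = 0) ∧
    (∀ f, HalfTest f → 0 ≤ f → ∫ y, f y ∂σ = 0 → ∀ y, y 0 = 0 → f y = 0) := by
  obtain ⟨m, rfl⟩ : ∃ m, n = m + 1 := Nat.exists_eq_succ_of_ne_zero (NeZero.ne n)
  -- `Ψ` splits off the boundary coordinate, and `ι` parametrizes the boundary hyperplane; the
  -- measure is the image of Lebesgue measure under `ι`.
  let Ψ : ℝ × (Fin m → ℝ) ≃ᵐ EuclideanSpace ℝ (Fin (m + 1)) :=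
    (MeasurableEquiv.piFinSuccAbove (fun _ => ℝ) 0).symm.trans (MeasurableEquiv.toLp 2 _)
  have hΨ : MeasurePreserving Ψ volume volume :=
    (PiLp.volume_preserving_toLp (Fin (m + 1))).comp
      ((volume_preserving_piFinSuccAbove (fun _ : Fin (m + 1) => ℝ) 0).symm _)
  have hΨ0 : ∀ t z, Ψ (t, z) 0 = t := fun t z => rfl
  have hΨs : ∀ t z (j : Fin m), Ψ (t, z) j.succ = z j := fun t z j => rfl
  have hΨe : ∀ t z, Ψ (t, z) = Ψ (0, z) + t • EuclideanSpace.single 0 1 := by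
    intro t z
    ext j
    refine Fin.cases ?_ (fun j => ?_) j
    · simp [hΨ0]
    · simp [hΨs]
  let ι : (Fin m → ℝ) → EuclideanSpace ℝ (Fin (m + 1)) := fun z => Ψ (0, z)
  have hιc : Continuous ι := by
    have : ι = fun z => WithLp.toLp 2 (Fin.cons 0 z : Fin (m + 1) → ℝ) := by
      funext z
      ext j
      refine Fin.cases rfl (fun j => rfl) j
    rw [this]
    fun_prop
  have hιHS : ∀ z, ι z ∈ HS (m + 1) := fun z => mem_HS.2 (hΨ0 0 z).ge
  have hιsub : ∀ (K : Set (EuclideanSpace ℝ (Fin (m + 1)))), IsCompact K →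
      IsCompact (ι ⁻¹' K) := by
    intro K hK
    let π : EuclideanSpace ℝ (Fin (m + 1)) → (Fin m → ℝ) := fun y j => y j.succ
    have hπ : Continuous π := by unfold π; fun_prop
    refine IsCompact.of_isClosed_subset (hK.image hπ) (hK.isClosed.preimage hιc) fun z hz =>
      ⟨ι z, hz, ?_⟩
    funext j
    exact hΨs 0 z j
  have hcomp : ∀ f, HalfTest f → Continuous (f ∘ ι) ∧ HasCompactSupport (f ∘ ι) := by
    intro f hf
    refine ⟨continuousOn_univ.1 (hf.continuousOn.comp hιc.continuousOn fun z _ => hιHS z), ?_⟩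
    exact HasCompactSupport.intro (hιsub _ hf.compactSupport) fun z hz =>
      show f (ι z) = 0 from image_eq_zero_of_notMem_tsupport hz
  have hint : ∀ f, HalfTest f → ∫ y, f y ∂(Measure.map ι volume) = ∫ z, f (ι z) := by
    intro f hf
    have hm : MeasurableEmbedding ι := Ψ.measurableEmbedding.comp
      (measurableEmbedding_prodMk_left 0)
    exact hm.integral_map f
  refine ⟨Measure.map ι volume, ⟨fun K hK => ?_⟩, ?_, fun f hf => ?_, fun f i hi hf => ?_,
    fun f hf h0 h y hy => ?_⟩
  · rw [Measure.map_apply hιc.measurable hK.measurableSet]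
    exact (hιsub K hK).measure_lt_top
  · rw [ae_map_iff hιc.measurable.aemeasurable
      (measurableSet_eq_fun (by fun_prop) measurable_const)]
    exact Eventually.of_forall fun z => hΨ0 0 z
  -- Fubini, and the fundamental theorem of calculus on the rays `t ↦ Ψ (t, z)`
  · rw [hint f hf, ← hΨ.integral_comp Ψ.measurableEmbedding, Measure.volume_eq_prod,
      integral_prod_symm _ (by
        rw [← Measure.volume_eq_prod]
        exact (hΨ.integrable_comp_emb Ψ.measurableEmbedding).2 (hf.pd.integrable _)),
      ← integral_neg]
    refine integral_congr_ae (Eventually.of_forall fun z => ?_)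
    have hsupp : ∀ t ∉ Ici (0 : ℝ), pd 0 f (Ψ (t, z)) = 0 := by
      intro t ht
      refine pd_eq_zero_of_notMem fun h => ht ?_
      rw [mem_HS, hΨ0] at h
      exact h
    have hcl : Continuous fun t : ℝ => Ψ (t, z) := by
      have : (fun t : ℝ => Ψ (t, z)) = fun t => Ψ (0, z) + t • EuclideanSpace.single 0 1 := by
        funext t
        exact hΨe t z
      rw [this]
      fun_prop
    have hmaps : MapsTo (fun t : ℝ => Ψ (t, z)) (Ici 0) (HS (m + 1)) := by
      intro t ht
      rw [mem_HS, hΨ0]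
      exact ht
    -- the coordinate `t` is bounded on the support of `f`
    obtain ⟨R, hR⟩ : ∃ R : ℝ, ∀ y ∈ tsupport f, y 0 ≤ R := by
      obtain ⟨R, hR⟩ := (hf.compactSupport.isCompact.image (f := fun y => y 0)
        (by fun_prop)).bddAbove
      exact ⟨R, fun y hy => hR ⟨y, hy, rfl⟩⟩
    change ∫ t, pd 0 f (Ψ (t, z)) = -f (Ψ (0, z))
    rw [← setIntegral_eq_integral_of_forall_compl_eq_zero hsupp, integral_Ici_eq_integral_Ioi,
      integral_Ioi_of_hasDerivAt_of_tendsto (f := fun t => f (Ψ (t, z))) (m := 0)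
      ((hf.continuousOn.comp hcl.continuousOn hmaps) 0 self_mem_Ici) (fun t ht => ?_) ?_ ?_,
      zero_sub]
    · have hc : ContinuousOn (fun t => pd 0 f (Ψ (t, z))) (Icc 0 R) :=
        hf.pd.continuousOn.comp hcl.continuousOn fun t ht => hmaps ht.1
      refine IntegrableOn.mono_set (t := Icc 0 R ∪ Ioi R) ?_ (fun t ht => ?_)
      · refine hc.integrableOn_Icc.union ?_
        refine integrableOn_zero.congr_fun (fun t ht => ?_) measurableSet_Ioi
        symm
        by_contra hne
        have h5 : Ψ (t, z) ∉ tsupport f := fun h6 => by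
          have := hR _ h6
          rw [hΨ0] at this
          exact absurd this (not_le.2 ht)
        apply hne
        by_cases h7 : Ψ (t, z) ∈ HS (m + 1)
        · have h0 : f =ᶠ[𝓝[HS (m + 1)] Ψ (t, z)] fun _ => 0 :=
            ((isClosed_tsupport f).isOpen_compl.eventually_mem h5 |>.mono fun y hy =>
              image_eq_zero_of_notMem_tsupport hy).filter_mono nhdsWithin_le_nhds
          rw [pd_congr h0 h7, pd_const]
        · exact pd_eq_zero_of_notMem h7
      · rcases le_or_gt t R with h | h
        · exact Or.inl ⟨le_of_lt ht, h⟩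
        · exact Or.inr h
    · refine tendsto_const_nhds.congr' ?_
      filter_upwards [eventually_gt_atTop R] with t ht
      symm
      refine image_eq_zero_of_notMem_tsupport fun h6 => ?_
      have := hR _ h6
      rw [hΨ0] at this
      exact absurd this (not_le.2 ht)
    · have h1 := ((hf.contDiffOn.differentiableOn (by simp)) _
        (hmaps (Ioi_subset_Ici_self ht))).hasFDerivWithinAt
      have h2 : HasDerivWithinAt (fun t : ℝ => Ψ (t, z)) (EuclideanSpace.single 0 1) (Ici 0) t := by
        have h3 := ((hasDerivAt_id t).smul_const (EuclideanSpace.single 0 1 :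
          EuclideanSpace ℝ (Fin (m + 1)))).const_add (Ψ (0, z))
        have h4 : (fun t : ℝ => Ψ (t, z)) = fun t => Ψ (0, z) + t • EuclideanSpace.single 0 1 := by
          funext t
          exact hΨe t z
        rw [h4]
        simpa using h3.hasDerivWithinAt
      exact (h1.comp_hasDerivWithinAt t h2 hmaps).hasDerivAt (Ici_mem_nhds ht)
  · rw [hint _ hf.pd]
    obtain ⟨j, rfl⟩ : ∃ j : Fin m, i = j.succ := ⟨i.pred hi, (Fin.succ_pred i hi).symm⟩
    have h1 := hcomp f hf
    have h2 := hcomp _ (hf.pd (i := j.succ))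
    refine integral_lineDeriv_eq_zero (F := f ∘ ι) (v := (Pi.single j 1 : Fin m → ℝ))
      (h1.1.integrable_of_hasCompactSupport h1.2) (h2.1.integrable_of_hasCompactSupport h2.2)
      fun z => ?_
    have h3 := hf.hasLineDerivAt hi (ι z)
    have h4 : (fun t : ℝ => (f ∘ ι) (z + t • (Pi.single j 1 : Fin m → ℝ))) =
        fun t : ℝ => f (ι z + t • EuclideanSpace.single j.succ 1) := by
      funext t
      refine congrArg f ?_
      ext l
      refine Fin.cases ?_ (fun l => ?_) l
      · simp [ι, hΨ0]
      · simp [ι, hΨs, Pi.single_apply]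
    rw [HasLineDerivAt, h4]
    exact h3
  · rw [hint f hf] at h
    have h1 := hcomp f hf
    have h2 : y = ι (fun j => y j.succ) := by
      ext l
      refine Fin.cases ?_ (fun l => ?_) l
      · exact hy
      · rfl
    by_contra hne
    have h3 := h1.1.integral_pos_of_hasCompactSupport_nonneg_nonzero
      (μ := (volume : Measure (Fin m → ℝ))) h1.2
      (fun z => h0 _) (x := fun j : Fin m => y j.succ) (by
        rw [Function.comp_apply, ← h2]
        exact hne)
    exact absurd h h3.ne'

/-- A compactly supported function all of whose polynomial moments vanish has vanishing `L²`-norm,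
because by the Stone–Weierstrass theorem it is a uniform limit of polynomials on its support. -/
theorem integral_mul_self_eq_zero {μ : Measure (EuclideanSpace ℝ (Fin n))}
    [IsFiniteMeasureOnCompacts μ] (hf : HalfTest f)
    (h : ∀ p : MvPolynomial (Fin n) ℝ, ∫ y, MvPolynomial.eval (fun i => y i) p * f y ∂μ = 0) :
    ∫ y, f y * f y ∂μ = 0 := by
  set K := HS n ∩ tsupport f with hK
  have hKc : IsCompact K := hf.isCompact
  have : CompactSpace K := isCompact_iff_compactSpace.1 hKc
  have h0 : ∀ y ∉ K, f y = 0 := by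
    intro y hy
    rw [← hf.eq_indicator, indicator_of_notMem hy]
  let fK : C(K, ℝ) := ⟨fun y => f y, continuousOn_iff_continuous_domRestrict.1
    (hf.continuousOn.mono inter_subset_left)⟩
  let A : MvPolynomial (Fin n) ℝ →ₐ[ℝ] C(K, ℝ) :=
    MvPolynomial.aeval fun i => ⟨fun y => (y : EuclideanSpace ℝ (Fin n)) i, by fun_prop⟩
  have hA : ∀ p (y : K), A p y = MvPolynomial.eval (fun i => (y : EuclideanSpace ℝ (Fin n)) i) p := by
    intro p y
    induction p using MvPolynomial.induction_on with
    | C a => simp [A]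
    | add p q hp hq => simp [map_add, hp, hq]
    | mul_X p i hp =>
      rw [map_mul, map_mul, ContinuousMap.mul_apply, hp]
      simp [A]
  have hdense : A.range.topologicalClosure = ⊤ := by
    refine ContinuousMap.subalgebra_topologicalClosure_eq_top_of_separatesPoints _ ?_
    intro x y hxy
    obtain ⟨i, hi⟩ : ∃ i, (x : EuclideanSpace ℝ (Fin n)) i ≠ (y : EuclideanSpace ℝ (Fin n)) i := by
      by_contra! hcon
      exact hxy (Subtype.ext (by ext i; exact hcon i))
    refine ⟨A (MvPolynomial.X i), ⟨_, ⟨MvPolynomial.X i, rfl⟩, rfl⟩, ?_⟩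
    rw [hA, hA]
    simpa using hi
  have hint : ∀ q : EuclideanSpace ℝ (Fin n) → ℝ, Continuous q →
      Integrable (fun y => q y * f y) μ := by
    intro q hq
    have : (fun y => q y * f y) = K.indicator (fun y => q y * f y) := by
      funext y
      by_cases hy : y ∈ K
      · rw [indicator_of_mem hy]
      · rw [indicator_of_notMem hy, h0 y hy, mul_zero]
    rw [this, integrable_indicator_iff hKc.measurableSet]
    exact (hq.continuousOn.mul (hf.continuousOn.mono inter_subset_left)).integrableOn_compact hKc
  have hintf : Integrable (fun y => f y * f y) μ := by
    have : (fun y => f y * f y) = K.indicator (fun y => f y * f y) := by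
      funext y
      by_cases hy : y ∈ K
      · rw [indicator_of_mem hy]
      · rw [indicator_of_notMem hy, h0 y hy, mul_zero]
    rw [this, integrable_indicator_iff hKc.measurableSet]
    have := hf.continuousOn.mono (inter_subset_left (t := tsupport f))
    exact (this.mul this).integrableOn_compact hKc
  -- approximate one factor `f` by a polynomial `p`, and use that `∫ p f = 0`
  have hbound : ∀ ε > 0, |∫ y, f y * f y ∂μ| ≤ ε * ∫ y, |f y| ∂μ := by
    intro ε hε
    have hmem : fK ∈ A.range.topologicalClosure := hdense ▸ Algebra.mem_top
    obtain ⟨_, ⟨p, rfl⟩, hp⟩ := Metric.mem_closure_iff.1 hmem ε hε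
    have hq : Continuous fun y : EuclideanSpace ℝ (Fin n) =>
        MvPolynomial.eval (fun i => y i) p :=
      (MvPolynomial.continuous_eval p).comp (by fun_prop)
    have h1 : ∫ y, f y * f y ∂μ =
        ∫ y, (f y * f y - MvPolynomial.eval (fun i => y i) p * f y) ∂μ := by
      rw [integral_sub hintf (hint _ hq), h p, sub_zero]
    rw [h1, ← integral_const_mul]
    refine (norm_integral_le_integral_norm _).trans (integral_mono_ae
      (hintf.sub (hint _ hq)).norm ((hf.integrable μ).abs.const_mul ε)
      (Eventually.of_forall fun y => ?_))
    by_cases hy : y ∈ K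
    · have h2 := (ContinuousMap.dist_lt_iff hε).1 hp ⟨y, hy⟩
      rw [Real.dist_eq] at h2
      change |f y - A p ⟨y, hy⟩| < ε at h2
      rw [hA] at h2
      change ‖f y * f y - _ * f y‖ ≤ ε * |f y|
      rw [← sub_mul, norm_mul, Real.norm_eq_abs, Real.norm_eq_abs]
      gcongr
    · simp [h0 y hy]
  have hle : |∫ y, f y * f y ∂μ| ≤ 0 := by
    refine le_of_forall_pos_le_add fun ε hε => ?_
    have hI : 0 ≤ ∫ y, |f y| ∂μ := integral_nonneg fun y => abs_nonneg _
    refine (hbound (ε / (1 + ∫ y, |f y| ∂μ)) (by positivity)).trans ?_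
    rw [zero_add, div_mul_eq_mul_div, div_le_iff₀ (by positivity)]
    nlinarith
  exact abs_nonpos_iff.1 hle

end HalfSpaceIntegral

/-! ### Calculus in a chart -/

section Chart

open Set Filter Topology MeasureTheory

variable {n : ℕ} [NeZero n] {M : Type u} [TopologicalSpace M]
  [ChartedSpace (EuclideanHalfSpace n) M]

theorem Fn.zext_of_mem {U : Opens M} (f : Fn n U) {x : M} (hx : x ∈ U) :
    Fn.zext f x = f ⟨x, hx⟩ := by
  simp [Fn.zext, hx]

theorem Fn.zext_of_notMem {U : Opens M} (f : Fn n U) {x : M} (hx : x ∉ U) :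
    Fn.zext f x = 0 := by
  simp [Fn.zext, hx]

theorem Fn.zext_contMDiffAt {U : Opens M} (f : Fn n U) {x : M} (hx : x ∈ U) :
    ContMDiffAt (𝓡∂ n) 𝓘(ℝ, ℝ) ∞ (Fn.zext f) x := by
  rw [← contMDiffAt_subtype_iff (U := U) (x := ⟨x, hx⟩)]
  have : (fun y : U => Fn.zext f y) = f := by
    funext y
    exact Fn.zext_of_mem f y.2
  rw [this]
  exact f.contMDiff _

theorem Fn.zext_res_eventuallyEq {U V : Opens M} (h : V ≤ U) (f : Fn n U) {x : M} (hx : x ∈ V) :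
    Fn.zext (Fn.res h f) =ᶠ[𝓝 x] Fn.zext f := by
  filter_upwards [V.isOpen.mem_nhds hx] with y hy
  rw [Fn.zext_of_mem _ hy, Fn.zext_of_mem _ (h hy)]
  rfl

/-- The smooth function on `U` given by a function on `M` which is smooth at all points of `U`. -/
def Fn.mk' {U : Opens M} (g : M → ℝ) (hg : ∀ x ∈ U, ContMDiffAt (𝓡∂ n) 𝓘(ℝ, ℝ) ∞ g x) : Fn n U :=
  ⟨fun x => g x, fun x => contMDiffAt_subtype_iff.2 (hg x x.2)⟩

theorem Fn.zext_mk'_eventuallyEq {U : Opens M} (g : M → ℝ)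
    (hg : ∀ x ∈ U, ContMDiffAt (𝓡∂ n) 𝓘(ℝ, ℝ) ∞ g x) {x : M} (hx : x ∈ U) :
    Fn.zext (Fn.mk' g hg) =ᶠ[𝓝 x] g := by
  filter_upwards [U.isOpen.mem_nhds hx] with y hy
  rw [Fn.zext_of_mem _ hy]
  rfl

theorem TestFn.eq_zero_of_notMem {U : Opens M} {f : Fn n U} {K : Set M}
    (hf : ∀ x : U, (x : M) ∉ K → f x = 0) {x : M} (hx : x ∉ K) : Fn.zext f x = 0 := by
  by_cases hU : x ∈ U
  · rw [Fn.zext_of_mem _ hU]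
    exact hf ⟨x, hU⟩ hx
  · exact Fn.zext_of_notMem _ hU

variable (n M) in
/-- Smooth charts of `M`. -/
abbrev MChart : Type u :=
  {e : OpenPartialHomeomorph M (EuclideanHalfSpace n) // e ∈ IsManifold.maximalAtlas (𝓡∂ n) ∞ M}

namespace MChart

variable (c : MChart n M)

/-- The domain of a chart. -/
def dom : Opens M := ⟨c.1.source, c.1.open_source⟩

/-- The coordinates of a chart, as a partial equivalence with a subset of `ℝⁿ`. -/
abbrev ext : PartialEquiv M (EuclideanSpace ℝ (Fin n)) := c.1.extend (𝓡∂ n)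

variable {c}

theorem ext_symm_ext {x : M} (hx : x ∈ c.dom) : c.ext.symm (c.ext x) = x :=
  c.1.extend_left_inv hx

theorem ext_mem_target {x : M} (hx : x ∈ c.dom) : c.ext x ∈ c.ext.target :=
  c.ext.map_source (by rwa [c.1.extend_source])

theorem target_subset : c.ext.target ⊆ HS n := c.1.extend_target_subset_range

theorem ext_mem_HS {x : M} (hx : x ∈ c.dom) : c.ext x ∈ HS n := target_subset (ext_mem_target hx)

theorem ext_symm_mem {y : EuclideanSpace ℝ (Fin n)} (hy : y ∈ c.ext.target) :
    c.ext.symm y ∈ c.dom := by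
  have := c.ext.map_target hy
  rwa [c.1.extend_source] at this

theorem ext_ext_symm {y : EuclideanSpace ℝ (Fin n)} (hy : y ∈ c.ext.target) :
    c.ext (c.ext.symm y) = y := c.ext.right_inv hy

theorem target_mem_nhdsWithin {x : M} (hx : x ∈ c.dom) : c.ext.target ∈ 𝓝[HS n] c.ext x :=
  c.1.extend_target_mem_nhdsWithin hx

theorem tendsto_ext_symm {x : M} (hx : x ∈ c.dom) :
    Tendsto c.ext.symm (𝓝[HS n] c.ext x) (𝓝 x) :=
  (c.1.map_extend_symm_nhdsWithin_range (I := 𝓡∂ n) hx).le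

theorem contMDiffAt_ext {x : M} (hx : x ∈ c.dom) :
    ContMDiffAt (𝓡∂ n) 𝓘(ℝ, EuclideanSpace ℝ (Fin n)) ∞ c.ext x :=
  c.1.contMDiffAt_extend c.2 hx

theorem measurableSet_target : MeasurableSet c.ext.target := by
  rw [c.1.extend_target]
  exact (c.1.open_target.preimage (𝓡∂ n).continuous_symm).measurableSet.inter
    isClosed_HS.measurableSet

variable (c)

/-- A function on `M`, written in the coordinates of a chart and extended by zero. -/
def read (g : M → ℝ) : EuclideanSpace ℝ (Fin n) → ℝ := c.ext.target.indicator (g ∘ c.ext.symm)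

variable {c} {g g' : M → ℝ} {x : M} {i : Fin n}

theorem read_of_mem {y : EuclideanSpace ℝ (Fin n)} (hy : y ∈ c.ext.target) :
    c.read g y = g (c.ext.symm y) := indicator_of_mem hy _

theorem read_of_notMem {y : EuclideanSpace ℝ (Fin n)} (hy : y ∉ c.ext.target) :
    c.read g y = 0 := indicator_of_notMem hy _

theorem read_ext (hx : x ∈ c.dom) : c.read g (c.ext x) = g x := by
  rw [read_of_mem (ext_mem_target hx), ext_symm_ext hx]

theorem read_eventuallyEq (hx : x ∈ c.dom) :
    c.read g =ᶠ[𝓝[HS n] c.ext x] g ∘ c.ext.symm := by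
  filter_upwards [target_mem_nhdsWithin hx] with y hy
  exact read_of_mem hy

theorem read_contDiffWithinAt (hx : x ∈ c.dom) (hg : ContMDiffAt (𝓡∂ n) 𝓘(ℝ, ℝ) ∞ g x) :
    ContDiffWithinAt ℝ ∞ (c.read g) (HS n) (c.ext x) := by
  have h1 := (contMDiffWithinAt_iff_source_of_mem_maximalAtlas c.2 hx).1
    (contMDiffWithinAt_univ.2 hg)
  rw [preimage_univ, univ_inter, contMDiffWithinAt_iff_contDiffWithinAt] at h1
  exact h1.congr_of_eventuallyEq (read_eventuallyEq hx) (by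
    rw [read_ext hx, Function.comp_apply, ext_symm_ext hx])

/-- Pulling back a smooth function of the coordinates. -/
theorem contMDiffAt_comp_ext {F : EuclideanSpace ℝ (Fin n) → ℝ} (hx : x ∈ c.dom)
    (hF : ContDiffWithinAt ℝ ∞ F (HS n) (c.ext x)) :
    ContMDiffAt (𝓡∂ n) 𝓘(ℝ, ℝ) ∞ (fun y => F (c.ext y)) x := by
  have h1 := hF.contMDiffWithinAt
  rw [← contMDiffWithinAt_univ]
  have h2 : ContMDiffWithinAt (𝓡∂ n) 𝓘(ℝ, ℝ) ∞ (F ∘ c.ext) (c.dom : Set M) x :=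
    h1.comp x (contMDiffAt_ext hx).contMDiffWithinAt fun y hy => ext_mem_HS hy
  exact (h2.contMDiffAt (c.dom.isOpen.mem_nhds hx)).contMDiffWithinAt

theorem read_congr (hx : x ∈ c.dom) (h : g =ᶠ[𝓝 x] g') :
    c.read g =ᶠ[𝓝[HS n] c.ext x] c.read g' := by
  filter_upwards [(tendsto_ext_symm hx).eventually h] with y hy
  by_cases ht : y ∈ c.ext.target
  · rw [read_of_mem ht, read_of_mem ht, hy]
  · rw [read_of_notMem ht, read_of_notMem ht]

variable (c i) in
/-- The `i`-th partial derivative of a function on `M` in the coordinates of a chart. -/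
def deriv (g : M → ℝ) (x : M) : ℝ := pd i (c.read g) (c.ext x)

theorem deriv_contMDiffAt (hx : x ∈ c.dom) (hg : ContMDiffAt (𝓡∂ n) 𝓘(ℝ, ℝ) ∞ g x) :
    ContMDiffAt (𝓡∂ n) 𝓘(ℝ, ℝ) ∞ (c.deriv i g) x :=
  contMDiffAt_comp_ext hx (pd_contDiffWithinAt (read_contDiffWithinAt hx hg) (ext_mem_HS hx))

theorem deriv_congr (hx : x ∈ c.dom) (h : g =ᶠ[𝓝 x] g') : c.deriv i g x = c.deriv i g' x :=
  pd_congr (read_congr hx h) (ext_mem_HS hx)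

theorem read_add : c.read (fun x => g x + g' x) = fun y => c.read g y + c.read g' y := by
  funext y
  by_cases ht : y ∈ c.ext.target
  · simp only [read_of_mem ht]
  · simp only [read_of_notMem ht, add_zero]

theorem read_mul : c.read (fun x => g x * g' x) = fun y => c.read g y * c.read g' y := by
  funext y
  by_cases ht : y ∈ c.ext.target
  · simp only [read_of_mem ht]
  · simp only [read_of_notMem ht, mul_zero]

theorem read_const_mul (a : ℝ) : c.read (fun x => a * g x) = fun y => a * c.read g y := by
  funext y
  by_cases ht : y ∈ c.ext.target
  · simp only [read_of_mem ht]
  · simp only [read_of_notMem ht, mul_zero]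

theorem deriv_add (hx : x ∈ c.dom) (hg : ContMDiffAt (𝓡∂ n) 𝓘(ℝ, ℝ) ∞ g x)
    (hg' : ContMDiffAt (𝓡∂ n) 𝓘(ℝ, ℝ) ∞ g' x) :
    c.deriv i (fun x => g x + g' x) x = c.deriv i g x + c.deriv i g' x := by
  rw [deriv, read_add]
  exact pd_add (read_contDiffWithinAt hx hg) (read_contDiffWithinAt hx hg') (ext_mem_HS hx)

theorem deriv_mul (hx : x ∈ c.dom) (hg : ContMDiffAt (𝓡∂ n) 𝓘(ℝ, ℝ) ∞ g x)
    (hg' : ContMDiffAt (𝓡∂ n) 𝓘(ℝ, ℝ) ∞ g' x) :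
    c.deriv i (fun x => g x * g' x) x = c.deriv i g x * g' x + g x * c.deriv i g' x := by
  rw [deriv, read_mul, pd_mul (read_contDiffWithinAt hx hg) (read_contDiffWithinAt hx hg')
    (ext_mem_HS hx), read_ext hx, read_ext hx]
  rfl

theorem deriv_const_mul (a : ℝ) (hx : x ∈ c.dom) (hg : ContMDiffAt (𝓡∂ n) 𝓘(ℝ, ℝ) ∞ g x) :
    c.deriv i (fun x => a * g x) x = a * c.deriv i g x := by
  rw [deriv, read_const_mul]
  exact pd_const_mul a (read_contDiffWithinAt hx hg) (ext_mem_HS hx)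

theorem deriv_comp_ext {F : EuclideanSpace ℝ (Fin n) → ℝ} (hx : x ∈ c.dom) :
    c.deriv i (fun y => F (c.ext y)) x = pd i F (c.ext x) := by
  refine pd_congr ?_ (ext_mem_HS hx)
  filter_upwards [target_mem_nhdsWithin hx] with y hy
  rw [read_of_mem hy, ext_ext_symm hy]

end MChart

variable {U : Opens M}

theorem hasOrderLT_mulLeft (h : Fn n U) : HasOrderLT 1 (LinearMap.mulLeft ℝ h) := by
  intro f
  refine LinearMap.ext fun g => ?_
  change f * (h * g) - h * (f * g) = 0
  ring

namespace Fn

/-- Multiplication by a smooth function, as a differential operator. -/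
def mulOp (h : Fn n U) : DiffOp n U :=
  ⟨fun W => LinearMap.mulLeft ℝ (Fn.res W.2 h), fun V W hVW f => by
    ext x
    rfl, fun x _ => ⟨⊤, trivial, 1, fun W _ => hasOrderLT_mulLeft _⟩⟩

end Fn

namespace MChart

variable {c : MChart n M} {i : Fin n}

/-- The `i`-th partial derivative of smooth functions on an open subset of the domain of a
chart. -/
def derivFn (c : MChart n M) (i : Fin n) {W : Opens M} (hW : W ≤ c.dom) :
    Module.End ℝ (Fn n W) where
  toFun f := Fn.mk' (c.deriv i (Fn.zext f)) fun _ hx =>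
    deriv_contMDiffAt (hW hx) (Fn.zext_contMDiffAt f hx)
  map_add' f g := by
    ext x
    refine (deriv_congr (g' := fun y => Fn.zext f y + Fn.zext g y) (hW x.2) ?_).trans
      (deriv_add (hW x.2) (Fn.zext_contMDiffAt f x.2) (Fn.zext_contMDiffAt g x.2))
    filter_upwards [W.isOpen.mem_nhds x.2] with y hy
    rw [Fn.zext_of_mem _ hy, Fn.zext_of_mem _ hy, Fn.zext_of_mem _ hy]
    rfl
  map_smul' a f := by
    ext x
    refine (deriv_congr (g' := fun y => a * Fn.zext f y) (hW x.2) ?_).trans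
      (deriv_const_mul a (hW x.2) (Fn.zext_contMDiffAt f x.2))
    filter_upwards [W.isOpen.mem_nhds x.2] with y hy
    rw [Fn.zext_of_mem _ hy, Fn.zext_of_mem _ hy]
    rfl

theorem derivFn_mul {W : Opens M} (hW : W ≤ c.dom) (f g : Fn n W) :
    c.derivFn i hW (f * g) = c.derivFn i hW f * g + f * c.derivFn i hW g := by
  ext x
  have h := deriv_mul (i := i) (hW x.2) (Fn.zext_contMDiffAt f x.2) (Fn.zext_contMDiffAt g x.2)
  refine (deriv_congr (g' := fun y => Fn.zext f y * Fn.zext g y) (hW x.2) ?_).trans (h.trans ?_)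
  · filter_upwards [W.isOpen.mem_nhds x.2] with y hy
    rw [Fn.zext_of_mem _ hy, Fn.zext_of_mem _ hy, Fn.zext_of_mem _ hy]
    rfl
  · rw [Fn.zext_of_mem _ x.2, Fn.zext_of_mem _ x.2]
    rfl

theorem derivFn_res {V W : Opens M} (hVW : V ≤ W) (hW : W ≤ c.dom) (f : Fn n W) :
    c.derivFn i (hVW.trans hW) (Fn.res hVW f) = Fn.res hVW (c.derivFn i hW f) := by
  ext x
  exact deriv_congr (hW (hVW x.2)) (Fn.zext_res_eventuallyEq hVW f x.2)

theorem hasOrderLT_derivFn {W : Opens M} (hW : W ≤ c.dom) : HasOrderLT 2 (c.derivFn i hW) := by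
  intro f
  have : LinearMap.mulLeft ℝ f * c.derivFn i hW - c.derivFn i hW * LinearMap.mulLeft ℝ f =
      LinearMap.mulLeft ℝ (-c.derivFn i hW f) := by
    refine LinearMap.ext fun g => ?_
    change f * c.derivFn i hW g - c.derivFn i hW (f * g) = -c.derivFn i hW f * g
    rw [derivFn_mul]
    ring
  rw [this]
  exact hasOrderLT_mulLeft _

/-- The `i`-th partial derivative in a chart, as a differential operator. -/
def derivOp (c : MChart n M) (i : Fin n) (hU : U ≤ c.dom) : DiffOp n U :=
  ⟨fun W => c.derivFn i (le_trans W.2 hU), fun _ W h f => derivFn_res h (le_trans W.2 hU) f,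
    fun _ _ => ⟨⊤, trivial, 2, fun W _ => hasOrderLT_derivFn (le_trans W.2 hU)⟩⟩

/-- The pull-back of a smooth function of the coordinates. -/
def pull (c : MChart n M) (hU : U ≤ c.dom) (F : EuclideanSpace ℝ (Fin n) → ℝ)
    (hF : ContDiffOn ℝ ∞ F (HS n)) : Fn n U :=
  Fn.mk' (fun x => F (c.ext x)) fun _ hx => contMDiffAt_comp_ext (hU hx) (hF _ (ext_mem_HS (hU hx)))

/-- The `i`-th coordinate function of a chart. -/
def coord (c : MChart n M) (i : Fin n) (hU : U ≤ c.dom) : Fn n U :=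
  c.pull hU (fun y => y i) (ContDiff.contDiffOn (by fun_prop))

theorem derivFn_pull (hU : U ≤ c.dom) (F : EuclideanSpace ℝ (Fin n) → ℝ)
    (hF : ContDiffOn ℝ ∞ F (HS n)) :
    c.derivFn i hU (c.pull hU F hF) = c.pull hU (pd i F) (pd_contDiffOn hF) := by
  ext x
  exact (deriv_congr (hU x.2) (Fn.zext_mk'_eventuallyEq _ _ x.2)).trans (deriv_comp_ext (hU x.2))

theorem derivFn_coord (j : Fin n) (hU : U ≤ c.dom) :
    c.derivFn i hU (c.coord j hU) = if i = j then 1 else 0 := by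
  ext x
  rw [coord, derivFn_pull]
  refine (pd_coord j (ext_mem_HS (hU x.2))).trans ?_
  split_ifs <;> rfl

theorem halfTest_read {f : TestFn n U} (hU : U ≤ c.dom) : HalfTest (c.read (Fn.zext f.1)) := by
  obtain ⟨K, hK, hKU, hf⟩ := f.2
  have hKc : IsCompact (c.ext '' K) := hK.image_of_continuousOn
    (c.1.continuousOn_extend.mono (by rw [c.1.extend_source]; exact hKU.trans hU))
  have h0 : ∀ y ∉ c.ext '' K, c.read (Fn.zext f.1) y = 0 := by
    intro y hy
    by_cases ht : y ∈ c.ext.target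
    · rw [read_of_mem ht]
      exact TestFn.eq_zero_of_notMem hf fun h => hy ⟨_, h, ext_ext_symm ht⟩
    · exact read_of_notMem ht
  refine ⟨fun y hy => ?_, HasCompactSupport.intro hKc h0, fun y hy =>
    read_of_notMem fun h => hy (target_subset h)⟩
  by_cases hyK : y ∈ c.ext '' K
  · obtain ⟨x, hx, rfl⟩ := hyK
    exact read_contDiffWithinAt (hU (hKU hx)) (Fn.zext_contMDiffAt f.1 (hKU hx))
  · refine (contDiffWithinAt_const (c := (0 : ℝ))).congr_of_eventuallyEq ?_ (h0 y hyK)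
    exact (hKc.isClosed.isOpen_compl.eventually_mem hyK |>.mono fun z hz => h0 z hz).filter_mono
      nhdsWithin_le_nhds

variable [T2Space M]

theorem read_zext_derivOp (hU : U ≤ c.dom) (f : TestFn n U) :
    c.read (Fn.zext ((c.derivOp i hU).testMap f).1) = pd i (c.read (Fn.zext f.1)) := by
  have hT := halfTest_read (f := f) hU
  funext y
  by_cases ht : y ∈ c.ext.target
  · rw [read_of_mem ht]
    by_cases hy : c.ext.symm y ∈ U
    · rw [Fn.zext_of_mem _ hy]
      change pd i _ (c.ext (c.ext.symm y)) = _
      rw [ext_ext_symm ht]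
      rfl
    · rw [Fn.zext_of_notMem _ hy]
      obtain ⟨K, hK, hKU, hf⟩ := f.2
      have h0 : Fn.zext f.1 =ᶠ[𝓝 (c.ext.symm y)] fun _ => 0 := by
        filter_upwards [hK.isClosed.isOpen_compl.mem_nhds fun h => hy (hKU h)] with z hz
        exact TestFn.eq_zero_of_notMem hf hz
      have h1 := deriv_congr (i := i) (ext_symm_mem ht) h0
      have h2 : c.deriv i (fun _ => (0 : ℝ)) (c.ext.symm y) = 0 := by
        have : c.read (fun _ => (0 : ℝ)) = fun _ => 0 := by
          funext z
          by_cases hz : z ∈ c.ext.target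
          · rw [read_of_mem hz]
          · rw [read_of_notMem hz]
        rw [deriv, this, pd_const]
      rw [h2, deriv, ext_ext_symm ht] at h1
      exact h1.symm
  · rw [read_of_notMem ht]
    by_cases hy : y ∈ HS n
    · obtain ⟨K, hK, hKU, hf⟩ := f.2
      have hKc : IsCompact (c.ext '' K) := hK.image_of_continuousOn
        (c.1.continuousOn_extend.mono (by rw [c.1.extend_source]; exact hKU.trans hU))
      have hyK : y ∉ c.ext '' K := by
        rintro ⟨x, hx, rfl⟩
        exact ht (ext_mem_target (hU (hKU hx)))
      have h0 : c.read (Fn.zext f.1) =ᶠ[𝓝[HS n] y] fun _ => 0 := by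
        refine (hKc.isClosed.isOpen_compl.eventually_mem hyK |>.mono fun z hz => ?_).filter_mono
          nhdsWithin_le_nhds
        by_cases hzt : z ∈ c.ext.target
        · rw [read_of_mem hzt]
          exact TestFn.eq_zero_of_notMem hf fun h => hz ⟨_, h, ext_ext_symm hzt⟩
        · exact read_of_notMem hzt
      rw [pd_congr h0 hy, pd_const]
    · exact (pd_eq_zero_of_notMem hy).symm

theorem read_zext_mulOp_coord (hU : U ≤ c.dom) (f : TestFn n U) :
    c.read (Fn.zext ((Fn.mulOp (c.coord i hU)).testMap f).1) =
      fun y => y i * c.read (Fn.zext f.1) y := by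
  funext y
  by_cases ht : y ∈ c.ext.target
  · rw [read_of_mem ht, read_of_mem ht]
    by_cases hy : c.ext.symm y ∈ U
    · rw [Fn.zext_of_mem _ hy, Fn.zext_of_mem _ hy]
      change c.ext (c.ext.symm y) i * _ = _
      rw [ext_ext_symm ht]
      rfl
    · rw [Fn.zext_of_notMem _ hy, Fn.zext_of_notMem _ hy, mul_zero]
  · rw [read_of_notMem ht, read_of_notMem ht, mul_zero]

end MChart

end Chart

/-! ### Cut-off functions -/

section Cutoff

open Set Filter Topology MeasureTheory

variable {n : ℕ} [NeZero n] {M : Type u} [TopologicalSpace M]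
  [ChartedSpace (EuclideanHalfSpace n) M] [T2Space M] [SecondCountableTopology M]
  [IsManifold (𝓡∂ n) ∞ M]

theorem exists_cutoff {U : Opens M} {K : Set M} (hK : IsCompact K) (hKU : K ⊆ U) :
    ∃ (χ : TestFn n U) (V : Opens M), K ⊆ V ∧ V ≤ U ∧ ∀ x : U, (x : M) ∈ V → χ.1 x = 1 := by
  have : LocallyCompactSpace M := Manifold.locallyCompact_of_finiteDimensional (𝓡∂ n)
  obtain ⟨L, hL, hKL, hLU⟩ := exists_compact_between hK U.isOpen hKU
  obtain ⟨χ, h1, h0, -⟩ := exists_contMDiffMap_one_nhds_of_subset_interior (𝓡∂ n) (n := ⊤)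
    hK.isClosed hKL
  obtain ⟨V, hV, hKV, hχ⟩ := eventually_nhdsSet_iff_exists.1 h1
  refine ⟨⟨Fn.mk' χ fun x _ => χ.contMDiff x, L, hL, hLU, fun x hx => h0 x hx⟩,
    ⟨V ∩ U, hV.inter U.isOpen⟩, fun x hx => ⟨hKV hx, hKU hx⟩, fun x hx => hx.2,
    fun x hx => hχ x hx.1⟩

theorem exists_cutoff_at {U : Opens M} {x : M} (hx : x ∈ U) :
    ∃ (χ : TestFn n U) (V : Opens M), x ∈ V ∧ V ≤ U ∧ ∀ x : U, (x : M) ∈ V → χ.1 x = 1 := by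
  obtain ⟨χ, V, h⟩ := exists_cutoff (n := n) isCompact_singleton (singleton_subset_iff.2 hx)
  exact ⟨χ, V, h.1 rfl, h.2⟩

/-- A smooth function agrees near a given point with a smooth function of the coordinates defined
on the whole half-space, which vanishes where the given function does. -/
theorem MChart.exists_eq_pull_of_support {c : MChart n M} {U : Opens M} (hU : U ≤ c.dom)
    (f : Fn n U) {x : M} (hx : x ∈ U) :
    ∃ (F : EuclideanSpace ℝ (Fin n) → ℝ) (hF : ContDiffOn ℝ ∞ F (HS n))
      (V : Opens M) (hV : V ≤ U), x ∈ V ∧ Fn.res hV f = c.pull (hV.trans hU) F hF ∧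
        ∀ y, (∀ z : U, c.ext z = y → f z = 0) → F y = 0 := by
  obtain ⟨χ, V, hxV, hVU, hχ⟩ := exists_cutoff_at (n := n) hx
  obtain ⟨K, hK, hKU, h0⟩ := χ.2
  let g : TestFn n U := ⟨χ.1 * f, K, hK, hKU, fun y hy => by
    change χ.1 y * f y = 0
    rw [h0 y hy, zero_mul]⟩
  refine ⟨_, (halfTest_read (f := g) hU).contDiffOn, V, hVU, hxV, ?_, fun y hy => ?_⟩
  · ext y
    change f ⟨y, hVU y.2⟩ = c.read _ (c.ext y)
    rw [read_ext (hU (hVU y.2)), Fn.zext_of_mem _ (hVU y.2)]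
    change _ = χ.1 ⟨y, hVU y.2⟩ * f ⟨y, hVU y.2⟩
    rw [hχ ⟨y, hVU y.2⟩ y.2, one_mul]
  · by_cases ht : y ∈ c.ext.target
    · rw [read_of_mem ht]
      by_cases hyU : c.ext.symm y ∈ U
      · rw [Fn.zext_of_mem _ hyU]
        change χ.1 ⟨_, hyU⟩ * f ⟨_, hyU⟩ = 0
        rw [hy ⟨_, hyU⟩ (ext_ext_symm ht), mul_zero]
      · exact Fn.zext_of_notMem _ hyU
    · exact read_of_notMem ht

theorem MChart.exists_eq_pull {c : MChart n M} {U : Opens M} (hU : U ≤ c.dom) (f : Fn n U) {x : M}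
    (hx : x ∈ U) : ∃ (F : EuclideanSpace ℝ (Fin n) → ℝ) (hF : ContDiffOn ℝ ∞ F (HS n))
      (V : Opens M) (hV : V ≤ U), x ∈ V ∧ Fn.res hV f = c.pull (hV.trans hU) F hF := by
  obtain ⟨F, hF, V, hV, hxV, h, -⟩ := exists_eq_pull_of_support hU f hx
  exact ⟨F, hF, V, hV, hxV, h⟩

end Cutoff

/-! ### The coordinate density of a chart -/

section Density

open Set Filter Topology MeasureTheory

variable {n : ℕ} [NeZero n] {M : Type u} [TopologicalSpace M]
  [ChartedSpace (EuclideanHalfSpace n) M]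

theorem Fn.zext_add {U : Opens M} (f g : Fn n U) :
    Fn.zext (f + g) = fun x => Fn.zext f x + Fn.zext g x := by
  funext x
  by_cases hx : x ∈ U <;> simp [Fn.zext, hx]

theorem Fn.zext_smul {U : Opens M} (a : ℝ) (f : Fn n U) :
    Fn.zext (a • f) = fun x => a * Fn.zext f x := by
  funext x
  by_cases hx : x ∈ U <;> simp [Fn.zext, hx]

variable [T2Space M]

namespace MChart

variable {U : Opens M}

/-- The density `f ↦ ∫ f dx` on an open subset of the domain of a chart, `dx` being Lebesgue
measure in the coordinates of the chart. -/
def dx (c : MChart n M) (hU : U ≤ c.dom) : Distribution n U :=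
  ⟨{  toFun := fun f => ∫ y, c.read (Fn.zext f.1) y
      map_add' := fun f g => by
        rw [← integral_add ((halfTest_read hU).integrable _) ((halfTest_read hU).integrable _),
          ← read_add, ← Fn.zext_add]
        rfl
      map_smul' := fun a f => by
        rw [RingHom.id_apply, smul_eq_mul, ← integral_const_mul, ← read_const_mul,
          ← Fn.zext_smul]
        rfl }, by
    intro K hK hKU
    have hKc : IsCompact (c.ext '' K) := hK.image_of_continuousOn
      (c.1.continuousOn_extend.mono (by rw [c.1.extend_source]; exact hKU.trans hU))
    refine ⟨{1}, (volume (c.ext '' K)).toReal, fun f hf B hB hs => ?_⟩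
    have h0 : ∀ y ∉ c.ext '' K, c.read (Fn.zext f.1) y = 0 := by
      intro y hy
      by_cases ht : y ∈ c.ext.target
      · rw [read_of_mem ht]
        exact TestFn.eq_zero_of_notMem hf fun h => hy ⟨_, h, ext_ext_symm ht⟩
      · exact read_of_notMem ht
    have hb : ∀ y, ‖c.read (Fn.zext f.1) y‖ ≤ B := by
      intro y
      by_cases ht : y ∈ c.ext.target
      · rw [read_of_mem ht]
        by_cases hy : c.ext.symm y ∈ U
        · rw [Fn.zext_of_mem _ hy]
          exact hs 1 (Finset.mem_singleton_self _) ⟨_, hy⟩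
        · rw [Fn.zext_of_notMem _ hy, norm_zero]
          exact hB
      · rw [read_of_notMem ht, norm_zero]
        exact hB
    change |∫ y, c.read (Fn.zext f.1) y| ≤ _
    rw [← setIntegral_eq_integral_of_forall_compl_eq_zero h0, mul_comm, ← Real.norm_eq_abs]
    exact norm_setIntegral_le_of_norm_le_const hKc.measure_lt_top fun y _ => hb y⟩

omit [T2Space M] in
theorem dx_apply (c : MChart n M) (hU : U ≤ c.dom) (f : TestFn n U) :
    (c.dx hU).1 f = ∫ y, c.read (Fn.zext f.1) y := rfl

theorem dx_res (c : MChart n M) {V : Opens M} (h : V ≤ U) (hU : U ≤ c.dom) :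
    Distribution.res h (c.dx hU) = c.dx (h.trans hU) := by
  refine Subtype.ext (LinearMap.ext fun f => ?_)
  rw [Distribution.res_apply, dx_apply, dx_apply, TestFn.zext_ext]

omit [NeZero n] in
theorem _root_.BoundaryDMod.contDiffWithinAt_det {φ : EuclideanSpace ℝ (Fin n) →
      EuclideanSpace ℝ (Fin n) →L[ℝ] EuclideanSpace ℝ (Fin n)}
    {s : Set (EuclideanSpace ℝ (Fin n))} {x : EuclideanSpace ℝ (Fin n)}
    (h : ContDiffWithinAt ℝ ∞ φ s x) : ContDiffWithinAt ℝ ∞ (fun y => (φ y).det) s x := by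
  let b := (EuclideanSpace.basisFun (Fin n) ℝ).toBasis
  have h1 : ∀ y, (φ y).det = ∑ σ : Equiv.Perm (Fin n), (Equiv.Perm.sign σ : ℤ) •
      ∏ i, (φ y (EuclideanSpace.single i 1)) (σ i) := by
    intro y
    rw [ContinuousLinearMap.det, ← LinearMap.det_toMatrix b, Matrix.det_apply]
    refine Finset.sum_congr rfl fun σ _ => ?_
    congr 1
  simp only [h1]
  refine ContDiffWithinAt.sum fun σ _ => ?_
  simp only [zsmul_eq_mul]
  refine contDiffWithinAt_const.mul (contDiffWithinAt_prod fun i _ => ?_)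
  exact (EuclideanSpace.proj (σ i) : EuclideanSpace ℝ (Fin n) →L[ℝ] ℝ).contDiff.comp_contDiffWithinAt
    (h.clm_apply contDiffWithinAt_const)

omit [T2Space M] in
/-- The coordinate density of a chart is smooth in every other chart, by the change of variables
formula. -/
theorem isSmoothDensity_dx (c : MChart n M) (hU : U ≤ c.dom) : IsSmoothDensity (c.dx hU) := by
  intro e he
  let d : MChart n M := ⟨e, he⟩
  -- `φ` is the change of coordinates and `J` the absolute value of its Jacobian determinant
  let φ := (𝓡∂ n).extendCoordChange d.1 c.1
  have hφs : ∀ z, z ∈ φ.source ↔ z ∈ d.ext.target ∧ d.ext.symm z ∈ c.dom := by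
    intro z
    rw [PartialEquiv.trans_source, c.1.extend_source]
    rfl
  have hφt : ∀ y, y ∈ φ.target ↔ y ∈ c.ext.target ∧ c.ext.symm y ∈ d.dom := by
    intro y
    rw [PartialEquiv.trans_target, PartialEquiv.symm_target, d.1.extend_source]
    rfl
  have hφd : ∀ z ∈ φ.source, ContDiffWithinAt ℝ ∞ φ (HS n) z := fun z hz =>
    (𝓡∂ n).contDiffWithinAt_extendCoordChange d.2 c.2 hz
  have hsub : φ.source ⊆ HS n := fun z hz => target_subset ((hφs z).1 hz).1
  have hmeas : MeasurableSet φ.source := by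
    rw [(𝓡∂ n).extendCoordChange_source, (𝓡∂ n).image_eq]
    exact ((OpenPartialHomeomorph.open_source _).preimage
      (𝓡∂ n).continuous_symm).measurableSet.inter isClosed_HS.measurableSet
  let J : EuclideanSpace ℝ (Fin n) → ℝ := fun z => |(fderivWithin ℝ φ (HS n) z).det|
  refine ⟨fun x => J (d.ext x), fun x hx => ContMDiffAt.contMDiffWithinAt ?_, fun f hf => ?_⟩
  · have hxd : x ∈ d.dom := hx.2
    have hz : d.ext x ∈ φ.source := (hφs _).2 ⟨ext_mem_target hxd, by
      rw [ext_symm_ext hxd]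
      exact hU hx.1⟩
    refine contMDiffAt_comp_ext (c := d) hxd ?_
    refine ContDiffWithinAt.abs (contDiffWithinAt_det
      ((hφd _ hz).fderivWithin_right (m := ∞) uniqueDiffOn_HS (by simp) (hsub hz))) ?_
    have h1 := (𝓡∂ n).isInvertible_fderivWithin_extendCoordChange (n := ∞) (by simp) d.2 c.2 hz
    have h2 : fderivWithin ℝ φ (HS n) (d.ext x) = fderivWithin ℝ φ φ.source (d.ext x) :=
      fderivWithin_of_mem_nhdsWithin ((𝓡∂ n).extendCoordChange_source_mem_nhdsWithin hz)
        (uniqueDiffOn_HS _ (hsub hz))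
        (((hφd _ hz).differentiableWithinAt (by simp)).mono hsub)
    rw [h2]
    obtain ⟨A, hA⟩ := h1
    rw [← hA]
    exact A.toLinearEquiv.isUnit_det'.ne_zero
  · -- as `f` is supported in `U`, both integrals may be restricted to the overlap of the charts
    obtain ⟨K, hK, hKU, hf⟩ := hf
    have h1 : ∀ y ∉ φ.target, c.read (Fn.zext f.1) y = 0 := by
      intro y hy
      by_cases ht : y ∈ c.ext.target
      · rw [read_of_mem ht]
        exact TestFn.eq_zero_of_notMem hf fun h => hy ((hφt y).2 ⟨ht, (hKU h).2⟩)
      · exact read_of_notMem ht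
    have h2 : ∀ z ∈ d.ext.target \ φ.source,
        J (d.ext (d.ext.symm z)) * Fn.zext f.1 (d.ext.symm z) = 0 := by
      rintro z ⟨hz, hzs⟩
      rw [TestFn.eq_zero_of_notMem hf fun h => hzs ((hφs z).2 ⟨hz, hU (hKU h).1⟩), mul_zero]
    change _ = ∫ z in d.ext.target, J (d.ext (d.ext.symm z)) * Fn.zext f.1 (d.ext.symm z)
    rw [dx_apply, ← setIntegral_eq_integral_of_forall_compl_eq_zero h1,
      setIntegral_eq_of_subset_of_forall_sdiff_eq_zero measurableSet_target
        (fun z hz => ((hφs z).1 hz).1) h2, ← φ.image_source_eq_target,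
      integral_image_eq_integral_abs_det_fderiv_smul volume hmeas (fun z hz =>
        (((hφd z hz).differentiableWithinAt (by simp)).hasFDerivWithinAt).mono hsub) φ.injOn]
    refine setIntegral_congr_fun hmeas fun z hz => ?_
    have hz' := (hφs z).1 hz
    have h3 : φ z ∈ c.ext.target := ((hφt _).1 (φ.map_source hz)).1
    have h4 : c.ext.symm (φ z) = d.ext.symm z := ext_symm_ext hz'.2
    change J z • c.read (Fn.zext f.1) (φ z) = J (d.ext (d.ext.symm z)) * _
    rw [read_of_mem h3, h4, ext_ext_symm hz'.1, smul_eq_mul]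

end MChart

end Density

/-! ### Generation of the `∂`-smooth densities by coordinate densities -/

section Generation

open Set Filter Topology MeasureTheory

variable {n : ℕ} [NeZero n] {M : Type u} [TopologicalSpace M]
  [ChartedSpace (EuclideanHalfSpace n) M] [T2Space M]

omit [T2Space M] in
theorem Distribution.ext_apply {U : Opens M} {T T' : Distribution n U} (h : ∀ f, T.1 f = T'.1 f) :
    T = T' :=
  Subtype.ext (LinearMap.ext h)

theorem Distribution.res_res {U V W : Opens M} (h : V ≤ U) (h' : W ≤ V) (T : Distribution n U) :
    Distribution.res h' (Distribution.res h T) = Distribution.res (h'.trans h) T :=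
  Distribution.ext_apply fun f => by simp [TestFn.ext_ext]

theorem Distribution.rmul_mul {U : Opens M} (T : Distribution n U) (D D' : DiffOp n U) :
    T.rmul (D * D') = (T.rmul D).rmul D' := rfl

theorem Distribution.rmul_add {U : Opens M} (T : Distribution n U) (D D' : DiffOp n U) :
    T.rmul (D + D') = T.rmul D + T.rmul D' :=
  Distribution.ext_apply fun f => T.1.map_add (D.testMap f) (D'.testMap f)

theorem Distribution.rmul_smul {U : Opens M} (T : Distribution n U) (a : ℝ) (D : DiffOp n U) :
    T.rmul (a • D) = a • T.rmul D :=
  Distribution.ext_apply fun f => T.1.map_smul a (D.testMap f)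

namespace MChart

variable {U : Opens M} {c : MChart n M}

/-- The distributions which near every point, and in every chart, have the form `dx · D` with a
differential operator `D`. They form a subsheaf of right modules over the differential operators
which contains the smooth densities, and hence all `∂`-smooth densities. -/
def generated (n : ℕ) [NeZero n] (M : Type u) [TopologicalSpace M]
    [ChartedSpace (EuclideanHalfSpace n) M] [T2Space M] : SubDModule n M where
  sections U :=
    { carrier := {T | ∀ x ∈ U, ∀ c : MChart n M, x ∈ c.dom → ∃ (V : Opens M) (h : V ≤ U)
        (hV : V ≤ c.dom) (D : DiffOp n V), x ∈ V ∧ Distribution.res h T = (c.dx hV).rmul D}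
      zero_mem' := fun x hx c hxc => ⟨U ⊓ c.dom, inf_le_left, inf_le_right, 0, ⟨hx, hxc⟩, by
        have h := Distribution.rmul_smul (c.dx (inf_le_right : U ⊓ c.dom ≤ c.dom)) 0 0
        rw [zero_smul, zero_smul] at h
        rw [h, map_zero]⟩
      add_mem' := by
        intro T T' hT hT' x hx c hxc
        obtain ⟨V, h, hV, D, hxV, hD⟩ := hT x hx c hxc
        obtain ⟨V', h', hV', D', hxV', hD'⟩ := hT' x hx c hxc
        refine ⟨V ⊓ V', inf_le_left.trans h, inf_le_left.trans hV,
          D.res inf_le_left + D'.res inf_le_right, ⟨hxV, hxV'⟩, ?_⟩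
        rw [map_add, Distribution.rmul_add]
        have e := congrArg (Distribution.res (inf_le_left : V ⊓ V' ≤ V)) hD
        have e' := congrArg (Distribution.res (inf_le_right : V ⊓ V' ≤ V')) hD'
        rw [Distribution.res_res, Distribution.res_rmul, dx_res] at e e'
        rw [e, ← e']
      smul_mem' := by
        intro a T hT x hx c hxc
        obtain ⟨V, h, hV, D, hxV, hD⟩ := hT x hx c hxc
        exact ⟨V, h, hV, a • D, hxV, by rw [map_smul, Distribution.rmul_smul, hD]⟩ }
  res_mem := by
    intro U V h T hT x hx c hxc
    obtain ⟨W, hW, hWc, D, hxW, hD⟩ := hT x (h hx) c hxc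
    refine ⟨W ⊓ V, inf_le_right, inf_le_left.trans hWc, D.res inf_le_left, ⟨hxW, hx⟩, ?_⟩
    have e := congrArg (Distribution.res (inf_le_left : W ⊓ V ≤ W)) hD
    rw [Distribution.res_res, Distribution.res_rmul, dx_res] at e
    rw [Distribution.res_res, e]
  rmul_mem := by
    intro U T D hT x hx c hxc
    obtain ⟨V, h, hV, D', hxV, hD'⟩ := hT x hx c hxc
    exact ⟨V, h, hV, D' * D.res h, hxV, by
      rw [Distribution.res_rmul, hD', Distribution.rmul_mul]⟩
  glue := by
    intro U T hT x hx c hxc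
    obtain ⟨V, h, hxV, hTV⟩ := hT x hx
    obtain ⟨W, hW, hWc, D, hxW, hD⟩ := hTV x hxV c hxc
    exact ⟨W, hW.trans h, hWc, D, hxW, by rw [← hD, Distribution.res_res]⟩

theorem smoothDensity_mem_generated {T : Distribution n U} (hT : IsSmoothDensity T) :
    T ∈ (generated n M).sections U := by
  intro x hx c hxc
  obtain ⟨ρ, hρ, hT⟩ := hT c.1 c.2
  have hρ' : ∀ y ∈ U ⊓ c.dom, ContMDiffAt (𝓡∂ n) 𝓘(ℝ, ℝ) ∞ ρ y := fun y hy =>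
    (hρ y hy).contMDiffAt ((U ⊓ c.dom).isOpen.mem_nhds hy)
  refine ⟨U ⊓ c.dom, inf_le_left, inf_le_right, Fn.mulOp (Fn.mk' ρ hρ'), ⟨hx, hxc⟩,
    Distribution.ext_apply fun f => ?_⟩
  obtain ⟨K, hK, hKU, hf⟩ := f.2
  rw [Distribution.res_apply, hT _ ⟨K, hK, hKU, fun y hy => ?_⟩, Distribution.rmul_apply, dx_apply,
    ← integral_indicator measurableSet_target, TestFn.zext_ext]
  · refine integral_congr_ae (Eventually.of_forall fun y => ?_)
    change _ = indicator _ _ y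
    congr 1
    funext y
    change ρ (c.ext.symm y) * Fn.zext f.1 (c.ext.symm y) = Fn.zext _ (c.ext.symm y)
    by_cases hy : c.ext.symm y ∈ U ⊓ c.dom
    · rw [Fn.zext_of_mem _ hy, Fn.zext_of_mem _ hy]
      rfl
    · rw [Fn.zext_of_notMem _ hy, Fn.zext_of_notMem _ hy, mul_zero]
  · exact TestFn.eq_zero_of_notMem hf hy

/-- Every `∂`-smooth density is locally of the form `dx · D` with a differential operator `D`. -/
theorem exists_eq_dx_rmul (w : BdrySmoothDensity n U) {x : M} (hx : x ∈ U) (hxc : x ∈ c.dom) :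
    ∃ (V : Opens M) (h : V ≤ U) (hV : V ≤ c.dom) (D : DiffOp n V), x ∈ V ∧
      Distribution.res h w.1 = (c.dx hV).rmul D := by
  have h := w.2
  simp only [bdrySmoothDensities, Submodule.mem_iInf] at h
  exact h ⟨generated n M, fun V T hT => smoothDensity_mem_generated hT⟩ x hx c hxc

/-- The coordinate density of a chart as a `∂`-smooth density. -/
def dxB (c : MChart n M) (hU : U ≤ c.dom) : BdrySmoothDensity n U :=
  ⟨c.dx hU, by
    simp only [bdrySmoothDensities, Submodule.mem_iInf]
    exact fun S => S.2 U _ (isSmoothDensity_dx c hU)⟩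

/-- The integral of a tangential derivative vanishes. -/
theorem dx_rmul_derivOp (hU : U ≤ c.dom) {i : Fin n} (hi : i ≠ 0) :
    (c.dx hU).rmul (c.derivOp i hU) = 0 :=
  Distribution.ext_apply fun f => by
    rw [Distribution.rmul_apply, dx_apply, read_zext_derivOp hU,
      (halfTest_read hU).integral_pd hi]
    rfl

/-- The integral of `∂_0 (x_0 f)` is the boundary integral of `-x_0 f`, which vanishes. -/
theorem dx_rmul_derivOp_zero_mul (hU : U ≤ c.dom) :
    (c.dx hU).rmul (c.derivOp 0 hU * Fn.mulOp (c.coord 0 hU)) = 0 :=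
  Distribution.ext_apply fun f => by
    obtain ⟨σ, -, h0, hσ, -, -⟩ := exists_boundary_measure n
    rw [Distribution.rmul_mul, Distribution.rmul_apply, Distribution.rmul_apply, dx_apply,
      read_zext_derivOp hU, hσ _ (halfTest_read hU), read_zext_mulOp_coord hU,
      integral_eq_zero_of_ae]
    · exact neg_zero
    · filter_upwards [h0] with y hy
      rw [hy, zero_mul]
      rfl

/-- The integral of `∂_0 ∂_i f` is the boundary integral of a tangential derivative, which
vanishes. -/
theorem dx_rmul_derivOp_zero_mul_derivOp (hU : U ≤ c.dom) {i : Fin n} (hi : i ≠ 0) :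
    (c.dx hU).rmul (c.derivOp 0 hU * c.derivOp i hU) = 0 :=
  Distribution.ext_apply fun f => by
    obtain ⟨σ, -, -, hσ, hσi, -⟩ := exists_boundary_measure n
    rw [Distribution.rmul_mul, Distribution.rmul_apply, Distribution.rmul_apply, dx_apply,
      read_zext_derivOp hU, hσ _ (halfTest_read hU), read_zext_derivOp hU,
      hσi _ i hi (halfTest_read hU)]
    exact neg_zero

/-- A polynomial in the coordinates of a chart, as a smooth function. -/
def polyFn (c : MChart n M) (hU : U ≤ c.dom) (p : MvPolynomial (Fin n) ℝ) : Fn n U :=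
  MvPolynomial.aeval (fun i => c.coord i hU) p

omit [T2Space M] in
theorem polyFn_apply (hU : U ≤ c.dom) (p : MvPolynomial (Fin n) ℝ) (x : U) :
    c.polyFn hU p x = MvPolynomial.eval (fun i => c.ext x i) p := by
  induction p using MvPolynomial.induction_on with
  | C a =>
    rw [polyFn, MvPolynomial.aeval_C, MvPolynomial.eval_C]
    exact rfl
  | add p q hp hq =>
    rw [polyFn, map_add, map_add, ← hp, ← hq]
    rfl
  | mul_X p i hp =>
    rw [polyFn, map_mul, map_mul, ← hp, MvPolynomial.aeval_X, MvPolynomial.eval_X]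
    rfl

theorem read_zext_mulOp_polyFn (hU : U ≤ c.dom) (p : MvPolynomial (Fin n) ℝ) (f : TestFn n U) :
    c.read (Fn.zext ((Fn.mulOp (c.polyFn hU p)).testMap f).1) =
      fun y => MvPolynomial.eval (fun i => y i) p * c.read (Fn.zext f.1) y := by
  funext y
  by_cases ht : y ∈ c.ext.target
  · rw [read_of_mem ht, read_of_mem ht]
    by_cases hy : c.ext.symm y ∈ U
    · rw [Fn.zext_of_mem _ hy, Fn.zext_of_mem _ hy]
      change c.polyFn hU p ⟨c.ext.symm y, hy⟩ * _ = _
      rw [polyFn_apply, ext_ext_symm ht]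
      rfl
    · rw [Fn.zext_of_notMem _ hy, Fn.zext_of_notMem _ hy, mul_zero]
  · rw [read_of_notMem ht, read_of_notMem ht, mul_zero]

/-- A test function whose polynomial moments vanish is zero at interior points. -/
theorem eq_zero_of_moments (hU : U ≤ c.dom) (f : TestFn n U)
    (h : ∀ p, (c.dx hU).1 ((Fn.mulOp (c.polyFn hU p)).testMap f) = 0) (x : U)
    (hx : 0 < c.ext x 0) : f.1 x = 0 := by
  have hT := halfTest_read (f := f) hU
  have h1 := integral_mul_self_eq_zero (μ := volume) hT fun p => by
    have := h p
    rwa [dx_apply, read_zext_mulOp_polyFn] at this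
  set F := c.read (Fn.zext f.1) with hF
  have h2 : (fun y => F y * F y) =ᵐ[volume] 0 := by
    refine (integral_eq_zero_iff_of_nonneg (fun y => mul_self_nonneg _) ?_).1 h1
    have hK := hT.isCompact
    have h3 : (fun y => F y * F y) = (HS n ∩ tsupport F).indicator (fun y => F y * F y) := by
      funext y
      by_cases hy : y ∈ HS n ∩ tsupport F
      · rw [indicator_of_mem hy]
      · rw [indicator_of_notMem hy]
        have := hT.eq_indicator
        rw [← this, indicator_of_notMem hy, mul_zero]
    rw [h3, integrable_indicator_iff hK.measurableSet]
    have := hT.continuousOn.mono (inter_subset_left (t := tsupport F))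
    exact (this.mul this).integrableOn_compact hK
  -- a continuous function which vanishes almost everywhere vanishes on every open set
  have hO : IsOpen {y : EuclideanSpace ℝ (Fin n) | 0 < y 0} :=
    isOpen_lt continuous_const (by fun_prop)
  have hc : ContinuousOn (fun y => F y * F y) {y | 0 < y 0} :=
    (hT.continuousOn.mono fun y hy => mem_HS.2 (le_of_lt hy)).mul
      (hT.continuousOn.mono fun y hy => mem_HS.2 (le_of_lt hy))
  have h4 : EqOn (fun y => F y * F y) 0 {y | 0 < y 0} :=
    Measure.eqOn_open_of_ae_eq (ae_restrict_of_ae h2) hO hc continuousOn_const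
  have h5 := h4 (x := c.ext x) hx
  have h6 : F (c.ext x) = f.1 x := by
    rw [hF, read_ext (hU x.2), Fn.zext_of_mem _ x.2]
  change F _ * F _ = 0 at h5
  rw [h6] at h5
  exact mul_self_eq_zero.1 h5

/-- A test function whose polynomial moments on the boundary vanish is zero on the boundary. -/
theorem eq_zero_of_boundary_moments (hU : U ≤ c.dom) (f : TestFn n U)
    (h : ∀ p, (c.dx hU).1 ((c.derivOp 0 hU * Fn.mulOp (c.polyFn hU p)).testMap f) = 0) (x : U)
    (hx : c.ext x 0 = 0) : f.1 x = 0 := by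
  obtain ⟨σ, hσf, -, hσ, -, hpos⟩ := exists_boundary_measure n
  have hT := halfTest_read (f := f) hU
  have h1 := integral_mul_self_eq_zero (μ := σ) hT fun p => by
    have := h p
    change (c.dx hU).1 ((c.derivOp 0 hU).testMap ((Fn.mulOp (c.polyFn hU p)).testMap f)) = 0 at this
    rw [dx_apply, read_zext_derivOp hU, hσ _ (halfTest_read hU), read_zext_mulOp_polyFn] at this
    exact neg_eq_zero.1 this
  have hTT : HalfTest fun y => c.read (Fn.zext f.1) y * c.read (Fn.zext f.1) y :=
    ⟨hT.contDiffOn.mul hT.contDiffOn, hT.compactSupport.mul_left, fun y hy => by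
      rw [hT.eq_zero y hy, mul_zero]⟩
  have h2 := hpos _ hTT (fun y => mul_self_nonneg _) h1 (c.ext x) hx
  rw [read_ext (hU x.2), Fn.zext_of_mem _ x.2] at h2
  exact mul_self_eq_zero.1 h2

end MChart

end Generation

/-! ### Local frames -/

section Frames

open Set Filter Topology Bundle

variable {n : ℕ} [NeZero n] {M : Type u} [TopologicalSpace M]
  [ChartedSpace (EuclideanHalfSpace n) M] {𝓔 : GradedBundle n M}

theorem Fn.sum_apply {ι : Type*} {U : Opens M} (s : Finset ι) (f : ι → Fn n U) (x : U) :
    (∑ i ∈ s, f i) x = ∑ i ∈ s, f i x :=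
  map_sum ((Pi.evalRingHom (fun _ : U => ℝ) x).comp ContMDiffMap.coeFnRingHom) f s

theorem Fields.mulFn_apply {U : Opens M} (f : Fn n U) (φ : Fields 𝓔 U) (i : 𝓔.ι) (x : U) :
    (Fields.mulFn f φ).1 i x = f x • φ.1 i x := rfl

theorem Fields.mulFn_mulFn {U : Opens M} (f g : Fn n U) (φ : Fields 𝓔 U) :
    Fields.mulFn f (Fields.mulFn g φ) = Fields.mulFn (f * g) φ := by
  ext i x
  exact smul_smul (f x) (g x) _

theorem Fields.mulFn_add {U : Opens M} (f g : Fn n U) (φ : Fields 𝓔 U) :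
    Fields.mulFn (f + g) φ = Fields.mulFn f φ + Fields.mulFn g φ := by
  ext i x
  exact add_smul (f x) (g x) _

theorem Fields.mulFn_smul {U : Opens M} (a : ℝ) (f : Fn n U) (φ : Fields 𝓔 U) :
    Fields.mulFn (a • f) φ = a • Fields.mulFn f φ := by
  ext i x
  exact smul_assoc a (f x) _

theorem Fields.mulFn_one {U : Opens M} (φ : Fields 𝓔 U) : Fields.mulFn 1 φ = φ := by
  ext i x
  exact one_smul ℝ _

theorem Fields.res_mulFn {U V : Opens M} (h : V ≤ U) (f : Fn n U) (φ : Fields 𝓔 U) :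
    Fields.res h (Fields.mulFn f φ) = Fields.mulFn (Fn.res h f) (Fields.res h φ) := rfl

theorem Fn.res_mul {U V : Opens M} (h : V ≤ U) (f g : Fn n U) :
    Fn.res h (f * g) = Fn.res h f * Fn.res h g := rfl

variable (𝓔) in
/-- A finite family of fields on `V` which spans all fields over the smooth functions, with a
choice of coefficients that is linear over the smooth functions and compatible with
restriction. -/
structure LocalFrame (V : Opens M) where
  /-- The index set. -/
  B : Type
  fintype : Fintype B
  /-- The spanning fields. -/
  vec : B → Fields 𝓔 V
  /-- The coefficients of a field on an open subset of `V`. -/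
  coef : ∀ W : Opens M, W ≤ V → B → Fields 𝓔 W →ₗ[ℝ] Fn n W
  coef_mulFn : ∀ (W : Opens M) (h : W ≤ V) (b : B) (f : Fn n W) (φ : Fields 𝓔 W),
    coef W h b (Fields.mulFn f φ) = f * coef W h b φ
  coef_res : ∀ (W W' : Opens M) (h : W ≤ V) (h' : W' ≤ W) (b : B) (φ : Fields 𝓔 W),
    coef W' (h'.trans h) b (Fields.res h' φ) = Fn.res h' (coef W h b φ)
  sum_eq : ∀ (W : Opens M) (h : W ≤ V) (φ : Fields 𝓔 W),
    ∑ b, Fields.mulFn (coef W h b φ) (Fields.res h (vec b)) = φ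

attribute [instance] LocalFrame.fintype

theorem vecZext_of_mem {U : Opens M} {i : 𝓔.ι} (s : ∀ x : U, 𝓔.E i x) {x : M} (hx : x ∈ U) :
    vecZext 𝓔 s x = s ⟨x, hx⟩ := by
  simp [vecZext, hx]

theorem vecZext_of_notMem {U : Opens M} {i : 𝓔.ι} (s : ∀ x : U, 𝓔.E i x) {x : M} (hx : x ∉ U) :
    vecZext 𝓔 s x = 0 := by
  simp [vecZext, hx]

theorem Fields.contMDiffAt {U : Opens M} (φ : Fields 𝓔 U) (i : 𝓔.ι) {x : M} (hx : x ∈ U) :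
    ContMDiffAt (𝓡∂ n) ((𝓡∂ n).prod 𝓘(ℝ, EuclideanSpace ℝ (Fin (𝓔.rank i)))) ∞
      (fun x : M => (⟨x, vecZext 𝓔 (φ.1 i) x⟩ :
        Bundle.TotalSpace (EuclideanSpace ℝ (Fin (𝓔.rank i))) (𝓔.E i))) x :=
  (φ.2 i).contMDiffAt (U.isOpen.mem_nhds hx)

instance (i : 𝓔.ι) : ContMDiffVectorBundle 1 (EuclideanSpace ℝ (Fin (𝓔.rank i))) (𝓔.E i)
    (𝓡∂ n) :=
  ContMDiffVectorBundle.of_le (n := ∞) (by simp)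

/-- Local trivializations of the finitely many summands give a local frame. -/
theorem exists_localFrame (𝓔 : GradedBundle n M) (x : M) :
    ∃ V : Opens M, x ∈ V ∧ Nonempty (LocalFrame 𝓔 V) := by
  classical
  have hfin := 𝓔.finite_ι
  have := Fintype.ofFinite 𝓔.ι
  let e := fun i => trivializationAt (EuclideanSpace ℝ (Fin (𝓔.rank i))) (𝓔.E i) x
  let β := fun i => (EuclideanSpace.basisFun (Fin (𝓔.rank i)) ℝ).toBasis
  let V : Opens M := ⟨⋂ i, (e i).baseSet, isOpen_iInter_of_finite fun i => (e i).open_baseSet⟩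
  have hV : ∀ {y : M} (_ : y ∈ V) (i : 𝓔.ι), y ∈ (e i).baseSet := fun hy i => mem_iInter.1 hy i
  refine ⟨V, mem_iInter.2 fun i => FiberBundle.mem_baseSet_trivializationAt' x, ⟨?_⟩⟩
  exact
    { B := Σ i : 𝓔.ι, Fin (𝓔.rank i)
      fintype := inferInstance
      vec := fun b => ⟨Pi.single b.1 fun y : V => (e b.1).localFrame (β b.1) b.2 y, by
        intro i
        obtain ⟨i', j⟩ := b
        by_cases hi : i = i'
        · subst hi
          refine (((e i).contMDiffOn_localFrame_baseSet (I := 𝓡∂ n) ∞ (β i) j).mono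
            fun y hy => hV hy i).congr fun y hy => ?_
          rw [vecZext_of_mem _ hy, Pi.single_eq_same]
        · refine (Bundle.contMDiffOn_zeroSection ℝ (𝓔.E i)).congr fun y hy => ?_
          rw [vecZext_of_mem _ hy]
          simp [Pi.single_eq_of_ne hi, Bundle.zeroSection]⟩
      coef := fun W h b =>
        { toFun := fun φ => Fn.mk' (fun y => (e b.1).localFrameCoeff (𝓡∂ n) (β b.1) b.2 y
              (vecZext 𝓔 (φ.1 b.1) y)) fun y hy =>
            contMDiffAt_localFrameCoeff (β b.1) (hV (h hy) b.1) (Fields.contMDiffAt φ b.1 hy) b.2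
          map_add' := by
            intro φ ψ
            ext y
            change (e b.1).localFrameCoeff (𝓡∂ n) (β b.1) b.2 y _ =
              (e b.1).localFrameCoeff (𝓡∂ n) (β b.1) b.2 y _ +
                (e b.1).localFrameCoeff (𝓡∂ n) (β b.1) b.2 y _
            rw [vecZext_of_mem _ y.2, vecZext_of_mem _ y.2, vecZext_of_mem _ y.2]
            exact map_add _ (φ.1 b.1 y) (ψ.1 b.1 y)
          map_smul' := by
            intro a φ
            ext y
            change (e b.1).localFrameCoeff (𝓡∂ n) (β b.1) b.2 y _ =
              a * (e b.1).localFrameCoeff (𝓡∂ n) (β b.1) b.2 y _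
            rw [vecZext_of_mem _ y.2, vecZext_of_mem _ y.2]
            exact map_smul _ a (φ.1 b.1 y) }
      coef_mulFn := by
        intro W h b f φ
        ext y
        change (e b.1).localFrameCoeff (𝓡∂ n) (β b.1) b.2 y _ =
          f y * (e b.1).localFrameCoeff (𝓡∂ n) (β b.1) b.2 y _
        rw [vecZext_of_mem _ y.2, vecZext_of_mem _ y.2]
        exact map_smul _ (f y) (φ.1 b.1 y)
      coef_res := by
        intro W W' h h' b φ
        ext y
        change (e b.1).localFrameCoeff (𝓡∂ n) (β b.1) b.2 y _ =
          (e b.1).localFrameCoeff (𝓡∂ n) (β b.1) b.2 y _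
        rw [vecZext_of_mem _ y.2, vecZext_of_mem _ (h' y.2)]
        rfl
      sum_eq := by
        intro W h φ
        ext i y
        rw [Submodule.coe_sum, Finset.sum_apply, Finset.sum_apply, Fintype.sum_sigma,
          Finset.sum_eq_single i]
        · rw [← vecZext_of_mem (φ.1 i) y.2, (e i).eq_sum_localFrameCoeff_smul (I := 𝓡∂ n) (b := β i)
            (s := vecZext 𝓔 (φ.1 i)) (hV (h y.2) i)]
          refine Finset.sum_congr rfl fun j _ => ?_
          rw [Fields.mulFn_apply]
          change _ • (Pi.single i _ : ∀ i (x : V), 𝓔.E i x) i ⟨y, h y.2⟩ = _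
          rw [Pi.single_eq_same]
          rfl
        · intro i' _ hi'
          refine Finset.sum_eq_zero fun j _ => ?_
          rw [Fields.mulFn_apply]
          change _ • (Pi.single i' _ : ∀ i (x : V), 𝓔.E i x) i ⟨y, h y.2⟩ = _
          rw [Pi.single_eq_of_ne hi'.symm]
          exact smul_zero _
        · simp }

namespace LocalFrame

variable {V : Opens M} (F : LocalFrame 𝓔 V) {c : MChart n M}

/-- Restriction of a local frame to a smaller open set. -/
def restrict {V' : Opens M} (h : V' ≤ V) : LocalFrame 𝓔 V' where
  B := F.B
  fintype := F.fintype
  vec b := Fields.res h (F.vec b)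
  coef W hW := F.coef W (hW.trans h)
  coef_mulFn W hW := F.coef_mulFn W (hW.trans h)
  coef_res W W' hW hW' := F.coef_res W W' (hW.trans h) hW'
  sum_eq W hW φ := F.sum_eq W (hW.trans h) φ

/-- The partial derivative of fields with respect to a local frame, that is, the derivative of their
coefficients. -/
def nabla (hV : V ≤ c.dom) (i : Fin n) {W : Opens M} (hW : W ≤ V) : Module.End ℝ (Fields 𝓔 W) where
  toFun φ := ∑ b, Fields.mulFn (c.derivFn i (hW.trans hV) (F.coef W hW b φ))
    (Fields.res hW (F.vec b))
  map_add' φ ψ := by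
    simp only [map_add, Fields.mulFn_add, Finset.sum_add_distrib]
  map_smul' a φ := by
    simp only [map_smul, Fields.mulFn_smul, Finset.smul_sum, RingHom.id_apply]

theorem nabla_mulFn (hV : V ≤ c.dom) (i : Fin n) {W : Opens M} (hW : W ≤ V) (f : Fn n W)
    (φ : Fields 𝓔 W) : F.nabla hV i hW (Fields.mulFn f φ) =
      Fields.mulFn f (F.nabla hV i hW φ) + Fields.mulFn (c.derivFn i (hW.trans hV) f) φ := by
  have h : Fields.mulFn (c.derivFn i (hW.trans hV) f) φ =
      Fields.mulFn (c.derivFn i (hW.trans hV) f)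
        (∑ b, Fields.mulFn (F.coef W hW b φ) (Fields.res hW (F.vec b))) := by rw [F.sum_eq]
  rw [h]
  simp only [nabla, LinearMap.coe_mk, AddHom.coe_mk, F.coef_mulFn, MChart.derivFn_mul,
    Fields.mulFn_add, map_sum, Fields.mulFn_mulFn, Finset.sum_add_distrib]
  exact add_comm (G := Fields 𝓔 W) _ _

theorem nabla_res (hV : V ≤ c.dom) (i : Fin n) {W W' : Opens M} (hW : W ≤ V) (h : W' ≤ W)
    (φ : Fields 𝓔 W) :
    F.nabla hV i (h.trans hW) (Fields.res h φ) = Fields.res h (F.nabla hV i hW φ) := by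
  simp only [nabla, LinearMap.coe_mk, AddHom.coe_mk, F.coef_res W W' hW h, map_sum,
    Fields.res_mulFn, MChart.derivFn_res h (hW.trans hV)]
  rfl

end LocalFrame

end Frames

/-! ### Operations on polydifferential operators -/

section PolyOperations

open Set Filter Topology

variable {n : ℕ} [NeZero n] {M : Type u} [TopologicalSpace M]
  [ChartedSpace (EuclideanHalfSpace n) M] {𝓔 : GradedBundle n M} {k : ℕ}

section MultiOp

variable {W : Opens M}

theorem slotComm_apply (a : Fin k) (f : Fn n W) (P : MultiOp 𝓔 k W) (φ : Fin k → Fields 𝓔 W) :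
    slotComm a f P φ = f * P φ - P (Function.update φ a (Fields.mulFn f (φ a))) := by
  have h : (fun b => (Function.update (fun _ => LinearMap.id) a (Fields.mulFn f) :
      Fin k → Module.End ℝ (Fields 𝓔 W)) b (φ b)) =
      Function.update φ a (Fields.mulFn f (φ a)) := by
    funext b
    by_cases hb : b = a
    · subst hb
      simp
    · simp [hb]
  change _ - P _ = _ - P _
  rw [← h]
  rfl

/-- Composition with an endomorphism in one argument. -/
def MultiOp.precomp (a : Fin k) (A : Module.End ℝ (Fields 𝓔 W)) :
    MultiOp 𝓔 k W →ₗ[ℝ] MultiOp 𝓔 k W where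
  toFun P := P.compLinearMap (Function.update (fun _ => LinearMap.id) a A)
  map_add' _ _ := rfl
  map_smul' _ _ := rfl

theorem MultiOp.precomp_apply (a : Fin k) (A : Module.End ℝ (Fields 𝓔 W)) (P : MultiOp 𝓔 k W)
    (φ : Fin k → Fields 𝓔 W) :
    MultiOp.precomp a A P φ = P (Function.update φ a (A (φ a))) := by
  change P _ = P _
  congr 1
  funext b
  by_cases hb : b = a
  · subst hb
    simp
  · simp [hb]

theorem slotComm_comm (a b : Fin k) (f g : Fn n W) (P : MultiOp 𝓔 k W) :
    slotComm a f (slotComm b g P) = slotComm b g (slotComm a f P) := by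
  refine MultilinearMap.ext fun φ => ?_
  simp only [slotComm_apply]
  by_cases hab : a = b
  · subst hab
    simp only [Function.update_self, Function.update_idem, Fields.mulFn_mulFn, mul_comm g f]
    ring
  · rw [Function.update_of_ne hab, Function.update_of_ne (Ne.symm hab),
      Function.update_comm hab]
    ring

theorem slotComm_mulLeft (a : Fin k) (f g : Fn n W) (P : MultiOp 𝓔 k W) :
    slotComm a f ((LinearMap.mulLeft ℝ g).compMultilinearMap P) =
      (LinearMap.mulLeft ℝ g).compMultilinearMap (slotComm a f P) := by
  refine MultilinearMap.ext fun φ => ?_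
  change slotComm a f _ φ = g * slotComm a f P φ
  simp only [slotComm_apply]
  change f * (g * P φ) - g * P _ = _
  ring

theorem slotComm_precomp_of_ne {a b : Fin k} (hab : a ≠ b) (f : Fn n W)
    (A : Module.End ℝ (Fields 𝓔 W)) (P : MultiOp 𝓔 k W) :
    slotComm a f (MultiOp.precomp b A P) = MultiOp.precomp b A (slotComm a f P) := by
  refine MultilinearMap.ext fun φ => ?_
  simp only [slotComm_apply, MultiOp.precomp_apply]
  rw [Function.update_of_ne hab, Function.update_of_ne (Ne.symm hab), Function.update_comm hab]

/-- The commutator with a function `f` of the composition with an operator `A` on fields which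
satisfies a Leibniz rule, where `g` is the derivative of `f`. -/
theorem slotComm_precomp (a : Fin k) (f g : Fn n W) (A : Module.End ℝ (Fields 𝓔 W))
    (hA : ∀ φ, A (Fields.mulFn f φ) = Fields.mulFn f (A φ) + Fields.mulFn g φ)
    (P : MultiOp 𝓔 k W) :
    slotComm a f (MultiOp.precomp a A P) = MultiOp.precomp a A (slotComm a f P) +
      (slotComm a g P - (LinearMap.mulLeft ℝ g).compMultilinearMap P) := by
  refine MultilinearMap.ext fun φ => ?_
  change _ = MultiOp.precomp a A (slotComm a f P) φ + (slotComm a g P φ - g * P φ)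
  simp only [slotComm_apply, MultiOp.precomp_apply, Function.update_self, Function.update_idem,
    hA, MultilinearMap.map_update_add]
  ring

namespace HasOrderLTAt

variable {a b : Fin k} {r : ℕ} {P : MultiOp 𝓔 k W}

theorem slotComm' (h : HasOrderLTAt a r P) (f : Fn n W) :
    HasOrderLTAt a r (slotComm b f P) := by
  induction r generalizing P with
  | zero =>
    have h' : P = 0 := h
    subst h'
    refine MultilinearMap.ext fun φ => ?_
    rw [slotComm_apply]
    simp
  | succ r ih =>
    intro g
    rw [slotComm_comm]
    exact ih (h g)

theorem mulLeft (h : HasOrderLTAt a r P) (g : Fn n W) :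
    HasOrderLTAt a r ((LinearMap.mulLeft ℝ g).compMultilinearMap P) := by
  induction r generalizing P with
  | zero =>
    have h' : P = 0 := h
    subst h'
    exact MultilinearMap.ext fun φ => mul_zero g
  | succ r ih =>
    intro f
    rw [slotComm_mulLeft]
    exact ih (h f)

theorem sub {Q : MultiOp 𝓔 k W} (h : HasOrderLTAt a r P) (h' : HasOrderLTAt a r Q) :
    HasOrderLTAt a r (P - Q) := by
  rw [sub_eq_add_neg, ← neg_one_smul ℝ Q]
  exact h.add (h'.smul _)

theorem precomp (h : HasOrderLTAt a r P) (A : Module.End ℝ (Fields 𝓔 W))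
    (hA : ∀ f, ∃ g, ∀ φ, A (Fields.mulFn f φ) = Fields.mulFn f (A φ) + Fields.mulFn g φ) :
    HasOrderLTAt a (r + 1) (MultiOp.precomp b A P) := by
  induction r generalizing P with
  | zero =>
    have h' : P = 0 := h
    subst h'
    rw [map_zero]
    exact HasOrderLTAt.zero _
  | succ r ih =>
    intro f
    by_cases hab : a = b
    · subst hab
      obtain ⟨g, hg⟩ := hA f
      rw [slotComm_precomp a f g A hg]
      exact (ih (h f)).add ((h.slotComm' g).sub (h.mulLeft g))
    · rw [slotComm_precomp_of_ne hab]
      exact ih (h f)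

end HasOrderLTAt

end MultiOp

theorem Fields.res_update {U V : Opens M} (h : V ≤ U) (φ : Fin k → Fields 𝓔 U) (a : Fin k)
    (ψ : Fields 𝓔 U) : Function.update (fun b => Fields.res h (φ b)) a (Fields.res h ψ) =
      fun b => Fields.res h (Function.update φ a ψ b) := by
  funext b
  by_cases hb : b = a
  · subst hb
    simp
  · simp [hb]

instance (k : ℕ) (U : Opens M) : AddCommGroup (PolyDiffOp 𝓔 k U) :=
  Submodule.addCommGroup (M := ∀ W : Set.Iic U, MultiOp 𝓔 k W.1) _

namespace PolyDiffOp

variable {V : Opens M}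

theorem ext {P Q : PolyDiffOp 𝓔 k V} (h : ∀ (W : Set.Iic V) (φ : Fin k → Fields 𝓔 W.1),
    P.1 W φ = Q.1 W φ) : P = Q :=
  Subtype.ext (funext fun W => MultilinearMap.ext (h W))

/-- The commutator with multiplication by a smooth function in one argument. -/
def comm (a : Fin k) (f : Fn n V) : Module.End ℝ (PolyDiffOp 𝓔 k V) where
  toFun P := ⟨fun W => slotComm a (Fn.res W.2 f) (P.1 W), by
      intro W' W h φ
      have key := P.2.1 W' W h (Function.update φ a (Fields.mulFn (Fn.res W.2 f) (φ a)))
      rw [← Fields.res_update] at key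
      rw [slotComm_apply, slotComm_apply, map_sub, Fn.res_mul, ← key, P.2.1 W' W h]
      rfl, by
      intro x hx
      obtain ⟨V', hV', r, hr⟩ := P.2.2 x hx
      exact ⟨V', hV', r, fun W hW b => (hr W hW b).slotComm' _⟩⟩
  map_add' P Q := Subtype.ext (funext fun W => slotComm_add _ _ _)
  map_smul' t P := Subtype.ext (funext fun W => slotComm_smul _ _ _)

theorem comm_val (a : Fin k) (f : Fn n V) (P : PolyDiffOp 𝓔 k V) (W : Set.Iic V) :
    (comm a f P).1 W = slotComm a (Fn.res W.2 f) (P.1 W) := rfl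

/-- The left action of a differential operator as an endomorphism. -/
def lmulEnd (D : DiffOp n V) : Module.End ℝ (PolyDiffOp 𝓔 k V) where
  toFun P := lmul D P
  map_add' _ _ := ext fun W _ => map_add (D.1 W) _ _
  map_smul' _ _ := ext fun W _ => map_smul (D.1 W) _ _

theorem lmulEnd_apply (D : DiffOp n V) (P : PolyDiffOp 𝓔 k V) : lmulEnd D P = lmul D P := rfl

theorem lmul_val (D : DiffOp n V) (P : PolyDiffOp 𝓔 k V) (W : Set.Iic V)
    (φ : Fin k → Fields 𝓔 W.1) : (lmul D P).1 W φ = D.1 W (P.1 W φ) := rfl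

section Nabla

variable {c : MChart n M} (F : LocalFrame 𝓔 V) (hV : V ≤ c.dom)

/-- Composition with a partial derivative in one argument. -/
def precompNabla (a : Fin k) (i : Fin n) : Module.End ℝ (PolyDiffOp 𝓔 k V) where
  toFun P := ⟨fun W => MultiOp.precomp a (F.nabla hV i W.2) (P.1 W), by
      intro W' W h φ
      rw [MultiOp.precomp_apply, MultiOp.precomp_apply, ← P.2.1 W' W h, ← Fields.res_update]
      congr 2
      exact F.nabla_res hV i W.2 h (φ a), by
      intro x hx
      obtain ⟨V', hV', r, hr⟩ := P.2.2 x hx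
      exact ⟨V', hV', r + 1, fun W hW b => (hr W hW b).precomp _ fun f =>
        ⟨_, F.nabla_mulFn hV i W.2 f⟩⟩⟩
  map_add' P Q := Subtype.ext (funext fun W => map_add (MultiOp.precomp a _) (P.1 W) (Q.1 W))
  map_smul' t P := Subtype.ext (funext fun W => map_smul (MultiOp.precomp a _) t (P.1 W))

theorem precompNabla_val (a : Fin k) (i : Fin n) (P : PolyDiffOp 𝓔 k V) (W : Set.Iic V) :
    (precompNabla F hV a i P).1 W = MultiOp.precomp a (F.nabla hV i W.2) (P.1 W) := rfl

theorem comm_mul_comm (a : Fin k) (f g : Fn n V) :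
    comm (𝓔 := 𝓔) a f * comm a g = comm a g * comm a f :=
  LinearMap.ext fun P => Subtype.ext (funext fun W => slotComm_comm a a _ _ (P.1 W))

theorem slotComm_ite {W : Opens M} (a : Fin k) (p : Prop) [Decidable p] (P : MultiOp 𝓔 k W) :
    slotComm a (if p then 1 else 0) P - (LinearMap.mulLeft ℝ (if p then 1 else 0)).compMultilinearMap
      P = - if p then P else 0 := by
  refine MultilinearMap.ext fun φ => ?_
  change slotComm a (if p then 1 else 0) P φ - (if p then 1 else 0) * P φ = -((if p then P else 0) φ)
  rw [slotComm_apply]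
  split_ifs
  · rw [Fields.mulFn_one, Function.update_eq_self]
    ring
  · have : Fields.mulFn (0 : Fn n W) (φ a) = 0 := by
      ext i x
      exact zero_smul ℝ _
    rw [this, MultilinearMap.map_update_zero]
    simp

theorem precompNabla_mul_comm_sub (a : Fin k) (i j : Fin n) :
    precompNabla F hV a i * comm a (c.coord j hV) - comm a (c.coord j hV) * precompNabla F hV a i =
      if i = j then 1 else 0 := by
  refine LinearMap.ext fun P => Subtype.ext (funext fun W => ?_)
  have h := slotComm_precomp a (Fn.res W.2 (c.coord j hV)) _ _
    (F.nabla_mulFn hV i W.2 (Fn.res W.2 (c.coord j hV))) (P.1 W)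
  have h1 : c.derivFn i (le_trans W.2 hV) (Fn.res W.2 (c.coord j hV)) = if i = j then 1 else 0 :=
    MChart.derivFn_coord j (le_trans W.2 hV)
  rw [h1, slotComm_ite] at h
  change MultiOp.precomp a _ (slotComm a _ (P.1 W)) -
    slotComm a _ (MultiOp.precomp a (F.nabla hV i W.2) (P.1 W)) = _
  rw [h, sub_add_cancel_left, neg_neg]
  split_ifs <;> rfl

theorem lmulEnd_derivOp_mul_comm_sub (a : Fin k) (i j : Fin n) :
    lmulEnd (𝓔 := 𝓔) (c.derivOp i hV) * comm a (c.coord j hV) -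
      comm (𝓔 := 𝓔) a (c.coord j hV) * lmulEnd (c.derivOp i hV) = if i = j then 1 else 0 := by
  refine LinearMap.ext fun P => ext fun W φ => ?_
  have h1 : c.derivFn i (le_trans W.2 hV) (Fn.res W.2 (c.coord j hV)) = if i = j then 1 else 0 :=
    MChart.derivFn_coord j (le_trans W.2 hV)
  change c.derivFn i (le_trans W.2 hV) (slotComm a (Fn.res W.2 (c.coord j hV)) (P.1 W) φ) -
    slotComm a (Fn.res W.2 (c.coord j hV)) ((c.derivFn i (le_trans W.2 hV)).compMultilinearMap
      (P.1 W)) φ = _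
  rw [slotComm_apply, slotComm_apply, map_sub, MChart.derivFn_mul, h1]
  refine (sub_sub_sub_cancel_right _ _ _).trans ((add_sub_cancel_right _ _).trans ?_)
  split_ifs
  · exact one_mul _
  · exact zero_mul _

end Nabla

variable (𝓔 k V) in
/-- The polydifferential operators whose order in each argument is bounded on all of `V`. -/
def uniformOrder : Submodule ℝ (PolyDiffOp 𝓔 k V) where
  carrier := {P | ∃ r, ∀ (W : Set.Iic V) (a : Fin k), HasOrderLTAt a r (P.1 W)}
  zero_mem' := ⟨0, fun _ _ => rfl⟩
  add_mem' := by
    rintro P Q ⟨r, hr⟩ ⟨s, hs⟩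
    exact ⟨max r s, fun W a => ((hr W a).mono (le_max_left _ _)).add
      ((hs W a).mono (le_max_right _ _))⟩
  smul_mem' := by
    rintro t P ⟨r, hr⟩
    exact ⟨r, fun W a => (hr W a).smul t⟩

theorem res_mem_uniformOrder {U : Opens M} (h : V ≤ U) {P : PolyDiffOp 𝓔 k U}
    (hP : P ∈ uniformOrder 𝓔 k U) : PolyDiffOp.res h P ∈ uniformOrder 𝓔 k V := by
  obtain ⟨r, hr⟩ := hP
  exact ⟨r, fun W a => hr ⟨W.1, le_trans (show W.1 ≤ V from W.2) h⟩ a⟩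

theorem comm_mem_uniformOrder (a : Fin k) (f : Fn n V) {P : PolyDiffOp 𝓔 k V}
    (hP : P ∈ uniformOrder 𝓔 k V) : comm a f P ∈ uniformOrder 𝓔 k V := by
  obtain ⟨r, hr⟩ := hP
  exact ⟨r, fun W a => (hr W a).slotComm' _⟩

theorem precompNabla_mem_uniformOrder {c : MChart n M} (F : LocalFrame 𝓔 V) (hV : V ≤ c.dom)
    (a : Fin k) (i : Fin n) {P : PolyDiffOp 𝓔 k V} (hP : P ∈ uniformOrder 𝓔 k V) :
    precompNabla F hV a i P ∈ uniformOrder 𝓔 k V := by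
  obtain ⟨r, hr⟩ := hP
  exact ⟨r + 1, fun W a => (hr W a).precomp _ fun f => ⟨_, F.nabla_mulFn hV i W.2 f⟩⟩

theorem mem_killed {P : PolyDiffOp 𝓔 k V} {a : Fin k} {r : ℕ}
    (hP : ∀ W : Set.Iic V, HasOrderLTAt a r (P.1 W)) {J : Type*} (f : J → Fn n V) :
    P ∈ killed (fun j => comm a (f j)) r := by
  induction r generalizing P with
  | zero => exact mem_killed_zero.2 (Subtype.ext (funext hP))
  | succ r ih => exact mem_killed_succ.2 fun j => ih fun W => hP W _

/-- The order in one argument can be bounded locally. -/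
theorem hasOrderLTAt_of_local (P : PolyDiffOp 𝓔 k V) {a : Fin k} {r : ℕ}
    (h : ∀ x ∈ V, ∃ V' : Opens M, x ∈ V' ∧
      ∀ W : Set.Iic V, W.1 ≤ V' → HasOrderLTAt a r (P.1 W)) : HasOrderLTAt a r P.app := by
  induction r generalizing P with
  | zero =>
    refine MultilinearMap.ext fun φ => ?_
    ext x
    obtain ⟨V', hxV', hV'⟩ := h x x.2
    have hVV : V ⊓ V' ≤ V := inf_le_left
    have h1 : P.1 ⟨V ⊓ V', hVV⟩ = 0 := hV' ⟨V ⊓ V', hVV⟩ inf_le_right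
    have h2 := P.2.1 ⟨V ⊓ V', hVV⟩ ⟨V, le_refl V⟩ hVV φ
    rw [h1] at h2
    exact (congrArg (fun g : Fn n (V ⊓ V' : Opens M) => g ⟨x, x.2, hxV'⟩) h2).symm
  | succ r ih =>
    intro f
    refine ih (comm a f P) fun x hx => ?_
    obtain ⟨V', hxV', hV'⟩ := h x hx
    exact ⟨V', hxV', fun W hW => hV' W hW _⟩

/-- Over a relatively compact open subset, the order is bounded. -/
theorem res_mem_uniformOrder_of_isCompact {U : Opens M} (P : PolyDiffOp 𝓔 k U) {K : Set M}
    (hK : IsCompact K) (hKU : K ⊆ U) (hVK : (V : Set M) ⊆ K) (hVU : V ≤ U) :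
    PolyDiffOp.res hVU P ∈ uniformOrder 𝓔 k V := by
  choose! N hN r hr using P.2.2
  obtain ⟨t, htK, ht⟩ := hK.elim_nhds_subcover (fun x => (N x : Set M))
    fun x hx => (N x).isOpen.mem_nhds (hN x (hKU hx))
  refine ⟨t.sup r, fun W a => ?_⟩
  refine hasOrderLTAt_of_local (PolyDiffOp.res (le_trans (show W.1 ≤ V from W.2) hVU) P)
    fun x hx => ?_
  obtain ⟨y, hyt, hy⟩ := mem_iUnion₂.1 (ht (hVK (W.2 hx)))
  exact ⟨N y, hy, fun W' hW' => (hr y (hKU (htK y hyt)) ⟨W'.1, le_trans (show W'.1 ≤ W.1 from W'.2)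
    (le_trans (show W.1 ≤ V from W.2) hVU)⟩ hW' a).mono (Finset.le_sup (f := r) hyt)⟩

theorem exists_res_mem_uniformOrder {U : Opens M} (P : PolyDiffOp 𝓔 k U) {x : M} (hx : x ∈ U) :
    ∃ (V : Opens M) (h : V ≤ U), x ∈ V ∧ PolyDiffOp.res h P ∈ uniformOrder 𝓔 k V := by
  obtain ⟨V, hxV, r, hr⟩ := P.2.2 x hx
  have hUV : U ⊓ V ≤ U := inf_le_left
  exact ⟨U ⊓ V, hUV, ⟨hx, hxV⟩, r, fun W a => hr ⟨W.1, le_trans (show W.1 ≤ U ⊓ V from W.2) hUV⟩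
    (le_trans (show W.1 ≤ U ⊓ V from W.2) inf_le_right) a⟩

end PolyDiffOp

end PolyOperations

/-! ### Local structure of polydifferential operators -/

section Structure

open Set Filter Topology

variable {n : ℕ} [NeZero n] {M : Type u} [TopologicalSpace M]
  [ChartedSpace (EuclideanHalfSpace n) M] {𝓔 : GradedBundle n M} {k : ℕ}

/-- By Hadamard's lemma, a linear map which commutes with multiplication by the coordinates is
given at every point by multiplication with its value at `1`. -/
theorem MChart.apply_pull_of_coord {c : MChart n M} {W : Opens M} (hW : W ≤ c.dom)
    (l : Module.End ℝ (Fn n W)) (hl : ∀ i g, l (c.coord i hW * g) = c.coord i hW * l g)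
    (F : EuclideanSpace ℝ (Fin n) → ℝ) (hF : ContDiffOn ℝ ∞ F (HS n)) (x : W) :
    l (c.pull hW F hF) x = F (c.ext x) * l 1 x := by
  obtain ⟨g, hg, hFg⟩ := exists_hadamard hF (ext_mem_HS (hW x.2))
  have h1 : c.pull hW F hF = F (c.ext x) • (1 : Fn n W) +
      ∑ i, (c.coord i hW * c.pull hW (g i) (hg i) - c.ext x i • c.pull hW (g i) (hg i)) := by
    ext y
    refine (hFg (c.ext y) (ext_mem_HS (hW y.2))).trans ?_
    change _ = F (c.ext x) * 1 + (∑ i, (c.coord i hW * c.pull hW (g i) (hg i) -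
      c.ext x i • c.pull hW (g i) (hg i))) y
    rw [mul_one, Fn.sum_apply]
    congr 1
    refine Finset.sum_congr rfl fun i _ => ?_
    exact sub_mul _ _ _
  rw [h1, map_add, map_smul, map_sum]
  simp only [map_sub, hl, map_smul]
  change F (c.ext x) * l 1 x + (∑ i, (c.coord i hW * l (c.pull hW (g i) (hg i)) -
      c.ext x i • l (c.pull hW (g i) (hg i)))) x = _
  rw [Fn.sum_apply, Finset.sum_eq_zero, add_zero]
  intro i _
  exact sub_self _

theorem iic_le {V : Opens M} (W : Set.Iic V) : W.1 ≤ V := W.2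

namespace PolyDiffOp

variable {V : Opens M} {c : MChart n M}

section

variable [T2Space M] [SecondCountableTopology M] [IsManifold (𝓡∂ n) ∞ M]

/-- A polydifferential operator which commutes with the coordinates in one argument is linear
over the smooth functions in that argument. -/
theorem map_mulFn (hV : V ≤ c.dom) (a : Fin k) {P : PolyDiffOp 𝓔 k V}
    (hP : ∀ j, comm a (c.coord j hV) P = 0) (W : Set.Iic V) (φ : Fin k → Fields 𝓔 W.1)
    (f : Fn n W.1) :
    P.1 W (Function.update φ a (Fields.mulFn f (φ a))) = f * P.1 W φ := by
  ext x
  have hWc : W.1 ≤ c.dom := le_trans W.2 hV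
  obtain ⟨F, hF, W', hW', hxW', hf⟩ := MChart.exists_eq_pull hWc f x.2
  have hWV : W' ≤ V := hW'.trans W.2
  let ψ := fun b => Fields.res hW' (φ b)
  let l : Module.End ℝ (Fn n W') :=
    { toFun := fun g => P.1 ⟨W', hWV⟩ (Function.update ψ a (Fields.mulFn g (ψ a)))
      map_add' := fun g g' => by rw [Fields.mulFn_add, MultilinearMap.map_update_add]
      map_smul' := fun t g => by
        rw [Fields.mulFn_smul, MultilinearMap.map_update_smul]
        rfl }
  have hl : ∀ i g, l (c.coord i (hWV.trans hV) * g) = c.coord i (hWV.trans hV) * l g := by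
    intro i g
    have h := congrArg (fun Q : PolyDiffOp 𝓔 k V => Q.1 ⟨W', hWV⟩
      (Function.update ψ a (Fields.mulFn g (ψ a)))) (hP i)
    have h1 := slotComm_apply a (Fn.res hWV (c.coord i hV)) (P.1 ⟨W', hWV⟩)
      (Function.update ψ a (Fields.mulFn g (ψ a)))
    rw [Function.update_self, Function.update_idem, Fields.mulFn_mulFn] at h1
    exact (sub_eq_zero.1 (h1.symm.trans h)).symm
  have h2 := MChart.apply_pull_of_coord (hWV.trans hV) l hl F hF ⟨x, hxW'⟩
  rw [← hf] at h2
  have h3 : l (Fn.res hW' f) =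
      Fn.res hW' (P.1 W (Function.update φ a (Fields.mulFn f (φ a)))) := by
    rw [← P.2.1 ⟨W', hWV⟩ W hW', ← Fields.res_update]
    rfl
  have h4 : l 1 = Fn.res hW' (P.1 W φ) := by
    rw [← P.2.1 ⟨W', hWV⟩ W hW']
    change P.1 ⟨W', hWV⟩ (Function.update ψ a (Fields.mulFn 1 (ψ a))) = _
    rw [Fields.mulFn_one, Function.update_eq_self]
  rw [h3, h4] at h2
  refine h2.trans ?_
  have h5 : F (c.ext x) = f x := (congrArg (fun g : Fn n W' => g ⟨x, hxW'⟩) hf).symm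
  exact congrArg (· * P.1 W φ x) h5

end

theorem _root_.BoundaryDMod.HasOrderLTAt.curryLeft {W : Opens M} {r : ℕ} {a : Fin k}
    {P : MultiOp 𝓔 (k + 1) W} (h : HasOrderLTAt a.succ r P) (ψ : Fields 𝓔 W) :
    HasOrderLTAt a r (P.curryLeft ψ) := by
  induction r generalizing P with
  | zero =>
    have h' : P = 0 := h
    subst h'
    rfl
  | succ r ih =>
    intro f
    have h1 : slotComm a f (P.curryLeft ψ) = (slotComm a.succ f P).curryLeft ψ := by
      refine MultilinearMap.ext fun φ => ?_
      rw [MultilinearMap.curryLeft_apply, slotComm_apply, slotComm_apply,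
        MultilinearMap.curryLeft_apply, MultilinearMap.curryLeft_apply, Fin.cons_update,
        Fin.cons_succ]
    rw [h1]
    exact ih (h f)

/-- Insertion of a field in the first argument. -/
def insert (ψ : Fields 𝓔 V) : PolyDiffOp 𝓔 (k + 1) V →ₗ[ℝ] PolyDiffOp 𝓔 k V where
  toFun P := ⟨fun W => (P.1 W).curryLeft (Fields.res (iic_le W) ψ), by
      intro W' W h φ
      rw [MultilinearMap.curryLeft_apply, MultilinearMap.curryLeft_apply, ← P.2.1 W' W h]
      congr 1
      funext b
      refine Fin.cases ?_ (fun b => ?_) b <;> rfl, by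
      intro x hx
      obtain ⟨V', hV', r, hr⟩ := P.2.2 x hx
      exact ⟨V', hV', r, fun W hW b => (hr W hW b.succ).curryLeft _⟩⟩
  map_add' _ _ := rfl
  map_smul' _ _ := rfl

theorem insert_val (ψ : Fields 𝓔 V) (P : PolyDiffOp 𝓔 (k + 1) V) (W : Set.Iic V)
    (φ : Fin k → Fields 𝓔 W.1) :
    (insert ψ P).1 W φ = P.1 W (Fin.cons (Fields.res (iic_le W) ψ) φ) := rfl

theorem insert_mem_uniformOrder (ψ : Fields 𝓔 V) {P : PolyDiffOp 𝓔 (k + 1) V}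
    (hP : P ∈ uniformOrder 𝓔 (k + 1) V) : insert ψ P ∈ uniformOrder 𝓔 k V := by
  obtain ⟨r, hr⟩ := hP
  exact ⟨r, fun W a => (hr W a.succ).curryLeft _⟩

/-- The coefficients in a local frame, as differential operators of order zero. -/
def coefOp (F : LocalFrame 𝓔 V) (b : F.B) : PolyDiffOp 𝓔 1 V :=
  ⟨fun W => MultilinearMap.ofSubsingleton ℝ _ _ 0 (F.coef W.1 (iic_le W) b), fun W' W h φ =>
      F.coef_res W.1 W'.1 W.2 h b (φ 0), fun x _ => ⟨⊤, trivial, 1, fun W _ a f => by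
        refine MultilinearMap.ext fun φ => ?_
        rw [Subsingleton.elim a 0, slotComm_apply]
        change f * F.coef W.1 (iic_le W) b (φ 0) -
          F.coef W.1 (iic_le W) b (Function.update φ 0 (Fields.mulFn f (φ 0)) 0) = 0
        rw [Function.update_self, F.coef_mulFn, sub_self]⟩⟩

variable (𝓔 k V) in
/-- Finite sums of products `φ ↦ (D_0 φ_0) ⋯ (D_k φ_k)` of differential operators in one
argument. -/
def sumsOfProducts : Submodule ℝ (PolyDiffOp 𝓔 (k + 1) V) where
  carrier := {P | ∃ (S : Type) (_ : Fintype S) (D : S → Fin (k + 1) → PolyDiffOp 𝓔 1 V),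
    ∀ (W : Set.Iic V) (φ : Fin (k + 1) → Fields 𝓔 W.1),
      P.1 W φ = ∑ s, ∏ a, (D s a).1 W fun _ => φ a}
  zero_mem' := ⟨Empty, inferInstance, fun s => s.elim, fun W φ => by
    rw [Finset.univ_eq_empty, Finset.sum_empty]
    rfl⟩
  add_mem' := by
    rintro P Q ⟨S, _, D, hD⟩ ⟨S', _, D', hD'⟩
    refine ⟨S ⊕ S', inferInstance, Sum.elim D D', fun W φ => ?_⟩
    rw [Fintype.sum_sum_type]
    exact congrArg₂ (· + ·) (hD W φ) (hD' W φ)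
  smul_mem' := by
    rintro t P ⟨S, _, D, hD⟩
    refine ⟨S, inferInstance, fun s => Function.update (D s) 0 (t • D s 0), fun W φ => ?_⟩
    refine (congrArg (t • ·) (hD W φ)).trans ?_
    simp only [Finset.smul_sum]
    refine Finset.sum_congr rfl fun s _ => ?_
    rw [Fin.prod_univ_succ, Fin.prod_univ_succ, Function.update_self, ← smul_mul_assoc]
    congr 1

/-- A polydifferential operator of bounded order over the domain of a chart and of a local frame
is a finite sum of products of differential operators in one argument. -/
theorem mem_sumsOfProducts [T2Space M] [SecondCountableTopology M] [IsManifold (𝓡∂ n) ∞ M]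
    (F : LocalFrame 𝓔 V) (hV : V ≤ c.dom) {P : PolyDiffOp 𝓔 (k + 1) V}
    (hP : P ∈ uniformOrder 𝓔 (k + 1) V) : P ∈ sumsOfProducts 𝓔 k V := by
  induction k with
  | zero =>
    refine ⟨Unit, inferInstance, fun _ _ => P, fun W φ => ?_⟩
    rw [Fintype.sum_unique, Fin.prod_univ_one]
    congr 1
    funext b
    rw [Fin.fin_one_eq_zero b]
  | succ k ih =>
    obtain ⟨r, hr⟩ := id hP
    -- It suffices to treat operators which are linear over the functions in the first argument, as
    -- all others arise from these by derivatives of the first argument.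
    refine killed_inf_le (c := fun j => comm 0 (c.coord j hV)) (n := precompNabla F hV 0)
      (G := uniformOrder 𝓔 (k + 1 + 1) V) (S := sumsOfProducts 𝓔 (k + 1) V)
      (fun i j => comm_mul_comm 0 _ _) (precompNabla_mul_comm_sub F hV 0)
      (fun j P hP => comm_mem_uniformOrder 0 _ hP)
      (fun j P hP => precompNabla_mem_uniformOrder F hV 0 j hP) ?_ ?_ r
      ⟨mem_killed (fun W => hr W 0) _, hP⟩
    · -- expand the first argument in the frame, and apply induction to the operators obtained by
      -- inserting the members of the frame
      rintro Q ⟨hQ, hQu⟩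
      choose S hS D hD using fun b => ih (insert_mem_uniformOrder (F.vec b) hQu)
      refine ⟨Σ b, S b, inferInstance, fun s => Fin.cons (coefOp F s.1) (D s.1 s.2),
        fun W φ => ?_⟩
      have h1 : Q.1 W φ = ∑ b, F.coef W.1 (iic_le W) b (φ 0) * (insert (F.vec b) Q).1 W (Fin.tail φ) := by
        have h2 : φ = Function.update φ 0 (∑ b, Fields.mulFn (F.coef W.1 (iic_le W) b (φ 0))
            (Fields.res (iic_le W) (F.vec b))) := by
          rw [F.sum_eq, Function.update_eq_self]
        conv_lhs => rw [h2, MultilinearMap.map_update_sum]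
        refine Finset.sum_congr rfl fun b _ => ?_
        have h3 := map_mulFn hV 0 (mem_killed_one.1 hQ) W
          (Fin.cons (Fields.res (iic_le W) (F.vec b)) (Fin.tail φ)) (F.coef W.1 (iic_le W) b (φ 0))
        rw [Fin.cons_zero, Fin.update_cons_zero] at h3
        rw [insert_val, ← h3]
        congr 1
        conv_lhs => rw [← Fin.cons_self_tail φ, Fin.update_cons_zero]
        rw [Fin.cons_zero]
      rw [h1, Fintype.sum_sigma]
      refine Finset.sum_congr rfl fun b _ => ?_
      rw [hD b, Finset.mul_sum]
      refine Finset.sum_congr rfl fun s _ => ?_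
      rw [Fin.prod_univ_succ (n := k + 1)]
      rfl
    · rintro j Q ⟨S, hS, D, hD⟩
      refine ⟨S, hS, fun s => Function.update (D s) 0 (precompNabla F hV 0 j (D s 0)),
        fun W φ => ?_⟩
      rw [precompNabla_val, MultiOp.precomp_apply, hD]
      refine Finset.sum_congr rfl fun s _ => ?_
      refine Finset.prod_congr rfl fun a _ => ?_
      by_cases ha : a = 0
      · subst ha
        simp only [Function.update_self]
        rw [precompNabla_val, MultiOp.precomp_apply]
        congr 1
        funext b
        rw [Fin.fin_one_eq_zero b, Function.update_self]
      · simp only [Function.update_of_ne ha]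

end PolyDiffOp

end Structure

/-! ### Division by the boundary coordinate -/

section Division

open Set Filter Topology

variable {n : ℕ} [NeZero n] {M : Type u} [TopologicalSpace M]
  [ChartedSpace (EuclideanHalfSpace n) M] {𝓔 : GradedBundle n M} {k : ℕ}
  {c : MChart n M} {V : Opens M}

namespace MChart

/-- At a boundary point, the normal derivative of `x_0 g` is `g`. -/
theorem deriv_coord_mul (hV : V ≤ c.dom) (g : Fn n V) (x : V) (hx : c.ext x 0 = 0) :
    c.derivFn 0 hV (c.coord 0 hV * g) x = g x := by
  rw [derivFn_mul, derivFn_coord, if_pos rfl]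
  change 1 * g x + c.ext x 0 * _ = _
  rw [hx]
  ring

theorem eq_zero_of_coord_mul (hV : V ≤ c.dom) {g : Fn n V} (h : c.coord 0 hV * g = 0) : g = 0 := by
  ext x
  by_cases hx : c.ext x 0 = 0
  · rw [← deriv_coord_mul hV g x hx, h, map_zero]
  · exact (mul_eq_zero.1 (congrArg (fun f : Fn n V => f x) h)).resolve_left hx

theorem coord_mul_cancel (hV : V ≤ c.dom) {g g' : Fn n V}
    (h : c.coord 0 hV * g = c.coord 0 hV * g') : g = g' := by
  rw [← sub_eq_zero]
  exact eq_zero_of_coord_mul hV (by rw [mul_sub, h, sub_self])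

variable [T2Space M] [SecondCountableTopology M] [IsManifold (𝓡∂ n) ∞ M]

/-- A smooth function which vanishes on the boundary is divisible by the boundary coordinate. -/
theorem exists_coord_mul_eq (hV : V ≤ c.dom) (f : Fn n V)
    (h0 : ∀ x : V, c.ext x 0 = 0 → f x = 0) : ∃ g : Fn n V, c.coord 0 hV * g = f := by
  have hloc : ∀ x ∈ V, ∃ (W : Opens M) (hW : W ≤ V) (g : Fn n W), x ∈ W ∧
      c.coord 0 (hW.trans hV) * g = Fn.res hW f := by
    intro x hx
    obtain ⟨F, hF, W, hW, hxW, hfF, hF0⟩ := exists_eq_pull_of_support hV f hx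
    refine ⟨W, hW, c.pull (hW.trans hV) _ (segAvg_contDiffOn (pd_contDiffOn (i := 0) hF)), hxW, ?_⟩
    rw [hfF]
    ext y
    exact (eq_coord_mul_segAvg_pd hF (fun z hz => hF0 z fun w hw => h0 w (by rw [hw, hz]))
      (ext_mem_HS (hV (hW y.2)))).symm
  refine ⟨Fn.mk' (fun y => if c.ext y 0 = 0 then c.deriv 0 (Fn.zext f) y
    else Fn.zext f y / c.ext y 0) fun x hx => ?_, ?_⟩
  · obtain ⟨W, hW, g, hxW, hg⟩ := hloc x hx
    refine (Fn.zext_contMDiffAt g hxW).congr_of_eventuallyEq ?_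
    filter_upwards [W.isOpen.mem_nhds hxW] with y hy
    rw [Fn.zext_of_mem g hy]
    split_ifs with h
    · rw [← deriv_coord_mul (hW.trans hV) g ⟨y, hy⟩ h, hg, derivFn_res hW hV f]
      rfl
    · rw [div_eq_iff h, Fn.zext_of_mem f (hW hy), mul_comm]
      exact (congrArg (fun g : Fn n W => g ⟨y, hy⟩) hg).symm
  · ext x
    change c.ext x 0 * (if _ then _ else _) = _
    split_ifs with h
    · rw [h, zero_mul, h0 x h]
    · rw [mul_div_cancel₀ _ h, Fn.zext_of_mem f x.2]

/-- Near every point, a smooth function has a primitive in the direction of the boundary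
coordinate which vanishes on the boundary. -/
theorem exists_eq_derivFn_coord_mul (hV : V ≤ c.dom) (f : Fn n V) {x : M} (hx : x ∈ V) :
    ∃ (W : Opens M) (hW : W ≤ V) (g : Fn n W), x ∈ W ∧
      Fn.res hW f = c.derivFn 0 (hW.trans hV) (c.coord 0 (hW.trans hV) * g) := by
  obtain ⟨F, hF, W, hW, hxW, hfF⟩ := exists_eq_pull hV f hx
  have hG := segAvg_contDiffOn hF
  refine ⟨W, hW, c.pull (hW.trans hV) _ hG, hxW, ?_⟩
  have hc : ContDiffOn ℝ ∞ (fun y : EuclideanSpace ℝ (Fin n) => y 0) (HS n) :=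
    ContDiff.contDiffOn (by fun_prop)
  have h1 : c.coord 0 (hW.trans hV) * c.pull (hW.trans hV) _ hG =
      c.pull (hW.trans hV) (fun y => y 0 * segAvg F y) (hc.mul hG) := rfl
  rw [h1, derivFn_pull, hfF]
  ext y
  exact (pd_coord_mul_segAvg hF (ext_mem_HS (hV (hW y.2)))).symm

end MChart

/-- Division by the boundary coordinate does not raise the order. -/
theorem HasOrderLTAt.of_coord_mul (hV : V ≤ c.dom) {a : Fin k} {r : ℕ} {P : MultiOp 𝓔 k V}
    (h : HasOrderLTAt a r ((LinearMap.mulLeft ℝ (c.coord 0 hV)).compMultilinearMap P)) :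
    HasOrderLTAt a r P := by
  induction r generalizing P with
  | zero =>
    refine MultilinearMap.ext fun φ => MChart.eq_zero_of_coord_mul hV ?_
    exact congrArg (fun Q : MultiOp 𝓔 k V => Q φ) h
  | succ r ih =>
    intro f
    refine ih ?_
    rw [← slotComm_mulLeft]
    exact h f

variable [T2Space M] [SecondCountableTopology M] [IsManifold (𝓡∂ n) ∞ M]

/-- A polydifferential operator whose values vanish on the boundary is divisible by the boundary
coordinate. -/
theorem PolyDiffOp.exists_lmul_coord_eq (hV : V ≤ c.dom) (R : PolyDiffOp 𝓔 k V)
    (hR : ∀ (W : Set.Iic V) (φ : Fin k → Fields 𝓔 W.1) (x : W.1), c.ext x 0 = 0 →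
      R.1 W φ x = 0) :
    ∃ R' : PolyDiffOp 𝓔 k V, R = lmul (Fn.mulOp (c.coord 0 hV)) R' := by
  have hW : ∀ W : Set.Iic V, W.1 ≤ c.dom := fun W => (iic_le W).trans hV
  choose g hg using fun W φ => MChart.exists_coord_mul_eq (hW W) (R.1 W φ) (hR W φ)
  let G : ∀ W : Set.Iic V, MultiOp 𝓔 k W.1 := fun W =>
    { toFun := g W
      map_update_add' := fun φ a ψ ψ' => MChart.coord_mul_cancel (hW W) <| by
        rw [mul_add, hg, hg, hg, MultilinearMap.map_update_add]
      map_update_smul' := fun φ a t ψ => MChart.coord_mul_cancel (hW W) <| by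
        rw [mul_smul_comm, hg, hg, MultilinearMap.map_update_smul] }
  have hG : ∀ W : Set.Iic V,
      R.1 W = (LinearMap.mulLeft ℝ (c.coord 0 (hW W))).compMultilinearMap (G W) := fun W =>
    MultilinearMap.ext fun φ => (hg W φ).symm
  refine ⟨⟨G, fun W' W h φ => MChart.coord_mul_cancel (hW W') ?_, fun x hx => ?_⟩,
    ext fun W φ => (hg W φ).symm⟩
  · refine (hg W' _).trans ((R.2.1 W' W h φ).trans ?_)
    rw [← hg W φ]
    rfl
  · obtain ⟨N, hN, r, hr⟩ := R.2.2 x hx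
    exact ⟨N, hN, r, fun W hWN a => HasOrderLTAt.of_coord_mul (hW W) ((hG W) ▸ hr W hWN a)⟩

end Division

/-! ### Total derivatives -/

section TotalDerivatives

open Set Filter Topology

variable {n : ℕ} [NeZero n] {M : Type u} [TopologicalSpace M]
  [ChartedSpace (EuclideanHalfSpace n) M] {𝓔 : GradedBundle n M} {k : ℕ}
  {c : MChart n M} {V : Opens M}

/-- Multiplication of compactly supported fields by a smooth function. -/
def CFields.mulFn {U : Opens M} (f : Fn n U) (φ : CFields 𝓔 U) : CFields 𝓔 U :=
  ⟨Fields.mulFn f φ.1, by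
    obtain ⟨K, hK, hKU, hφ⟩ := φ.2
    exact ⟨K, hK, hKU, fun x hx i => by rw [Fields.mulFn_apply, hφ x hx i, smul_zero]⟩⟩

/-- Cutting off a field by a test function. -/
def CFields.cutoff {U : Opens M} (χ : TestFn n U) : Fields 𝓔 U →ₗ[ℝ] CFields 𝓔 U :=
  (Fields.mulFn χ.1).codRestrict _ fun φ => by
    obtain ⟨K, hK, hKU, hχ⟩ := χ.2
    exact ⟨K, hK, hKU, fun x hx i => by rw [Fields.mulFn_apply, hχ x hx, zero_smul]⟩

theorem CFields.cutoff_coe {U : Opens M} (χ : TestFn n U) (φ : Fields 𝓔 U) :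
    (CFields.cutoff χ φ).1 = Fields.mulFn χ.1 φ := rfl

variable [T2Space M]

theorem DiffOp.testMap_mul (D D' : DiffOp n V) (f : TestFn n V) :
    (D * D').testMap f = D.testMap (D'.testMap f) := rfl

theorem mulOp_mul_testMap (f g : Fn n V) (t : TestFn n V) :
    (Fn.mulOp (f * g)).testMap t = (Fn.mulOp f).testMap ((Fn.mulOp g).testMap t) :=
  Subtype.ext (mul_assoc f g t.1)

theorem mulOp_add_testMap (f g : Fn n V) (t : TestFn n V) :
    (Fn.mulOp (f + g)).testMap t = (Fn.mulOp f).testMap t + (Fn.mulOp g).testMap t :=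
  Subtype.ext (add_mul f g t.1)

theorem mulOp_algebraMap_testMap (a : ℝ) (t : TestFn n V) :
    (Fn.mulOp (algebraMap ℝ (Fn n V) a)).testMap t = a • t :=
  Subtype.ext (Algebra.smul_def a t.1).symm

/-- As `dx · ∂_0` is minus the integral over the boundary, it vanishes on test functions which
vanish on the boundary. -/
theorem MChart.dx_rmul_derivOp_zero_apply (hV : V ≤ c.dom) (f : TestFn n V)
    (hf : ∀ x : V, c.ext x 0 = 0 → f.1 x = 0) :
    ((c.dx hV).rmul (c.derivOp 0 hV)).1 f = 0 := by
  obtain ⟨σ, -, h0, hσ, -, -⟩ := exists_boundary_measure n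
  rw [Distribution.rmul_apply, dx_apply, read_zext_derivOp hV, hσ _ (halfTest_read hV),
    MeasureTheory.integral_eq_zero_of_ae, neg_zero]
  filter_upwards [h0] with y hy
  by_cases ht : y ∈ c.ext.target
  · rw [read_of_mem ht]
    by_cases hyV : c.ext.symm y ∈ V
    · rw [Fn.zext_of_mem _ hyV]
      exact hf ⟨_, hyV⟩ (by rw [ext_ext_symm ht, hy])
    · exact Fn.zext_of_notMem _ hyV
  · exact read_of_notMem ht

namespace PolyDiffOp

theorem testFn_add (P Q : PolyDiffOp 𝓔 (k + 1) V) (φ : Fin (k + 1) → CFields 𝓔 V) :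
    (P + Q).testFn φ = P.testFn φ + Q.testFn φ := rfl

omit [T2Space M] in
theorem app_sum {ι : Type*} (s : Finset ι) (P : ι → PolyDiffOp 𝓔 k V)
    (φ : Fin k → Fields 𝓔 V) : (∑ i ∈ s, P i).app φ = ∑ i ∈ s, (P i).app φ := by
  classical
  induction s using Finset.induction_on with
  | empty => rw [Finset.sum_empty, Finset.sum_empty]; rfl
  | insert i s hi ih => rw [Finset.sum_insert hi, Finset.sum_insert hi, ← ih]; rfl

theorem testFn_sum {ι : Type*} (s : Finset ι) (P : ι → PolyDiffOp 𝓔 (k + 1) V)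
    (φ : Fin (k + 1) → CFields 𝓔 V) : (∑ i ∈ s, P i).testFn φ = ∑ i ∈ s, (P i).testFn φ := by
  apply Subtype.ext
  rw [Submodule.coe_sum]
  exact app_sum s P _

variable [SecondCountableTopology M] [IsManifold (𝓡∂ n) ∞ M]

/-- The value of a polydifferential operator at a point can be computed with compactly supported
fields, supported in any given neighbourhood of the point. -/
theorem exists_cfields (W : Set.Iic V) (φ : Fin k → Fields 𝓔 W.1) (x : W.1) (N : Opens M)
    (hx : (x : M) ∈ N) :
    ∃ (ψ : Fin k → CFields 𝓔 V) (K : Set M), IsCompact K ∧ K ⊆ N ∧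
      (∀ a (y : V), (y : M) ∉ K → ∀ i, (ψ a).1.1 i y = 0) ∧
      ∀ P : PolyDiffOp 𝓔 k V,
        P.app (fun a => (ψ a).1) ⟨x, iic_le W x.2⟩ = P.1 W φ x := by
  have hWN : W.1 ⊓ N ≤ W.1 := inf_le_left
  obtain ⟨χ, V', hxV', hV', hχ⟩ := exists_cutoff_at (n := n) (U := W.1 ⊓ N) ⟨x.2, hx⟩
  obtain ⟨K, hK, hKN, hχ0⟩ := χ.2
  refine ⟨fun a => CFields.ext (hWN.trans (iic_le W)) (CFields.cutoff χ (Fields.res hWN (φ a))),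
    K, hK, fun y hy => (hKN hy).2, fun a y hy i => ?_, fun P => ?_⟩
  · rw [CFields.ext_apply]
    by_cases hyW : (y : M) ∈ W.1 ⊓ N
    · rw [vecZext_of_mem _ hyW, CFields.cutoff_coe, Fields.mulFn_apply, hχ0 ⟨y, hyW⟩ hy, zero_smul]
    · exact vecZext_of_notMem _ hyW
  · have hV'W : V' ≤ W.1 := hV'.trans hWN
    have hV'V : V' ≤ V := hV'W.trans (iic_le W)
    have h1 := P.2.1 ⟨V', hV'V⟩ ⟨V, le_refl V⟩ hV'V fun a =>
      (CFields.ext (hWN.trans (iic_le W)) (CFields.cutoff χ (Fields.res hWN (φ a)))).1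
    have h2 := P.2.1 ⟨V', hV'V⟩ W hV'W φ
    have h3 : (fun a => Fields.res hV'V (CFields.ext (hWN.trans (iic_le W))
        (CFields.cutoff χ (Fields.res hWN (φ a)))).1) = fun a => Fields.res hV'W (φ a) := by
      funext a
      ext i y
      change vecZext 𝓔 _ _ = (φ a).1 i ⟨y, hV'W y.2⟩
      rw [vecZext_of_mem _ (hV' y.2), CFields.cutoff_coe, Fields.mulFn_apply,
        hχ ⟨y, hV' y.2⟩ y.2, one_smul]
      rfl
    rw [h3] at h1
    exact congrArg (fun g : Fn n V' => g ⟨x, hxV'⟩) (h1.symm.trans h2)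

/-- An operator which is linear over the smooth functions in its first argument vanishes if the
integrals of its values vanish whenever the first argument is supported in the interior. -/
theorem eq_zero_of_integral (hV : V ≤ c.dom) {L : PolyDiffOp 𝓔 (k + 1) V}
    (hL : ∀ j, comm 0 (c.coord j hV) L = 0)
    (h : ∀ (φ : Fin (k + 1) → CFields 𝓔 V) (K : Set M), IsCompact K →
      (∀ y ∈ K, 0 < c.ext y 0) → (∀ (y : V), (y : M) ∉ K → ∀ i, (φ 0).1.1 i y = 0) →
        (c.dx hV).1 (L.testFn φ) = 0) :
    L = 0 := by
  refine ext fun W φ => ?_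
  have hWc : W.1 ≤ c.dom := (iic_le W).trans hV
  -- multiplication by `x_0` reduces the claim to interior points
  refine MChart.eq_zero_of_coord_mul hWc ?_
  ext x
  change c.ext x 0 * L.1 W φ x = 0
  by_cases hx0 : c.ext x 0 = 0
  · rw [hx0, zero_mul]
  have hpos : 0 < c.ext x 0 := lt_of_le_of_ne (mem_HS.1 (MChart.ext_mem_HS (hWc x.2))) (Ne.symm hx0)
  -- the interior of the domain of the chart
  let N : Opens M := ⟨c.dom ∩ {y | 0 < c.ext y 0}, by
    have hc : ContinuousOn (fun y => c.ext y 0) c.dom := by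
      have h1 := c.1.continuousOn_extend (I := 𝓡∂ n)
      rw [c.1.extend_source] at h1
      exact (EuclideanSpace.proj (𝕜 := ℝ) (0 : Fin n)).continuous.comp_continuousOn h1
    exact hc.isOpen_inter_preimage c.dom.isOpen isOpen_Ioi⟩
  obtain ⟨ψ, K, hK, hKN, hψK, hψ⟩ := exists_cfields W φ x N ⟨hWc x.2, hpos⟩
  rw [← hψ L]
  have h1 := MChart.eq_zero_of_moments hV (L.testFn ψ) (fun p => ?_) ⟨x, iic_le W x.2⟩ hpos
  · change c.ext x 0 * (L.testFn ψ).1 _ = 0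
    rw [h1, mul_zero]
  -- by linearity, the polynomial can be moved to the first argument
  have h2 : (Fn.mulOp (c.polyFn hV p)).testMap (L.testFn ψ) =
      L.testFn (Function.update ψ 0 (CFields.mulFn (c.polyFn hV p) (ψ 0))) := by
    apply Subtype.ext
    have h3 := map_mulFn hV 0 hL ⟨V, le_refl V⟩ (fun a => (ψ a).1) (c.polyFn hV p)
    refine Eq.trans h3.symm ?_
    change L.app _ = L.app _
    congr 1
    funext a
    by_cases ha : a = 0
    · subst ha
      simp only [Function.update_self]
      rfl
    · simp only [Function.update_of_ne ha]
  rw [h2]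
  refine h _ K hK (fun y hy => (hKN hy).2) fun y hy i => ?_
  rw [Function.update_self]
  change _ • (ψ 0).1.1 i y = 0
  rw [hψK 0 y hy i, smul_zero]

/-- If the boundary integrals of all values vanish, an operator which commutes with the tangential
coordinates in its first argument has values vanishing on the boundary. -/
theorem eq_zero_of_boundary_integral (hV : V ≤ c.dom) {R : PolyDiffOp 𝓔 (k + 1) V}
    (hR : ∀ j, j ≠ 0 → comm 0 (c.coord j hV) R = 0)
    (h : ∀ φ : Fin (k + 1) → CFields 𝓔 V,
      ((c.dx hV).rmul (c.derivOp 0 hV)).1 (R.testFn φ) = 0) (W : Set.Iic V)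
    (φ : Fin (k + 1) → Fields 𝓔 W.1) (x : W.1) (hx : c.ext x 0 = 0) : R.1 W φ x = 0 := by
  obtain ⟨ψ, -, -, -, -, hψ⟩ := exists_cfields W φ x ⊤ trivial
  rw [← hψ R]
  refine MChart.eq_zero_of_boundary_moments hV (R.testFn ψ) (fun p => ?_) ⟨x, iic_le W x.2⟩ hx
  clear hψ
  -- Tangential coordinates can be moved to the first argument one at a time, and the boundary
  -- coordinate is zero on the boundary.
  simp only [DiffOp.testMap_mul]
  induction p using MvPolynomial.induction_on generalizing ψ with
  | C a =>
    rw [MChart.polyFn, MvPolynomial.aeval_C, mulOp_algebraMap_testMap, map_smul, map_smul]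
    exact (congrArg (a • ·) (h ψ)).trans (smul_zero a)
  | add p q hp hq =>
    rw [MChart.polyFn, map_add, mulOp_add_testMap, map_add, map_add]
    exact (congrArg₂ (· + ·) (hp ψ) (hq ψ)).trans (add_zero 0)
  | mul_X p j hp =>
    rw [MChart.polyFn, map_mul, MvPolynomial.aeval_X]
    by_cases hj : j = 0
    · subst hj
      rw [mul_comm, mulOp_mul_testMap]
      exact congrArg (fun T : Distribution n V => T.1 _) (MChart.dx_rmul_derivOp_zero_mul hV)
    · have h2 : (Fn.mulOp (c.coord j hV)).testMap (R.testFn ψ) =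
          R.testFn (Function.update ψ 0 (CFields.mulFn (c.coord j hV) (ψ 0))) := by
        apply Subtype.ext
        have h3 := congrArg (fun Q : PolyDiffOp 𝓔 (k + 1) V => Q.app fun a => (ψ a).1) (hR j hj)
        have h4 := slotComm_apply 0 (c.coord j hV) R.app fun a => (ψ a).1
        refine (sub_eq_zero.1 (h4.symm.trans h3)).trans ?_
        change R.app _ = R.app _
        congr 1
        funext a
        by_cases ha : a = 0
        · subst ha
          simp only [Function.update_self]
          rfl
        · simp only [Function.update_of_ne ha]
      rw [mulOp_mul_testMap, h2]
      exact hp _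

/-- The only relations between `∂`-smooth densities and polydifferential operators: if all
integrals `∫ P(φ) dx` vanish, then `P` is a sum of operators `D ∘ Q` with `dx · D = 0`. -/
theorem exists_eq_sum_lmul (F : LocalFrame 𝓔 V) (hV : V ≤ c.dom) {P : PolyDiffOp 𝓔 (k + 1) V}
    (hPu : P ∈ uniformOrder 𝓔 (k + 1) V)
    (hP : ∀ φ : Fin (k + 1) → CFields 𝓔 V, (c.dx hV).1 (P.testFn φ) = 0) :
    ∃ (R : PolyDiffOp 𝓔 (k + 1) V) (Q S : {i : Fin n // i ≠ 0} → PolyDiffOp 𝓔 (k + 1) V),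
      P = lmul (c.derivOp 0 hV * Fn.mulOp (c.coord 0 hV)) R +
        ∑ i, lmul (c.derivOp i.1 hV) (Q i) +
        ∑ i, lmul (c.derivOp 0 hV * c.derivOp i.1 hV) (S i) := by
  obtain ⟨r, hr⟩ := hPu
  have hk : P ∈ killed (fun j => comm 0 (c.coord j hV)) (r + 1) :=
    killed_le_succ r (mem_killed (fun W => hr W 0) _)
  obtain ⟨L, Q, hL, hQ, hPLQ⟩ := exists_eq_add_sum_range (fun i j => comm_mul_comm 0 _ _)
    (precompNabla_mul_comm_sub F hV 0) (lmulEnd_derivOp_mul_comm_sub hV 0) hk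
  simp only [lmulEnd_apply] at hPLQ
  -- The integrals of the tangential derivatives `∂_i Q_i` vanish.
  have hsum : ∀ φ : Fin (k + 1) → CFields 𝓔 V, (c.dx hV).1 (L.testFn φ) =
      -((c.dx hV).rmul (c.derivOp 0 hV)).1 ((Q 0).testFn φ) := by
    intro φ
    have h1 := hP φ
    rw [hPLQ, testFn_add, testFn_sum, map_add, map_sum, Finset.sum_eq_single 0] at h1
    · exact eq_neg_of_add_eq_zero_left h1
    · intro i _ hi
      exact congrArg (fun T : Distribution n V => T.1 ((Q i).testFn φ))
        (MChart.dx_rmul_derivOp hV hi)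
    · simp
  -- For fields supported in the interior the boundary term vanishes as well.
  have hL0 : L = 0 := by
    refine eq_zero_of_integral hV (mem_killed_one.1 hL) fun φ K hK hK0 hφ => ?_
    rw [hsum φ, neg_eq_zero]
    refine MChart.dx_rmul_derivOp_zero_apply hV _ fun x hx => ?_
    exact (Q 0).app_eq_zero hK.isClosed 0 hφ x fun hxK => (hK0 x hxK).ne' hx
  -- Now `P = ∑ ∂_i Q_i`, and the boundary integral of `Q_0` vanishes: integrate by parts once more,
  -- in the tangential directions only.
  subst hL0
  obtain ⟨R, S, hR, -, hQRS⟩ := exists_eq_add_sum_range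
    (c := fun j : {i : Fin n // i ≠ 0} => comm (𝓔 := 𝓔) 0 (c.coord j.1 hV))
    (fun i j => comm_mul_comm 0 _ _)
    (n := fun j => precompNabla F hV 0 j.1) (d := fun j => lmulEnd (c.derivOp j.1 hV))
    (fun i j => by simp only [precompNabla_mul_comm_sub F hV 0, Subtype.ext_iff])
    (fun i j => by simp only [lmulEnd_derivOp_mul_comm_sub hV 0, Subtype.ext_iff])
    (killed_le_succ r (killed_le_comp Subtype.val r (hQ 0)))
  simp only [lmulEnd_apply] at hQRS
  have hR0 : ∀ φ : Fin (k + 1) → CFields 𝓔 V,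
      ((c.dx hV).rmul (c.derivOp 0 hV)).1 (R.testFn φ) = 0 := by
    intro φ
    have h1 := hsum φ
    have h0 : (c.dx hV).1 ((0 : PolyDiffOp 𝓔 (k + 1) V).testFn φ) = 0 := map_zero _
    rw [h0, zero_eq_neg, hQRS, testFn_add, testFn_sum, map_add, map_sum, Finset.sum_eq_zero,
      add_zero] at h1
    · exact h1
    · intro i _
      exact congrArg (fun T : Distribution n V => T.1 ((S i).testFn φ))
        (MChart.dx_rmul_derivOp_zero_mul_derivOp hV i.2)
  -- The remainder vanishes on the boundary, and is divisible by `x_0`.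
  obtain ⟨R', hR'⟩ := exists_lmul_coord_eq hV R
    (eq_zero_of_boundary_integral hV (fun j hj => mem_killed_one.1 hR ⟨j, hj⟩) hR0)
  refine ⟨R', fun i => Q i, S, ?_⟩
  have hlmul : ∀ (D : DiffOp n V) (A B : PolyDiffOp 𝓔 (k + 1) V),
      lmul D (A + B) = lmul D A + lmul D B := fun D => map_add (lmulEnd D)
  have hlmul' : ∀ (D : DiffOp n V) (A : {i : Fin n // i ≠ 0} → PolyDiffOp 𝓔 (k + 1) V),
      lmul D (∑ i, A i) = ∑ i, lmul D (A i) := fun D A => map_sum (lmulEnd D) A _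
  rw [hPLQ, zero_add, Fintype.sum_eq_add_sum_subtype_ne _ 0, hQRS, hlmul, hlmul', hR',
    add_right_comm]
  rfl

end PolyDiffOp

end TotalDerivatives

/-! ### Graded symmetrization

The exchanges of neighbouring arguments with Koszul signs generate a finite monoid of endomorphisms,
and averaging over it is a projection to the graded symmetric operators. -/

section Average

variable {X Y : Type*} [AddCommGroup X] [Module ℝ X] [AddCommGroup Y] [Module ℝ Y]

/-- The average of a finite set of endomorphisms. -/
def average (G : Finset (Module.End ℝ X)) : Module.End ℝ X := (G.card : ℝ)⁻¹ • ∑ g ∈ G, g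

theorem mul_average {G : Finset (Module.End ℝ X)} {T : Module.End ℝ X} (hT : T * T = 1)
    (hG : ∀ g ∈ G, T * g ∈ G) : T * average G = average G := by
  rw [average, mul_smul_comm, Finset.mul_sum]
  congr 1
  refine Finset.sum_bij' (fun g _ => T * g) (fun g _ => T * g) hG hG ?_ ?_ fun g _ => rfl <;>
  · intro g _
    rw [← mul_assoc, hT, one_mul]

theorem map_average {G : Finset (Module.End ℝ X)} (hG : G.Nonempty) (f : X →ₗ[ℝ] Y) {P : X} {y : Y}
    (h : ∀ g ∈ G, f (g P) = y) : f (average G P) = y := by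
  rw [average, LinearMap.smul_apply, LinearMap.sum_apply, map_smul, map_sum,
    Finset.sum_congr rfl h, Finset.sum_const, ← Nat.cast_smul_eq_nsmul ℝ, smul_smul,
    inv_mul_cancel₀ (Nat.cast_ne_zero.2 hG.card_ne_zero), one_smul]

end Average

section Twist

variable {k : ℕ} {E X ι : Type*} [AddCommMonoid E] [Module ℝ E] [AddCommGroup X] [Module ℝ X]
  [Fintype ι] [DecidableEq ι] (π : ι → Module.End ℝ E)

/-- Permutation of the arguments of a multilinear map by `σ`, with signs `ε` depending on the
components of the arguments with respect to a decomposition of the module of arguments. -/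
def twist (σ : Equiv.Perm (Fin k)) (ε : (Fin k → ι) → ℤˣ) :
    Module.End ℝ (MultilinearMap ℝ (fun _ : Fin k => E) X) where
  toFun P := ∑ s, ((ε s : ℤ) : ℝ) • (P.domDomCongr σ).compLinearMap fun a => π (s a)
  map_add' P Q := by
    rw [← Finset.sum_add_distrib]
    exact Finset.sum_congr rfl fun s _ => MultilinearMap.ext fun φ => smul_add _ _ _
  map_smul' t P := by
    rw [RingHom.id_apply, Finset.smul_sum]
    exact Finset.sum_congr rfl fun s _ => MultilinearMap.ext fun φ => smul_comm _ _ _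

variable {π}

omit [DecidableEq ι] in
theorem twist_apply (σ : Equiv.Perm (Fin k)) (ε : (Fin k → ι) → ℤˣ)
    (P : MultilinearMap ℝ (fun _ : Fin k => E) X) (φ : Fin k → E) :
    twist π σ ε P φ = ∑ s, ((ε s : ℤ) : ℝ) • P fun a => π (s (σ a)) (φ (σ a)) := by
  change (∑ s, _ : MultilinearMap ℝ (fun _ : Fin k => E) X) φ = _
  rw [sum_apply]
  rfl

/-- The composition of two twists is a twist: as the `π i` are orthogonal idempotents, only matching
components contribute. -/
theorem twist_twist (hπ : ∀ i j, π i * π j = if i = j then π i else 0)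
    (σ τ : Equiv.Perm (Fin k)) (ε δ : (Fin k → ι) → ℤˣ)
    (P : MultilinearMap ℝ (fun _ : Fin k => E) X) :
    twist π σ ε (twist π τ δ P) = twist π (σ * τ) (fun s => ε s * δ (s ∘ σ)) P := by
  refine MultilinearMap.ext fun φ => ?_
  rw [twist_apply, twist_apply]
  refine Finset.sum_congr rfl fun s _ => ?_
  rw [twist_apply, Finset.sum_eq_single (s ∘ σ)]
  · rw [smul_smul, Units.val_mul, Int.cast_mul]
    congr 2
    funext a
    have h := congrArg (fun A : Module.End ℝ E => A (φ (σ (τ a))))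
      (hπ (s (σ (τ a))) (s (σ (τ a))))
    rw [if_pos rfl] at h
    exact h
  · intro t _ ht
    obtain ⟨b, hb⟩ := Function.ne_iff.1 ht
    rw [Function.comp_apply] at hb
    rw [P.map_coord_zero (τ.symm b), smul_zero]
    have h := congrArg (fun A : Module.End ℝ E => A (φ (σ b))) (hπ (t b) (s (σ b)))
    rw [if_neg hb] at h
    simpa using h
  · simp

omit [DecidableEq ι] in
theorem twist_one (hsum : ∑ i, π i = 1) (P : MultilinearMap ℝ (fun _ : Fin k => E) X) :
    twist π 1 1 P = P := by
  refine MultilinearMap.ext fun φ => ?_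
  rw [twist_apply]
  have h : φ = fun a => ∑ i, π i (φ a) := by
    funext a
    rw [← LinearMap.sum_apply, hsum]
    rfl
  conv_rhs => rw [h, MultilinearMap.map_sum]
  simp

variable {deg : ι → ℤ}

/-- The Koszul sign of the exchange of two arguments. -/
def koszul (deg : ι → ℤ) (a b : Fin k) (s : Fin k → ι) : ℤˣ := (deg (s a) * deg (s b)).negOnePow

omit [DecidableEq ι] in
theorem twist_swap_apply (hsum : ∑ i, π i = 1) (a b : Fin k) {p q : ℤ}
    (P : MultilinearMap ℝ (fun _ : Fin k => E) X) {φ : Fin k → E}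
    (hp : ∀ i, deg i ≠ p → π i (φ a) = 0) (hq : ∀ i, deg i ≠ q → π i (φ b) = 0) :
    twist π (Equiv.swap a b) (koszul deg a b) P φ =
      ((p * q).negOnePow : ℤ) • P (φ ∘ Equiv.swap a b) := by
  have h := congrArg (fun Q => Q (φ ∘ Equiv.swap a b)) (twist_one hsum P)
  change twist π 1 1 P (φ ∘ Equiv.swap a b) = P _ at h
  rw [← h, twist_apply, twist_apply, ← Int.cast_smul_eq_zsmul ℝ, Finset.smul_sum,
    ← Equiv.sum_comp (Equiv.arrowCongr (Equiv.swap a b) (Equiv.refl ι))]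
  refine Finset.sum_congr rfl fun s _ => ?_
  have hs : ∀ c, (Equiv.arrowCongr (Equiv.swap a b) (Equiv.refl ι)) s ((Equiv.swap a b) c) =
      s c := fun c => by simp
  simp only [hs]
  simp only [Pi.one_apply, Units.val_one, Int.cast_one, one_smul, Equiv.Perm.one_apply,
    Function.comp_apply]
  by_cases h1 : deg (s b) = p
  · by_cases h2 : deg (s a) = q
    · simp [koszul, h1, h2]
    · rw [P.map_coord_zero a, smul_zero, smul_zero]
      rw [Equiv.swap_apply_left]
      exact hq _ h2
  · rw [P.map_coord_zero b, smul_zero, smul_zero]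
    rw [Equiv.swap_apply_right]
    exact hp _ h1

/-- Graded symmetry with respect to the exchange of two arguments is invariance under a twist. -/
theorem twist_swap_eq_self_iff (hπ : ∀ i j, π i * π j = if i = j then π i else 0)
    (hsum : ∑ i, π i = 1) (a b : Fin k) (P : MultilinearMap ℝ (fun _ : Fin k => E) X) :
    twist π (Equiv.swap a b) (koszul deg a b) P = P ↔
      ∀ (p q : ℤ) (φ : Fin k → E), (∀ i, deg i ≠ p → π i (φ a) = 0) →
        (∀ i, deg i ≠ q → π i (φ b) = 0) →
          P (φ ∘ Equiv.swap a b) = ((p * q).negOnePow : ℤ) • P φ := by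
  have hsign : ∀ (m : ℤ) (x : X), (m.negOnePow : ℤ) • (m.negOnePow : ℤ) • x = x := by
    intro m x
    rw [smul_smul, ← Units.val_mul, Int.units_mul_self, Units.val_one, one_smul]
  constructor
  · intro h p q φ hp hq
    conv_rhs => rw [← h, twist_swap_apply hsum a b P hp hq, hsign]
  · intro h
    refine MultilinearMap.ext fun φ => ?_
    have hφ : φ = fun a => ∑ i, π i (φ a) := by
      funext a
      rw [← LinearMap.sum_apply, hsum]
      rfl
    rw [hφ, MultilinearMap.map_sum, MultilinearMap.map_sum]
    refine Finset.sum_congr rfl fun s _ => ?_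
    have hhom : ∀ c i, deg i ≠ deg (s c) → π i (π (s c) (φ c)) = 0 := by
      intro c i hi
      have h := congrArg (fun A : Module.End ℝ E => A (φ c)) (hπ i (s c))
      rwa [if_neg fun h => hi (by rw [h])] at h
    rw [twist_swap_apply hsum a b P (hhom a) (hhom b), h _ _ _ (hhom a) (hhom b), hsign]

end Twist

section Symmetrize

open Set

variable {n : ℕ} [NeZero n] {M : Type u} [TopologicalSpace M]
  [ChartedSpace (EuclideanHalfSpace n) M] {𝓔 : GradedBundle n M} {k : ℕ} {V W : Opens M}

instance (𝓔 : GradedBundle n M) : Finite 𝓔.ι := 𝓔.finite_ι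

instance (𝓔 : GradedBundle n M) : Fintype 𝓔.ι := Fintype.ofFinite _

instance (𝓔 : GradedBundle n M) : DecidableEq 𝓔.ι := Classical.decEq _

/-- The projection of fields to one of the summands of the bundle. -/
def Fields.proj (i : 𝓔.ι) : Module.End ℝ (Fields 𝓔 W) where
  toFun φ := ⟨Pi.single i (φ.1 i), by
    intro j
    by_cases hj : j = i
    · subst hj
      rw [Pi.single_eq_same]
      exact φ.2 j
    · rw [Pi.single_eq_of_ne hj]
      exact (Fields 𝓔 W).zero_mem j⟩
  map_add' φ ψ := Subtype.ext (Pi.single_add i _ _)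
  map_smul' t φ := Subtype.ext (by
    change Pi.single i (t • φ.1 i) = t • (Pi.single i (φ.1 i) : ∀ i (x : W), 𝓔.E i x)
    funext j
    by_cases hj : j = i
    · subst hj
      rw [Pi.smul_apply, Pi.single_eq_same, Pi.single_eq_same]
    · rw [Pi.smul_apply, Pi.single_eq_of_ne hj, Pi.single_eq_of_ne hj, smul_zero])

theorem Fields.proj_coe (i : 𝓔.ι) (φ : Fields 𝓔 W) : (Fields.proj i φ).1 = Pi.single i (φ.1 i) :=
  rfl

theorem Fields.proj_mul_proj (i j : 𝓔.ι) : Fields.proj i * Fields.proj j =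
    if i = j then (Fields.proj i : Module.End ℝ (Fields 𝓔 W)) else 0 := by
  refine LinearMap.ext fun φ => Subtype.ext ?_
  rw [Module.End.mul_apply, Fields.proj_coe, Fields.proj_coe]
  split_ifs with h
  · subst h
    rw [Pi.single_eq_same]
    rfl
  · rw [Pi.single_eq_of_ne h, Pi.single_zero]
    rfl

theorem Fields.sum_proj : ∑ i : 𝓔.ι, (Fields.proj i : Module.End ℝ (Fields 𝓔 W)) = 1 := by
  refine LinearMap.ext fun φ => Subtype.ext ?_
  rw [LinearMap.sum_apply, Submodule.coe_sum]
  exact Finset.univ_sum_single φ.1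

theorem Fields.proj_eq_zero_iff {i : 𝓔.ι} {φ : Fields 𝓔 W} : Fields.proj i φ = 0 ↔ φ.1 i = 0 :=
  Subtype.ext_iff.trans Pi.single_eq_zero_iff

theorem isHomogeneous_iff {d : ℤ} {φ : Fields 𝓔 W} :
    IsHomogeneous d φ ↔ ∀ i, 𝓔.deg i ≠ d → Fields.proj i φ = 0 :=
  forall₂_congr fun _ _ => Fields.proj_eq_zero_iff.symm

theorem Fields.proj_mulFn (i : 𝓔.ι) (f : Fn n W) (φ : Fields 𝓔 W) :
    Fields.proj i (Fields.mulFn f φ) = Fields.mulFn f (Fields.proj i φ) := by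
  ext j x
  rw [Fields.mulFn_apply, Fields.proj_coe, Fields.proj_coe]
  by_cases hj : j = i
  · subst hj
    rw [Pi.single_eq_same, Pi.single_eq_same]
    rfl
  · rw [Pi.single_eq_of_ne hj, Pi.single_eq_of_ne hj]
    exact (smul_zero _).symm

theorem Fields.proj_res (h : W ≤ V) (i : 𝓔.ι) (φ : Fields 𝓔 V) :
    Fields.proj i (Fields.res h φ) = Fields.res h (Fields.proj i φ) := by
  ext j x
  change (Pi.single i _ : ∀ i (x : W), 𝓔.E i x) j x =
    (Pi.single i _ : ∀ i (x : V), 𝓔.E i x) j ⟨x, h x.2⟩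
  by_cases hj : j = i
  · subst hj
    rw [Pi.single_eq_same, Pi.single_eq_same]
    rfl
  · rw [Pi.single_eq_of_ne hj, Pi.single_eq_of_ne hj]
    rfl

/-- The projection of compactly supported fields to one of the summands of the bundle. -/
def CFields.proj (i : 𝓔.ι) : Module.End ℝ (CFields 𝓔 W) :=
  (Fields.proj i).restrict fun φ hφ => by
    obtain ⟨K, hK, hKU, h0⟩ := hφ
    refine ⟨K, hK, hKU, fun x hx j => ?_⟩
    rw [Fields.proj_coe]
    by_cases hj : j = i
    · subst hj
      rw [Pi.single_eq_same]
      exact h0 x hx j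
    · rw [Pi.single_eq_of_ne hj]
      rfl

theorem CFields.proj_coe (i : 𝓔.ι) (φ : CFields 𝓔 W) :
    (CFields.proj i φ).1 = Fields.proj i φ.1 := rfl

theorem CFields.proj_mul_proj (i j : 𝓔.ι) : CFields.proj i * CFields.proj j =
    if i = j then (CFields.proj i : Module.End ℝ (CFields 𝓔 W)) else 0 := by
  refine LinearMap.ext fun φ => Subtype.ext ?_
  refine (congrArg (fun A : Module.End ℝ (Fields 𝓔 W) => A φ.1) (Fields.proj_mul_proj i j)).trans ?_
  split_ifs <;> rfl

theorem CFields.sum_proj : ∑ i : 𝓔.ι, (CFields.proj i : Module.End ℝ (CFields 𝓔 W)) = 1 := by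
  refine LinearMap.ext fun φ => Subtype.ext ?_
  rw [LinearMap.sum_apply, Submodule.coe_sum]
  have h := congrArg (fun A : Module.End ℝ (Fields 𝓔 W) => A φ.1) (Fields.sum_proj (𝓔 := 𝓔))
  rw [LinearMap.sum_apply] at h
  exact h

theorem CFields.proj_eq_zero_iff {i : 𝓔.ι} {φ : CFields 𝓔 W} :
    CFields.proj i φ = 0 ↔ Fields.proj i φ.1 = 0 :=
  Subtype.ext_iff

theorem HasOrderLTAt.sum {ι : Type*} {a : Fin k} {r : ℕ} (S : Finset ι) {P : ι → MultiOp 𝓔 k W}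
    (h : ∀ s ∈ S, HasOrderLTAt a r (P s)) : HasOrderLTAt a r (∑ s ∈ S, P s) := by
  classical
  induction S using Finset.induction_on with
  | empty => exact HasOrderLTAt.zero r
  | insert i S hi ih =>
    rw [Finset.sum_insert hi]
    exact (h i (Finset.mem_insert_self i S)).add
      (ih fun s hs => h s (Finset.mem_insert_of_mem hs))

theorem HasOrderLTAt.domDomCongr {a : Fin k} {r : ℕ} {P : MultiOp 𝓔 k W}
    (σ : Equiv.Perm (Fin k)) (s : Fin k → 𝓔.ι) (h : HasOrderLTAt (σ.symm a) r P) :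
    HasOrderLTAt a r ((P.domDomCongr σ).compLinearMap fun a => Fields.proj (s a)) := by
  induction r generalizing P with
  | zero =>
    have h' : P = 0 := h
    subst h'
    rfl
  | succ r ih =>
    intro f
    have h1 : slotComm a f ((P.domDomCongr σ).compLinearMap fun a => Fields.proj (s a)) =
        ((slotComm (σ.symm a) f P).domDomCongr σ).compLinearMap fun a => Fields.proj (s a) := by
      refine MultilinearMap.ext fun φ => ?_
      change _ = slotComm (σ.symm a) f P fun b => Fields.proj (s (σ b)) (φ (σ b))
      rw [slotComm_apply, slotComm_apply]
      congr 1
      change P _ = P _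
      congr 1
      funext b
      by_cases hb : b = σ.symm a
      · subst hb
        simp [Fields.proj_mulFn]
      · have hb' : σ b ≠ a := fun h => hb (by rw [← h, Equiv.symm_apply_apply])
        simp [hb, hb']
    rw [h1]
    exact ih (h f)

namespace PolyDiffOp

/-- Permutation of the arguments of polydifferential operators, with signs. -/
def twist (σ : Equiv.Perm (Fin k)) (ε : (Fin k → 𝓔.ι) → ℤˣ) : Module.End ℝ (PolyDiffOp 𝓔 k V) where
  toFun P := ⟨fun W => BoundaryDMod.twist Fields.proj σ ε (P.1 W), by
      intro W' W h φ
      rw [twist_apply, twist_apply, map_sum]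
      refine Finset.sum_congr rfl fun s _ => ?_
      rw [map_smul, ← P.2.1 W' W h]
      simp only [Fields.proj_res], by
      intro x hx
      obtain ⟨N, hN, r, hr⟩ := P.2.2 x hx
      exact ⟨N, hN, r, fun W hW a => HasOrderLTAt.sum _ fun s _ =>
        ((hr W hW (σ.symm a)).domDomCongr σ s).smul _⟩⟩
  map_add' P Q := Subtype.ext (funext fun W =>
    map_add (BoundaryDMod.twist Fields.proj σ ε) (P.1 W) (Q.1 W))
  map_smul' t P := Subtype.ext (funext fun W =>
    map_smul (BoundaryDMod.twist Fields.proj σ ε) t (P.1 W))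

theorem twist_val (σ : Equiv.Perm (Fin k)) (ε : (Fin k → 𝓔.ι) → ℤˣ) (P : PolyDiffOp 𝓔 k V)
    (W : Set.Iic V) : (twist σ ε P).1 W = BoundaryDMod.twist Fields.proj σ ε (P.1 W) := rfl

variable (𝓔 k V) in
/-- The exchange of two neighbouring arguments with the Koszul sign. -/
def exchange (a : {a : Fin k × Fin k // (a.2 : ℕ) = a.1 + 1}) : Module.End ℝ (PolyDiffOp 𝓔 k V) :=
  twist (Equiv.swap a.1.1 a.1.2) (koszul 𝓔.deg a.1.1 a.1.2)

theorem mem_symPolyDiffOp_iff {P : PolyDiffOp 𝓔 k V} :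
    P ∈ SymPolyDiffOp 𝓔 k V ↔ ∀ a, exchange 𝓔 k V a P = P := by
  constructor
  · rintro h ⟨⟨a, b⟩, hab⟩
    refine Subtype.ext (funext fun W => ?_)
    refine (twist_swap_eq_self_iff Fields.proj_mul_proj Fields.sum_proj a b (P.1 W)).2
      fun p q φ hp hq => ?_
    exact h W a b hab p q φ (isHomogeneous_iff.2 hp) (isHomogeneous_iff.2 hq)
  · intro h W a b hab p q φ hp hq
    have h1 := congrArg (fun Q : PolyDiffOp 𝓔 k V => Q.1 W) (h ⟨⟨a, b⟩, hab⟩)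
    exact (twist_swap_eq_self_iff Fields.proj_mul_proj Fields.sum_proj a b (P.1 W)).1 h1 p q φ
      (isHomogeneous_iff.1 hp) (isHomogeneous_iff.1 hq)

theorem twist_mul_twist (σ τ : Equiv.Perm (Fin k)) (ε δ : (Fin k → 𝓔.ι) → ℤˣ) :
    (twist σ ε * twist τ δ : Module.End ℝ (PolyDiffOp 𝓔 k V)) =
      twist (σ * τ) fun s => ε s * δ (s ∘ σ) :=
  LinearMap.ext fun P => Subtype.ext (funext fun W =>
    twist_twist Fields.proj_mul_proj σ τ ε δ (P.1 W))

theorem twist_one_one : (twist 1 1 : Module.End ℝ (PolyDiffOp 𝓔 k V)) = 1 :=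
  LinearMap.ext fun P => Subtype.ext (funext fun W => twist_one Fields.sum_proj (P.1 W))

theorem exchange_mul_self (a : {a : Fin k × Fin k // (a.2 : ℕ) = a.1 + 1}) :
    exchange 𝓔 k V a * exchange 𝓔 k V a = 1 := by
  rw [exchange, twist_mul_twist, Equiv.swap_mul_self, ← twist_one_one]
  congr 1
  funext s
  have : koszul 𝓔.deg a.1.1 a.1.2 (s ∘ Equiv.swap a.1.1 a.1.2) = koszul 𝓔.deg a.1.1 a.1.2 s := by
    simp [koszul, mul_comm]
  rw [this, Int.units_mul_self]
  rfl

variable (𝓔 k V) in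
/-- The monoid generated by the exchanges of neighbouring arguments. -/
def exchangeMonoid : Submonoid (Module.End ℝ (PolyDiffOp 𝓔 k V)) :=
  Submonoid.closure (range (exchange 𝓔 k V))

/-- All products of exchanges are twists, of which there are only finitely many. -/
theorem finite_exchangeMonoid :
    (exchangeMonoid 𝓔 k V : Set (Module.End ℝ (PolyDiffOp 𝓔 k V))).Finite := by
  refine (finite_range fun p : Equiv.Perm (Fin k) × ((Fin k → 𝓔.ι) → ℤˣ) =>
    (twist p.1 p.2 : Module.End ℝ (PolyDiffOp 𝓔 k V))).subset fun g hg => ?_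
  induction hg using Submonoid.closure_induction with
  | mem g hg =>
    obtain ⟨a, rfl⟩ := hg
    exact ⟨(_, _), rfl⟩
  | one => exact ⟨(1, 1), twist_one_one⟩
  | mul g g' _ _ h h' =>
    obtain ⟨⟨σ, ε⟩, rfl⟩ := h
    obtain ⟨⟨τ, δ⟩, rfl⟩ := h'
    exact ⟨(_, _), (twist_mul_twist σ τ ε δ).symm⟩

/-- The graded symmetrization of polydifferential operators. -/
def symmetrize : Module.End ℝ (PolyDiffOp 𝓔 k V) :=
  average (finite_exchangeMonoid (𝓔 := 𝓔) (k := k) (V := V)).toFinset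

/-- A linear map which takes the same value on all images of `P` under products of exchanges takes
this value on the symmetrization of `P`. -/
theorem map_symmetrize {Y : Type*} [AddCommGroup Y] [Module ℝ Y] (f : PolyDiffOp 𝓔 k V →ₗ[ℝ] Y)
    {P : PolyDiffOp 𝓔 k V} {y : Y} (h : ∀ g ∈ exchangeMonoid 𝓔 k V, f (g P) = y) :
    f (symmetrize P) = y :=
  map_average ⟨1, (Set.Finite.mem_toFinset _).2 (one_mem _)⟩ f fun g hg =>
    h g ((Set.Finite.mem_toFinset _).1 hg)

theorem symmetrize_mem (P : PolyDiffOp 𝓔 k V) : symmetrize P ∈ SymPolyDiffOp 𝓔 k V :=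
  mem_symPolyDiffOp_iff.2 fun a => by
    have h := mul_average (exchange_mul_self a)
      (G := (finite_exchangeMonoid (𝓔 := 𝓔) (k := k) (V := V)).toFinset) fun g hg =>
        (Set.Finite.mem_toFinset _).2 (mul_mem (Submonoid.subset_closure (mem_range_self a))
          ((Set.Finite.mem_toFinset _).1 hg))
    exact congrArg (fun A : Module.End ℝ (PolyDiffOp 𝓔 k V) => A P) h

theorem symmetrize_of_mem {P : PolyDiffOp 𝓔 k V} (hP : P ∈ SymPolyDiffOp 𝓔 k V) :
    symmetrize P = P := by
  refine map_symmetrize LinearMap.id fun g hg => ?_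
  induction hg using Submonoid.closure_induction with
  | mem g hg =>
    obtain ⟨a, rfl⟩ := hg
    exact mem_symPolyDiffOp_iff.1 hP a
  | one => rfl
  | mul g g' _ _ h h' => exact (congrArg g h').trans h

theorem exchange_lmul (a : {a : Fin k × Fin k // (a.2 : ℕ) = a.1 + 1}) (D : DiffOp n V)
    (P : PolyDiffOp 𝓔 k V) : exchange 𝓔 k V a (lmul D P) = lmul D (exchange 𝓔 k V a P) := by
  refine ext fun W φ => ?_
  rw [lmul_val, exchange, twist_val, twist_val, twist_apply, twist_apply, map_sum]
  exact Finset.sum_congr rfl fun s _ => (map_smul (D.1 W) _ _).symm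

theorem symmetrize_lmul (D : DiffOp n V) (P : PolyDiffOp 𝓔 k V) :
    symmetrize (lmul D P) = lmul D (symmetrize P) := by
  have hG : ∀ g ∈ exchangeMonoid 𝓔 k V, ∀ Q, g (lmul D Q) = lmul D (g Q) := by
    intro g hg
    induction hg using Submonoid.closure_induction with
    | mem g hg =>
      obtain ⟨a, rfl⟩ := hg
      exact fun Q => exchange_lmul a D Q
    | one => exact fun Q => rfl
    | mul g g' _ _ h h' => exact fun Q => (congrArg g (h' Q)).trans (h _)
  have h1 : symmetrize * lmulEnd D = lmulEnd D * (symmetrize : Module.End ℝ (PolyDiffOp 𝓔 k V)) := by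
    rw [symmetrize, average, smul_mul_assoc, mul_smul_comm, Finset.sum_mul, Finset.mul_sum]
    congr 1
    exact Finset.sum_congr rfl fun g hg =>
      LinearMap.ext fun Q => hG g ((Set.Finite.mem_toFinset _).1 hg) Q
  exact congrArg (fun A : Module.End ℝ (PolyDiffOp 𝓔 k V) => A P) h1

/-- If a graded symmetric functional is the integral of a polydifferential operator, then it is the
integral of its symmetrization. -/
theorem apply_testFn_symmetrize [T2Space M] (T : Distribution n V) (P : PolyDiffOp 𝓔 (k + 1) V)
    (I : Functional 𝓔 (k + 1) V)
    (hI : ∀ a b : Fin (k + 1), (b : ℕ) = a + 1 → ∀ (p q : ℤ) (φ : Fin (k + 1) → CFields 𝓔 V),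
      IsHomogeneous p (φ a).1 → IsHomogeneous q (φ b).1 →
        I (φ ∘ Equiv.swap a b) = ((p * q).negOnePow : ℤ) • I φ)
    (hP : ∀ φ, I φ = T.1 (P.testFn φ)) (φ : Fin (k + 1) → CFields 𝓔 V) :
    T.1 ((symmetrize P).testFn φ) = I φ := by
  let f : PolyDiffOp 𝓔 (k + 1) V →ₗ[ℝ] ℝ :=
    { toFun := fun Q => T.1 (Q.testFn φ)
      map_add' := fun Q Q' => map_add T.1 (Q.testFn φ) (Q'.testFn φ)
      map_smul' := fun t Q => map_smul T.1 t (Q.testFn φ) }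
  refine map_symmetrize f fun g hg => ?_
  suffices h : ∀ Q : PolyDiffOp 𝓔 (k + 1) V, (∀ φ, I φ = T.1 (Q.testFn φ)) →
      ∀ φ, I φ = T.1 ((g Q).testFn φ) from (h P hP φ).symm
  clear hP P f φ
  induction hg using Submonoid.closure_induction with
  | one => exact fun Q h => h
  | mul g g' _ _ h h' => exact fun Q hQ => h _ (h' Q hQ)
  | mem g hg =>
    obtain ⟨⟨⟨a, b⟩, hab⟩, rfl⟩ := hg
    intro Q hQ φ
    have h1 := (twist_swap_eq_self_iff (deg := 𝓔.deg) (CFields.proj_mul_proj (𝓔 := 𝓔) (W := V))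
      (CFields.sum_proj (𝓔 := 𝓔) (W := V)) a b I).2 fun p q φ hp hq => hI a b hab p q φ
        (isHomogeneous_iff.2 fun i hi => CFields.proj_eq_zero_iff.1 (hp i hi))
        (isHomogeneous_iff.2 fun i hi => CFields.proj_eq_zero_iff.1 (hq i hi))
    conv_lhs => rw [← h1, twist_apply]
    have h2 : (exchange 𝓔 (k + 1) V ⟨⟨a, b⟩, hab⟩ Q).testFn φ =
        ∑ s, ((koszul 𝓔.deg a b s : ℤ) : ℝ) • Q.testFn fun c =>
          CFields.proj (s (Equiv.swap a b c)) (φ (Equiv.swap a b c)) := by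
      apply Subtype.ext
      rw [Submodule.coe_sum]
      exact twist_apply _ _ Q.app _
    rw [h2, map_sum]
    refine Finset.sum_congr rfl fun s _ => ?_
    rw [map_smul, hQ]

end PolyDiffOp

end Symmetrize

/-! ### Functionals supported on the diagonal -/

section Diagonal

open Set Filter Topology

variable {n : ℕ} [NeZero n] {M : Type u} [TopologicalSpace M]
  [ChartedSpace (EuclideanHalfSpace n) M] {𝓔 : GradedBundle n M} {k : ℕ} {U V : Opens M}

/-- A functional is supported on the diagonal if it vanishes on tuples of fields whose supports
have no common point. -/
def DiagonalSupport (I : Functional 𝓔 (k + 1) U) : Prop :=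
  ∀ φ : Fin (k + 1) → CFields 𝓔 U,
    (∀ x ∈ U, ∃ a, ∃ W : Opens M, x ∈ W ∧ ∀ y : U, (y : M) ∈ W → ∀ i, (φ a).1.1 i y = 0) →
      I φ = 0

/-- Changing the arguments away from the support of the first argument does not affect the value
of a functional supported on the diagonal. -/
theorem DiagonalSupport.congr {I : Functional 𝓔 (k + 1) U} (hI : DiagonalSupport I)
    {φ φ' : Fin (k + 1) → CFields 𝓔 U}
    (h : ∀ x ∈ U, ∃ W : Opens M, x ∈ W ∧
      ((∀ a (y : U), (y : M) ∈ W → ∀ i, (φ a).1.1 i y = (φ' a).1.1 i y) ∨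
        ∀ y : U, (y : M) ∈ W → ∀ i, (φ 0).1.1 i y = 0 ∧ (φ' 0).1.1 i y = 0)) :
    I φ = I φ' := by
  -- change the arguments one at a time
  suffices hS : ∀ S : Finset (Fin (k + 1)), I (S.piecewise φ' φ) = I φ by
    rw [← hS Finset.univ, Finset.piecewise_univ]
  intro S
  induction S using Finset.induction_on with
  | empty => rw [Finset.piecewise_empty]
  | insert a S ha ih =>
    rw [← ih, Finset.piecewise_insert, ← sub_eq_zero]
    have h1 : S.piecewise φ' φ = Function.update (S.piecewise φ' φ) a (φ a) := by
      rw [← Finset.piecewise_eq_of_notMem S φ' φ ha, Function.update_eq_self]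
    have h2 : I (Function.update (S.piecewise φ' φ) a (φ' a)) - I (S.piecewise φ' φ) =
        I (Function.update (S.piecewise φ' φ) a (φ' a + (-1 : ℝ) • φ a)) := by
      rw [MultilinearMap.map_update_add, MultilinearMap.map_update_smul, ← h1, neg_one_smul,
        sub_eq_add_neg]
    refine h2.trans ?_
    refine hI _ fun x hx => ?_
    obtain ⟨W, hxW, hW | hW⟩ := h x hx
    · refine ⟨a, W, hxW, fun y hy i => ?_⟩
      rw [Function.update_self]
      change (φ' a).1.1 i y + (-1 : ℝ) • (φ a).1.1 i y = 0
      rw [hW a y hy i, neg_one_smul, add_neg_cancel]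
    · refine ⟨0, W, hxW, fun y hy i => ?_⟩
      by_cases h0 : (0 : Fin (k + 1)) = a
      · subst h0
        rw [Function.update_self]
        change (φ' 0).1.1 i y + (-1 : ℝ) • (φ 0).1.1 i y = 0
        rw [(hW y hy i).1, (hW y hy i).2, smul_zero, add_zero]
      · rw [Function.update_of_ne h0]
        by_cases hS : (0 : Fin (k + 1)) ∈ S
        · rw [Finset.piecewise_eq_of_mem _ _ _ hS, (hW y hy i).2]
        · rw [Finset.piecewise_eq_of_notMem _ _ _ hS, (hW y hy i).1]

/-- A pair of smooth functions on `U` with support in `V`, the second of which is equal to one near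
the support of the first. -/
def IsBumpPair (χ ψ : Fn n U) (V : Opens M) : Prop :=
  (∃ (C : Set M) (N : Opens M), IsClosed C ∧ C ∩ U ⊆ V ∧ (∀ x : U, (x : M) ∉ C → χ x = 0) ∧
    C ∩ U ⊆ N ∧ ∀ x : U, (x : M) ∈ N → ψ x = 1) ∧
  ∃ C : Set M, IsClosed C ∧ C ∩ U ⊆ V ∧ ∀ x : U, (x : M) ∉ C → ψ x = 0

theorem IsBumpPair.supp_left {χ ψ : Fn n U} (h : IsBumpPair χ ψ V) :
    ∃ C : Set M, IsClosed C ∧ C ∩ U ⊆ V ∧ ∀ x : U, (x : M) ∉ C → χ x = 0 := by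
  obtain ⟨⟨C, N, hC, hCV, h0, -⟩, -⟩ := h
  exact ⟨C, hC, hCV, h0⟩

theorem IsBumpPair.restrict {χ ψ : Fn n U} (h : IsBumpPair χ ψ V) {U' : Opens M} (hU : U' ≤ U) :
    IsBumpPair (Fn.res hU χ) (Fn.res hU ψ) (V ⊓ U') := by
  obtain ⟨⟨C, N, hC, hCV, h0, hN, h1⟩, C', hC', hCV', h0'⟩ := h
  exact ⟨⟨C, N, hC, fun x hx => ⟨hCV ⟨hx.1, hU hx.2⟩, hx.2⟩, fun x hx => h0 ⟨x, hU x.2⟩ hx,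
    fun x hx => hN ⟨hx.1, hU hx.2⟩, fun x hx => h1 ⟨x, hU x.2⟩ hx⟩, C', hC',
    fun x hx => ⟨hCV' ⟨hx.1, hU hx.2⟩, hx.2⟩, fun x hx => h0' ⟨x, hU x.2⟩ hx⟩

theorem CFields.mulFn_coe (f : Fn n U) (φ : CFields 𝓔 U) :
    (CFields.mulFn f φ).1 = Fields.mulFn f φ.1 := rfl

variable [T2Space M]

/-- Multiplication by a smooth function on `U` whose support is contained in `V` takes fields with
compact support in `U` to fields with compact support in `V`. -/
def CFields.cut (hV : V ≤ U) (f : Fn n U)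
    (hf : ∃ C : Set M, IsClosed C ∧ C ∩ U ⊆ V ∧ ∀ x : U, (x : M) ∉ C → f x = 0) :
    CFields 𝓔 U →ₗ[ℝ] CFields 𝓔 V :=
  ((Fields.res hV ∘ₗ Fields.mulFn f) ∘ₗ (CFields 𝓔 U).subtype).codRestrict _ fun φ => by
    obtain ⟨K, hK, hKU, hφ⟩ := φ.2
    obtain ⟨C, hC, hCV, hf⟩ := hf
    refine ⟨K ∩ C, hK.inter_right hC, fun x hx => hCV ⟨hx.2, hKU hx.1⟩, fun x hx i => ?_⟩
    change f ⟨x, hV x.2⟩ • φ.1.1 i ⟨x, hV x.2⟩ = 0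
    by_cases hxC : (x : M) ∈ C
    · rw [hφ ⟨x, hV x.2⟩ (fun hxK => hx ⟨hxK, hxC⟩), smul_zero]
    · rw [hf ⟨x, hV x.2⟩ hxC, zero_smul]

omit [T2Space M] in
theorem CFields.cut_apply (hV : V ≤ U) (f : Fn n U)
    (hf : ∃ C : Set M, IsClosed C ∧ C ∩ U ⊆ V ∧ ∀ x : U, (x : M) ∉ C → f x = 0)
    (φ : CFields 𝓔 U) (i : 𝓔.ι) (x : V) :
    (CFields.cut hV f hf φ).1.1 i x = f ⟨x, hV x.2⟩ • φ.1.1 i ⟨x, hV x.2⟩ := rfl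

theorem CFields.ext_cut (hV : V ≤ U) (f : Fn n U)
    (hf : ∃ C : Set M, IsClosed C ∧ C ∩ U ⊆ V ∧ ∀ x : U, (x : M) ∉ C → f x = 0)
    (φ : CFields 𝓔 U) : CFields.ext hV (CFields.cut hV f hf φ) = CFields.mulFn f φ := by
  apply Subtype.ext
  ext i x
  rw [CFields.ext_apply, CFields.mulFn_coe, Fields.mulFn_apply]
  by_cases hx : (x : M) ∈ V
  · rw [vecZext_of_mem _ hx, CFields.cut_apply]
  · obtain ⟨C, hC, hCV, hf⟩ := hf
    rw [vecZext_of_notMem _ hx, hf x fun hxC => hx (hCV ⟨hxC, x.2⟩), zero_smul]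

theorem CFields.cut_ext {U' : Opens M} (hV : V ≤ U) (hU : U' ≤ U) (f : Fn n U)
    (hf : ∃ C : Set M, IsClosed C ∧ C ∩ U ⊆ V ∧ ∀ x : U, (x : M) ∉ C → f x = 0)
    (hf' : ∃ C : Set M, IsClosed C ∧ C ∩ U' ⊆ (V ⊓ U' : Opens M) ∧
      ∀ x : U', (x : M) ∉ C → Fn.res hU f x = 0) (φ : CFields 𝓔 U') :
    CFields.cut hV f hf (CFields.ext hU φ) =
      CFields.ext inf_le_left (CFields.cut inf_le_right (Fn.res hU f) hf' φ) := by
  apply Subtype.ext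
  ext i x
  rw [CFields.cut_apply, CFields.ext_apply, CFields.ext_apply]
  by_cases hx : (x : M) ∈ U'
  · rw [vecZext_of_mem _ hx, vecZext_of_mem _ (show (x : M) ∈ V ⊓ U' from ⟨x.2, hx⟩),
      CFields.cut_apply]
    rfl
  · rw [vecZext_of_notMem _ hx,
      vecZext_of_notMem _ fun h : (x : M) ∈ V ⊓ U' => hx h.2, smul_zero]

/-- Extension of a functional `J` from `V` to `U` by means of a pair of bump functions:
`φ ↦ J(χ φ_0, ψ φ_1, …, ψ φ_k)`. -/
def Functional.spread (hV : V ≤ U) {χ ψ : Fn n U} (h : IsBumpPair χ ψ V)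
    (J : Functional 𝓔 (k + 1) V) : Functional 𝓔 (k + 1) U :=
  J.compLinearMap (Function.update (fun _ => CFields.cut hV ψ h.2) 0
    (CFields.cut hV χ h.supp_left))

omit [T2Space M] in
theorem Functional.spread_apply (hV : V ≤ U) {χ ψ : Fn n U} (h : IsBumpPair χ ψ V)
    (J : Functional 𝓔 (k + 1) V) (φ : Fin (k + 1) → CFields 𝓔 U) :
    Functional.spread hV h J φ =
      J (Function.update (fun a => CFields.cut hV ψ h.2 (φ a)) 0
        (CFields.cut hV χ h.supp_left (φ 0))) := by
  change J _ = J _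
  congr 1
  funext a
  by_cases ha : a = 0
  · subst ha
    simp only [Function.update_self]
  · simp only [Function.update_of_ne ha]

/-- For a functional supported on the diagonal, the factors `ψ` have no effect, since they are one
near the support of `χ φ_0`. -/
theorem Functional.spread_res (hV : V ≤ U) {χ ψ : Fn n U} (h : IsBumpPair χ ψ V)
    {I : Functional 𝓔 (k + 1) U} (hI : DiagonalSupport I) (φ : Fin (k + 1) → CFields 𝓔 U) :
    Functional.spread hV h (Functional.res hV I) φ =
      I (Function.update φ 0 (CFields.mulFn χ (φ 0))) := by
  rw [Functional.spread_apply, Functional.res_apply]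
  refine hI.congr fun x hx => ?_
  obtain ⟨⟨C, N, hC, hCV, h0, hN, h1⟩, -⟩ := id h
  by_cases hxC : x ∈ C
  · refine ⟨N, hN ⟨hxC, hx⟩, Or.inl fun a y hy i => ?_⟩
    by_cases ha : a = 0
    · subst ha
      simp only [Function.update_self]
      rw [CFields.ext_cut]
    · simp only [Function.update_of_ne ha]
      rw [CFields.ext_cut, CFields.mulFn_coe, Fields.mulFn_apply, h1 y hy, one_smul]
  · refine ⟨⟨Cᶜ, hC.isOpen_compl⟩, hxC, Or.inr fun y hy i => ?_⟩
    simp only [Function.update_self]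
    rw [CFields.ext_cut, CFields.mulFn_coe, Fields.mulFn_apply, h0 y hy, zero_smul]
    exact ⟨rfl, rfl⟩

/-! ### Partitions of unity and gluing -/

/-- A smooth partition of unity `χ` subordinate to a family of open sets, together with functions
`ψ i` which are equal to one near the support of `χ i`. -/
structure BumpPartition {ι : Type*} (U : Opens M) (N : ι → Opens M) where
  χ : ι → Fn n U
  ψ : ι → Fn n U
  pair : ∀ i, IsBumpPair (χ i) (ψ i) (N i)
  finite : ∀ K : Set M, IsCompact K → K ⊆ U → {i | ∃ x : U, (x : M) ∈ K ∧ χ i x ≠ 0}.Finite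
  sum_eq : ∀ x : U, ∑ᶠ i, χ i x = 1

namespace BumpPartition

variable {ι : Type*} {N : ι → Opens M}

/-- Restriction of a partition of unity to a smaller open set. -/
def restrict (p : BumpPartition (n := n) U N) {U' : Opens M} (hU : U' ≤ U) :
    BumpPartition (n := n) U' fun i => N i ⊓ U' where
  χ i := Fn.res hU (p.χ i)
  ψ i := Fn.res hU (p.ψ i)
  pair i := (p.pair i).restrict hU
  finite K hK hKU := (p.finite K hK (hKU.trans hU)).subset fun _ ⟨x, hx, h⟩ =>
    ⟨⟨x, hU x.2⟩, hx, h⟩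
  sum_eq x := p.sum_eq ⟨x, hU x.2⟩

omit [T2Space M] in
/-- The indices whose bump function meets the support of a field. -/
theorem exists_finset (p : BumpPartition (n := n) U N) (φ : CFields 𝓔 U) :
    ∃ S : Finset ι, (∀ i ∉ S, CFields.mulFn (p.χ i) φ = 0) ∧
      ∑ i ∈ S, CFields.mulFn (p.χ i) φ = φ := by
  obtain ⟨K, hK, hKU, hφ⟩ := φ.2
  have hfin := p.finite K hK hKU
  have h0 : ∀ i ∉ hfin.toFinset, ∀ x : U, (x : M) ∈ K → p.χ i x = 0 := by
    intro i hi x hx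
    by_contra h
    exact hi (hfin.mem_toFinset.2 ⟨x, hx, h⟩)
  refine ⟨hfin.toFinset, fun i hi => ?_, ?_⟩
  · apply Subtype.ext
    ext j x
    change p.χ i x • φ.1.1 j x = 0
    by_cases hx : (x : M) ∈ K
    · rw [h0 i hi x hx, zero_smul]
    · rw [hφ x hx, smul_zero]
  · apply Subtype.ext
    ext j x
    rw [Submodule.coe_sum, Submodule.coe_sum, Finset.sum_apply, Finset.sum_apply]
    change ∑ i ∈ _, p.χ i x • φ.1.1 j x = _
    rw [← Finset.sum_smul]
    by_cases hx : (x : M) ∈ K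
    · rw [← finsum_eq_sum_of_support_subset, p.sum_eq x, one_smul]
      intro i hi
      by_contra h
      exact hi (h0 i h x hx)
    · rw [hφ x hx, smul_zero]

omit [T2Space M] in
theorem functional_eq_finsum (p : BumpPartition (n := n) U N) (I : Functional 𝓔 (k + 1) U)
    (φ : Fin (k + 1) → CFields 𝓔 U) :
    I φ = ∑ᶠ i, I (Function.update φ 0 (CFields.mulFn (p.χ i) (φ 0))) := by
  obtain ⟨S, hS, hsum⟩ := p.exists_finset (φ 0)
  rw [finsum_eq_sum_of_support_subset (s := S)]
  · rw [← MultilinearMap.map_update_sum, hsum, Function.update_eq_self]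
  · intro i hi
    by_contra h
    refine hi ?_
    change I (Function.update φ 0 (CFields.mulFn (p.χ i) (φ 0))) = 0
    rw [hS i h, MultilinearMap.map_update_zero]

theorem finite_support_spread (p : BumpPartition (n := n) U N) (hN : ∀ i, N i ≤ U)
    (J : ∀ i, Functional 𝓔 (k + 1) (N i)) (φ : Fin (k + 1) → CFields 𝓔 U) :
    (Function.support fun i => Functional.spread (hN i) (p.pair i) (J i) φ).Finite := by
  obtain ⟨S, hS, -⟩ := p.exists_finset (φ 0)
  refine S.finite_toSet.subset fun i hi => ?_
  by_contra h
  refine hi ?_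
  change Functional.spread (hN i) (p.pair i) (J i) φ = 0
  rw [Functional.spread_apply]
  refine (J i).map_coord_zero 0 ?_
  rw [Function.update_self]
  have h1 := CFields.res_ext (hN i) (CFields.cut (hN i) (p.χ i) (p.pair i).supp_left (φ 0))
  rw [CFields.ext_cut, hS i h] at h1
  exact Subtype.ext h1.symm

/-- The functional `φ ↦ ∑ i, J_i(χ_i φ_0, ψ_i φ_1, …, ψ_i φ_k)` glued from functionals `J_i` on the
members of a cover. The sum is finite since the support of `φ_0` is compact. -/
def glue (p : BumpPartition (n := n) U N) (hN : ∀ i, N i ≤ U)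
    (J : ∀ i, Functional 𝓔 (k + 1) (N i)) : Functional 𝓔 (k + 1) U where
  toFun φ := ∑ᶠ i, Functional.spread (hN i) (p.pair i) (J i) φ
  map_update_add' φ a x y := by
    rw [← finsum_add_distrib (p.finite_support_spread hN J _) (p.finite_support_spread hN J _)]
    exact finsum_congr fun i => MultilinearMap.map_update_add _ _ _ _ _
  map_update_smul' φ a t x := by
    rw [smul_finsum' _ (p.finite_support_spread hN J _)]
    exact finsum_congr fun i => MultilinearMap.map_update_smul _ _ _ _ _

theorem glue_apply (p : BumpPartition (n := n) U N) (hN : ∀ i, N i ≤ U)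
    (J : ∀ i, Functional 𝓔 (k + 1) (N i)) (φ : Fin (k + 1) → CFields 𝓔 U) :
    p.glue hN J φ = ∑ᶠ i, Functional.spread (hN i) (p.pair i) (J i) φ := rfl

theorem diagonalSupport_glue (p : BumpPartition (n := n) U N) (hN : ∀ i, N i ≤ U)
    {J : ∀ i, Functional 𝓔 (k + 1) (N i)} (hJ : ∀ i, DiagonalSupport (J i)) :
    DiagonalSupport (p.glue hN J) := by
  intro φ hφ
  rw [glue_apply, finsum_congr, finsum_zero]
  intro i
  rw [Functional.spread_apply]
  refine hJ i _ fun x hx => ?_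
  obtain ⟨a, W, hxW, hW⟩ := hφ x (hN i hx)
  refine ⟨a, W, hxW, fun y hy j => ?_⟩
  by_cases ha : a = 0
  · subst ha
    rw [Function.update_self, CFields.cut_apply, hW ⟨y, hN i y.2⟩ hy, smul_zero]
  · rw [Function.update_of_ne ha, CFields.cut_apply, hW ⟨y, hN i y.2⟩ hy, smul_zero]

/-- The glued functional restricts to the given ones. -/
theorem res_glue (p : BumpPartition (n := n) U N) (hN : ∀ i, N i ≤ U)
    {J : ∀ i, Functional 𝓔 (k + 1) (N i)} (hJ : ∀ i, DiagonalSupport (J i))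
    (hJJ : ∀ i j, Functional.res (inf_le_left : N i ⊓ N j ≤ N i) (J i) =
      Functional.res (inf_le_right : N i ⊓ N j ≤ N j) (J j)) (j : ι) :
    Functional.res (hN j) (p.glue hN J) = J j := by
  refine MultilinearMap.ext fun φ => ?_
  -- decompose both sides by the partition of unity, and compare on `N i ∩ N j`
  rw [Functional.res_apply, glue_apply, (p.restrict (hN j)).functional_eq_finsum (J j) φ]
  refine finsum_congr fun i => ?_
  rw [← Functional.spread_res inf_le_right ((p.restrict (hN j)).pair i) (hJ j), ← hJJ i j,
    Functional.spread_apply, Functional.spread_apply, Functional.res_apply]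
  congr 1
  funext a
  by_cases ha : a = 0
  · subst ha
    simp only [Function.update_self]
    exact CFields.cut_ext _ _ _ _ _ _
  · simp only [Function.update_of_ne ha]
    exact CFields.cut_ext _ _ _ _ _ _

end BumpPartition

variable [SecondCountableTopology M] [IsManifold (𝓡∂ n) ∞ M]

theorem exists_bumpPartition {ι : Type*} (U : Opens M) (N : ι → Opens M)
    (hU : ∀ x ∈ U, ∃ i, x ∈ N i) : Nonempty (BumpPartition (n := n) U N) := by
  have : LocallyCompactSpace M := Manifold.locallyCompact_of_finiteDimensional (𝓡∂ n)
  have : LocallyCompactSpace U := U.isOpen.locallyCompactSpace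
  obtain ⟨f, hf⟩ := SmoothPartitionOfUnity.exists_isSubordinate (𝓡∂ n) (M := U) isClosed_univ
    (fun i => ((↑) : U → M) ⁻¹' N i) (fun i => (N i).isOpen.preimage continuous_subtype_val)
    (fun x _ => mem_iUnion.2 (hU x x.2))
  have hψ : ∀ i, ∃ (ψ : Fn n U) (t : Set U), IsClosed t ∧ t ⊆ ((↑) : U → M) ⁻¹' N i ∧
      (∀ᶠ x in 𝓝ˢ (tsupport (f i)), ψ x = 1) ∧ ∀ x ∉ t, ψ x = 0 := by
    intro i
    obtain ⟨v, hv, hfv, hvN⟩ := normal_exists_closure_subset (isClosed_tsupport (f i))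
      ((N i).isOpen.preimage continuous_subtype_val) (hf i)
    obtain ⟨ψ, h1, h0, -⟩ := exists_contMDiffMap_one_nhds_of_subset_interior (𝓡∂ n) (n := ⊤)
      (isClosed_tsupport (f i)) (hfv.trans (interior_maximal subset_closure hv))
    exact ⟨⟨ψ, ψ.contMDiff⟩, closure v, isClosed_closure, hvN, h1, h0⟩
  choose ψ t ht htN hψ1 hψ0 using hψ
  refine ⟨⟨fun i => ⟨f i, (f i).contMDiff⟩, ψ, fun i => ⟨?_, ?_⟩, fun K hK hKU => ?_, fun x => ?_⟩⟩
  · obtain ⟨C, hC, hCf⟩ := isClosed_induced_iff.1 (isClosed_tsupport (f i))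
    obtain ⟨O, hO, hfO, hO1⟩ := eventually_nhdsSet_iff_exists.1 (hψ1 i)
    obtain ⟨O', hO', rfl⟩ := isOpen_induced_iff.1 hO
    have hmem : ∀ x : U, (x : M) ∈ C ↔ x ∈ tsupport (f i) := fun x => by rw [← hCf]; rfl
    exact ⟨C, ⟨O', hO'⟩, hC, fun x hx => hf i ((hmem ⟨x, hx.2⟩).1 hx.1),
      fun x hx => image_eq_zero_of_notMem_tsupport fun h => hx ((hmem x).2 h),
      fun x hx => hfO ((hmem ⟨x, hx.2⟩).1 hx.1), fun x hx => hO1 x hx⟩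
  · obtain ⟨C, hC, hCt⟩ := isClosed_induced_iff.1 (ht i)
    have hmem : ∀ x : U, (x : M) ∈ C ↔ x ∈ t i := fun x => by rw [← hCt]; rfl
    exact ⟨C, hC, fun x hx => htN i ((hmem ⟨x, hx.2⟩).1 hx.1),
      fun x hx => hψ0 i x fun h => hx ((hmem x).2 h)⟩
  · have hK' : IsCompact (((↑) : U → M) ⁻¹' K) := by
      rw [Subtype.isCompact_iff]
      have himage : ((↑) : U → M) '' (((↑) : U → M) ⁻¹' K) = K :=
        image_preimage_eq_of_subset fun x hx => ⟨(⟨x, hKU hx⟩ : U), rfl⟩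
      exact himage.symm ▸ hK
    refine (f.locallyFinite.finite_nonempty_inter_compact hK').subset ?_
    rintro i ⟨x, hx, h⟩
    exact ⟨x, h, hx⟩
  · exact f.sum_eq_one (mem_univ x)

/-- A functional supported on the diagonal which vanishes locally is zero. -/
theorem DiagonalSupport.eq_zero_of_local {I : Functional 𝓔 (k + 1) U} (hI : DiagonalSupport I)
    (h : ∀ x ∈ U, ∃ (V : Opens M) (hV : V ≤ U), x ∈ V ∧ Functional.res hV I = 0) : I = 0 := by
  choose! N hN hxN hNI using h
  obtain ⟨p⟩ := exists_bumpPartition (n := n) U (fun x : U => N x)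
    fun x hx => ⟨⟨x, hx⟩, hxN x hx⟩
  refine MultilinearMap.ext fun φ => ?_
  rw [p.functional_eq_finsum I φ, finsum_congr, finsum_zero]
  · rfl
  intro x
  rw [← Functional.spread_res (hN x x.2) (p.pair x) hI, hNI x x.2]
  rfl

end Diagonal

/-! ### Local functionals form a sheaf -/

section Sheaf

open Set

variable {n : ℕ} [NeZero n] {M : Type u} [TopologicalSpace M] [T2Space M]
  [ChartedSpace (EuclideanHalfSpace n) M] {𝓔 : GradedBundle n M} {k : ℕ} {U V : Opens M}

theorem Functional.res_res {W : Opens M} (h : V ≤ U) (h' : W ≤ V) (I : Functional 𝓔 k U) :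
    Functional.res h' (Functional.res h I) = Functional.res (h'.trans h) I := by
  refine MultilinearMap.ext fun φ => ?_
  simp only [Functional.res_apply, CFields.ext_ext]

theorem CFields.ext_proj (h : V ≤ U) (i : 𝓔.ι) (φ : CFields 𝓔 V) :
    CFields.ext h (CFields.proj i φ) = CFields.proj i (CFields.ext h φ) := by
  apply Subtype.ext
  ext j x
  rw [CFields.ext_apply, CFields.proj_coe, CFields.proj_coe, Fields.proj_coe, Fields.proj_coe]
  by_cases hj : j = i
  · subst hj
    rw [Pi.single_eq_same, Pi.single_eq_same, CFields.ext_apply]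
  · rw [Pi.single_eq_of_ne hj, Pi.single_eq_of_ne hj]
    simp [vecZext]

theorem Functional.res_twist (h : V ≤ U) (σ : Equiv.Perm (Fin k)) (ε : (Fin k → 𝓔.ι) → ℤˣ)
    (I : Functional 𝓔 k U) :
    Functional.res h (twist CFields.proj σ ε I) = twist CFields.proj σ ε (Functional.res h I) := by
  refine MultilinearMap.ext fun φ => ?_
  simp only [Functional.res_apply, twist_apply, CFields.ext_proj]

omit [T2Space M] in
/-- Graded symmetry of a functional as invariance under the exchange of two arguments. -/
theorem twist_eq_self_iff (a b : Fin k) (I : Functional 𝓔 k U) :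
    twist CFields.proj (Equiv.swap a b) (koszul 𝓔.deg a b) I = I ↔
      ∀ (p q : ℤ) (φ : Fin k → CFields 𝓔 U), IsHomogeneous p (φ a).1 → IsHomogeneous q (φ b).1 →
        I (φ ∘ Equiv.swap a b) = ((p * q).negOnePow : ℤ) • I φ := by
  rw [twist_swap_eq_self_iff CFields.proj_mul_proj CFields.sum_proj]
  simp only [isHomogeneous_iff, CFields.proj_eq_zero_iff]

omit [T2Space M] in
theorem DiagonalSupport.sub {I J : Functional 𝓔 (k + 1) U} (hI : DiagonalSupport I)
    (hJ : DiagonalSupport J) : DiagonalSupport (I - J) := fun φ hφ => by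
  change I φ - J φ = 0
  rw [hI φ hφ, hJ φ hφ, sub_zero]

omit [T2Space M] in
theorem DiagonalSupport.twist {I : Functional 𝓔 (k + 1) U} (hI : DiagonalSupport I)
    (σ : Equiv.Perm (Fin (k + 1))) (ε : (Fin (k + 1) → 𝓔.ι) → ℤˣ) :
    DiagonalSupport (BoundaryDMod.twist CFields.proj σ ε I) := by
  intro φ hφ
  rw [twist_apply]
  refine Finset.sum_eq_zero fun s _ => ?_
  rw [hI _ fun x hx => ?_, smul_zero]
  obtain ⟨a, W, hxW, hW⟩ := hφ x hx
  refine ⟨σ.symm a, W, hxW, fun y hy i => ?_⟩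
  rw [Equiv.apply_symm_apply, CFields.proj_coe, Fields.proj_coe]
  by_cases hi : i = s a
  · subst hi
    rw [Pi.single_eq_same, hW y hy]
  · rw [Pi.single_eq_of_ne hi]
    rfl

variable [SecondCountableTopology M] [IsManifold (𝓡∂ n) ∞ M]

theorem DiagonalSupport.eq_of_local {I J : Functional 𝓔 (k + 1) U} (hI : DiagonalSupport I)
    (hJ : DiagonalSupport J)
    (h : ∀ x ∈ U, ∃ (V : Opens M) (hV : V ≤ U), x ∈ V ∧
      Functional.res hV I = Functional.res hV J) : I = J := by
  refine sub_eq_zero.1 ((hI.sub hJ).eq_zero_of_local fun x hx => ?_)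
  obtain ⟨V, hV, hxV, h⟩ := h x hx
  refine ⟨V, hV, hxV, MultilinearMap.ext fun φ => ?_⟩
  exact sub_eq_zero.2 (congrArg (fun L => L φ) h)

/-- Compatible local functionals on the members of an open cover can be glued. -/
theorem LocalFunctional.exists_glue {ι : Type*} (N : ι → Opens M) (hN : ∀ i, N i ≤ U)
    (hU : ∀ x ∈ U, ∃ i, x ∈ N i) (J : ∀ i, LocalFunctional 𝓔 k (N i))
    (hJ : ∀ i j, Functional.res (inf_le_left : N i ⊓ N j ≤ N i) (J i).1 =
      Functional.res (inf_le_right : N i ⊓ N j ≤ N j) (J j).1) :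
    ∃ I : LocalFunctional 𝓔 k U, ∀ i, Functional.res (hN i) I.1 = (J i).1 := by
  obtain ⟨p⟩ := exists_bumpPartition (n := n) U N hU
  have hdiag : ∀ i, DiagonalSupport (J i).1 := fun i => (J i).2.2.1
  have hres := p.res_glue hN hdiag hJ
  have hglue := p.diagonalSupport_glue hN hdiag
  refine ⟨⟨p.glue hN fun i => (J i).1, fun a b hab => ?_, hglue, fun x hx => ?_⟩, hres⟩
  · -- graded symmetry can be checked locally
    rw [← twist_eq_self_iff]
    refine (hglue.twist _ _).eq_of_local hglue fun x hx => ?_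
    obtain ⟨i, hi⟩ := hU x hx
    refine ⟨N i, hN i, hi, ?_⟩
    rw [Functional.res_twist, hres, twist_eq_self_iff]
    exact (J i).2.1 a b hab
  · obtain ⟨i, hi⟩ := hU x hx
    obtain ⟨V, hV, hxV, h⟩ := (J i).2.2.2 x hi
    refine ⟨V, hV.trans (hN i), hxV, ?_⟩
    rwa [← Functional.res_res (hN i) hV, hres]

open CategoryTheory Opposite

theorem isSheaf_localFunctionals (𝓔 : GradedBundle n M) :
    Presheaf.IsSheaf (Opens.grothendieckTopology M) (localFunctionals 𝓔) := by
  refine (TopCat.Presheaf.isSheaf_iff_isSheafUniqueGluing (X := TopCat.of M)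
    (localFunctionals 𝓔)).2 ?_
  intro ι N (J : ∀ i, ∀ k : ℕ, LocalFunctional 𝓔 k (N i)) hJ
  have hJ' : ∀ k i j, Functional.res (inf_le_left : N i ⊓ N j ≤ N i) (J i k).1 =
      Functional.res (inf_le_right : N i ⊓ N j ≤ N j) (J j k).1 := fun k i j =>
    congrArg Subtype.val (congrFun (hJ i j) k)
  have hN : ∀ i, N i ≤ iSup N := le_iSup N
  have hU : ∀ x ∈ iSup N, ∃ i, x ∈ N i := fun x hx => Opens.mem_iSup.1 hx
  choose I hI using fun k => LocalFunctional.exists_glue N hN hU (fun i => J i k) (hJ' k)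
  refine ⟨I, fun i => funext fun k => Subtype.ext (hI k i), ?_⟩
  intro (I' : ∀ k : ℕ, LocalFunctional 𝓔 k (iSup N)) hI'
  funext k
  have hd : ∀ L : LocalFunctional 𝓔 k (iSup N), DiagonalSupport L.1 := fun L => L.2.2.1
  refine Subtype.ext ((hd (I' k)).eq_of_local (hd (I k)) fun x hx => ?_)
  obtain ⟨i, hi⟩ := hU x hx
  refine ⟨N i, hN i, hi, ?_⟩
  rw [hI k i]
  exact congrArg Subtype.val (congrFun (hI' i) k)

end Sheaf

/-! ### Functionals given by densities and polydifferential operators -/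

section Pairing

open Set

variable {n : ℕ} [NeZero n] {M : Type u} [TopologicalSpace M] [T2Space M]
  [ChartedSpace (EuclideanHalfSpace n) M] {𝓔 : GradedBundle n M} {k : ℕ} {U V : Opens M}

/-- The functional `φ ↦ T(P(φ))` of a distribution `T` and a polydifferential operator `P`. -/
def pairing (T : Distribution n U) (P : PolyDiffOp 𝓔 (k + 1) U) : Functional 𝓔 (k + 1) U where
  toFun φ := T.1 (P.testFn φ)
  map_update_add' φ a x y := by
    have h : ∀ z : CFields 𝓔 U, (fun b => (Function.update φ a z b).1) =
        Function.update (fun b => (φ b).1) a z.1 := fun z => by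
      funext b
      by_cases hb : b = a
      · subst hb
        simp only [Function.update_self]
      · simp only [Function.update_of_ne hb]
    rw [← map_add]
    congr 1
    apply Subtype.ext
    change P.app _ = P.app _ + P.app _
    rw [h, h, h]
    exact MultilinearMap.map_update_add _ _ _ _ _
  map_update_smul' φ a t x := by
    have h : ∀ z : CFields 𝓔 U, (fun b => (Function.update φ a z b).1) =
        Function.update (fun b => (φ b).1) a z.1 := fun z => by
      funext b
      by_cases hb : b = a
      · subst hb
        simp only [Function.update_self]
      · simp only [Function.update_of_ne hb]
    rw [← map_smul]
    congr 1
    apply Subtype.ext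
    change P.app _ = t • P.app _
    rw [h, h]
    exact MultilinearMap.map_update_smul _ _ _ _ _

theorem pairing_apply (T : Distribution n U) (P : PolyDiffOp 𝓔 (k + 1) U)
    (φ : Fin (k + 1) → CFields 𝓔 U) : pairing T P φ = T.1 (P.testFn φ) := rfl

theorem res_pairing (h : V ≤ U) (T : Distribution n U) (P : PolyDiffOp 𝓔 (k + 1) U) :
    Functional.res h (pairing T P) = pairing (Distribution.res h T) (PolyDiffOp.res h P) := by
  refine MultilinearMap.ext fun φ => ?_
  rw [Functional.res_apply, pairing_apply, PolyDiffOp.testFn_ext]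
  rfl

theorem pairing_rmul (T : Distribution n U) (D : DiffOp n U) (P : PolyDiffOp 𝓔 (k + 1) U) :
    pairing (T.rmul D) P = pairing T (PolyDiffOp.lmul D P) := rfl

theorem pairing_add (T : Distribution n U) (P Q : PolyDiffOp 𝓔 (k + 1) U) :
    pairing T (P + Q) = pairing T P + pairing T Q :=
  MultilinearMap.ext fun φ => map_add T.1 (P.testFn φ) (Q.testFn φ)

theorem pairing_smul (T : Distribution n U) (t : ℝ) (P : PolyDiffOp 𝓔 (k + 1) U) :
    pairing T (t • P) = t • pairing T P :=
  MultilinearMap.ext fun φ => map_smul T.1 t (P.testFn φ)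

theorem pairing_sum {ι : Type*} (s : Finset ι) (T : Distribution n U)
    (P : ι → PolyDiffOp 𝓔 (k + 1) U) : pairing T (∑ i ∈ s, P i) = ∑ i ∈ s, pairing T (P i) := by
  refine MultilinearMap.ext fun φ => ?_
  rw [pairing_apply, PolyDiffOp.testFn_sum, map_sum, sum_apply]
  rfl

theorem diagonalSupport_pairing (T : Distribution n U) (P : PolyDiffOp 𝓔 (k + 1) U) :
    DiagonalSupport (pairing T P) := by
  intro φ hφ
  rw [pairing_apply]
  suffices h : P.testFn φ = 0 by rw [h, map_zero]
  apply Subtype.ext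
  ext x
  obtain ⟨a, W, hxW, hW⟩ := hφ x x.2
  exact P.app_eq_zero (K := (W : Set M)ᶜ) W.isOpen.isClosed_compl a
    (fun y hy i => hW y (not_not.1 hy) i) x (not_not.2 hxW)

end Pairing

/-! ### Products of differential operators -/

section Prod

variable {n : ℕ} [NeZero n] {M : Type u} [TopologicalSpace M]
  [ChartedSpace (EuclideanHalfSpace n) M] {𝓔 : GradedBundle n M} {k : ℕ} {U V W : Opens M}

/-- The product `φ ↦ ∏ a, L a (φ a)` of linear maps. -/
def MultiOp.prod (L : Fin k → MultiOp 𝓔 1 W) : MultiOp 𝓔 k W :=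
  (MultilinearMap.mkPiAlgebra ℝ (Fin k) (Fn n W)).compLinearMap fun a =>
    (MultilinearMap.ofSubsingleton ℝ (Fields 𝓔 W) (Fn n W) (0 : Fin 1)).symm (L a)

theorem MultiOp.prod_apply (L : Fin k → MultiOp 𝓔 1 W) (φ : Fin k → Fields 𝓔 W) :
    MultiOp.prod L φ = ∏ a, L a fun _ => φ a := rfl

theorem HasOrderLTAt.prod {a : Fin k} {r : ℕ} {L : Fin k → MultiOp 𝓔 1 W}
    (h : HasOrderLTAt 0 r (L a)) : HasOrderLTAt a r (MultiOp.prod L) := by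
  induction r generalizing L with
  | zero =>
    refine MultilinearMap.ext fun φ => ?_
    rw [MultiOp.prod_apply]
    refine Finset.prod_eq_zero (Finset.mem_univ a) ?_
    rw [show L a = 0 from h]
    rfl
  | succ r ih =>
    intro f
    have key : slotComm a f (MultiOp.prod L) =
        MultiOp.prod (Function.update L a (slotComm 0 f (L a))) := by
      refine MultilinearMap.ext fun φ => ?_
      have h1 : ∀ b ∈ Finset.univ.erase a, (L b fun _ => Function.update φ a
          (Fields.mulFn f (φ a)) b) = L b fun _ => φ b := fun b hb => by
        rw [Function.update_of_ne (Finset.ne_of_mem_erase hb)]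
      have h2 : ∀ b ∈ Finset.univ.erase a, (Function.update L a (slotComm 0 f (L a)) b
          fun _ => φ b) = L b fun _ => φ b := fun b hb => by
        rw [Function.update_of_ne (Finset.ne_of_mem_erase hb)]
      have h3 : slotComm 0 f (L a) (fun _ => φ a) =
          f * L a (fun _ => φ a) - L a fun _ => Fields.mulFn f (φ a) := by
        rw [slotComm_apply]
        congr 2
        funext b
        rw [Subsingleton.elim b 0, Function.update_self]
      rw [slotComm_apply, MultiOp.prod_apply, MultiOp.prod_apply, MultiOp.prod_apply,
        ← Finset.mul_prod_erase _ _ (Finset.mem_univ a),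
        ← Finset.mul_prod_erase _ (fun b => L b fun _ => Function.update φ a _ b)
          (Finset.mem_univ a),
        ← Finset.mul_prod_erase _ (fun b => Function.update L a _ b fun _ => φ b)
          (Finset.mem_univ a), Finset.prod_congr rfl h1, Finset.prod_congr rfl h2,
        Function.update_self, Function.update_self, h3, sub_mul, mul_assoc]
    rw [key]
    refine ih ?_
    rw [Function.update_self]
    exact h f

/-- The product of differential operators in one argument. -/
def PolyDiffOp.prod (D : Fin k → PolyDiffOp 𝓔 1 V) : PolyDiffOp 𝓔 k V :=
  ⟨fun W => MultiOp.prod fun a => (D a).1 W, fun W' W h φ => by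
      rw [MultiOp.prod_apply, MultiOp.prod_apply]
      refine Eq.trans ?_ (map_prod (ContMDiffMap.restrictRingHom (n := ∞) (𝓡∂ n) 𝓘(ℝ, ℝ) ℝ h) _ _).symm
      exact Finset.prod_congr rfl fun a _ => (D a).2.1 W' W h fun _ => φ a, fun x hx => by
      choose N hN r hr using fun a => (D a).2.2 x hx
      refine ⟨Finset.univ.inf N, ?_, Finset.univ.sup r, fun W hW a => ?_⟩
      · rw [← SetLike.mem_coe, Opens.coe_finset_inf]
        simpa using hN
      · exact HasOrderLTAt.prod ((hr a W (hW.trans (Finset.inf_le (Finset.mem_univ a))) 0).mono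
          (Finset.le_sup (Finset.mem_univ a)))⟩

variable [T2Space M]

theorem exists_eq_pairing_of_mem_basicLocal {I : Functional 𝓔 (k + 1) U}
    (hI : I ∈ basicLocal 𝓔 k U) : ∃ (μ : Distribution n U) (P : PolyDiffOp 𝓔 (k + 1) U),
      IsSmoothDensity μ ∧ I = pairing μ P := by
  obtain ⟨μ, D, hμ, h⟩ := hI
  refine ⟨μ, PolyDiffOp.prod D, hμ, MultilinearMap.ext fun φ => ?_⟩
  obtain ⟨g, hg, hI⟩ := h φ
  rw [hI, pairing_apply]
  congr 1
  exact Subtype.ext hg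

theorem pairing_prod_mem_basicLocal {μ : Distribution n U} (hμ : IsSmoothDensity μ)
    (D : Fin (k + 1) → PolyDiffOp 𝓔 1 U) : pairing μ (PolyDiffOp.prod D) ∈ basicLocal 𝓔 k U :=
  ⟨μ, D, hμ, fun φ => ⟨(PolyDiffOp.prod D).testFn φ, rfl, rfl⟩⟩

end Prod

/-! ### Extension of polydifferential operators by zero -/

section Extend

open Set

variable {n : ℕ} [NeZero n] {M : Type u} [TopologicalSpace M]
  [ChartedSpace (EuclideanHalfSpace n) M] {𝓔 : GradedBundle n M} {k : ℕ} {U V : Opens M}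

/-- Multiplication by a function `ψ` on `U` whose support is contained in `V`, followed by
extension by zero from `W ∩ V` to `W`. -/
def Fn.extend (ψ : Fn n U)
    (hψ : ∃ C : Set M, IsClosed C ∧ C ∩ U ⊆ V ∧ ∀ x : U, (x : M) ∉ C → ψ x = 0)
    (W : Set.Iic U) : Fn n (W.1 ⊓ V) →ₗ[ℝ] Fn n W.1 where
  toFun g := Fn.mk' (fun y => Fn.zext ψ y * Fn.zext g y) fun x hx => by
    by_cases hxV : x ∈ V
    · exact (Fn.zext_contMDiffAt ψ (iic_le W hx)).mul (Fn.zext_contMDiffAt g ⟨hx, hxV⟩)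
    · obtain ⟨C, hC, hCV, h0⟩ := hψ
      refine (contMDiffAt_const (c := (0 : ℝ))).congr_of_eventuallyEq ?_
      filter_upwards [hC.isOpen_compl.mem_nhds fun h => hxV (hCV ⟨h, iic_le W hx⟩),
        U.isOpen.mem_nhds (iic_le W hx)] with y hy hyU
      rw [Fn.zext_of_mem ψ hyU, h0 ⟨y, hyU⟩ hy, zero_mul]
  map_add' f g := by
    ext x
    change Fn.zext ψ x * Fn.zext (f + g) x =
      Fn.zext ψ x * Fn.zext f x + Fn.zext ψ x * Fn.zext g x
    rw [Fn.zext_add]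
    exact mul_add _ _ _
  map_smul' t g := by
    ext x
    change Fn.zext ψ x * Fn.zext (t • g) x = t * (Fn.zext ψ x * Fn.zext g x)
    rw [Fn.zext_smul]
    exact mul_left_comm _ _ _

theorem Fn.extend_mul {ψ : Fn n U}
    (hψ : ∃ C : Set M, IsClosed C ∧ C ∩ U ⊆ V ∧ ∀ x : U, (x : M) ∉ C → ψ x = 0)
    (W : Set.Iic U) (f : Fn n W.1) (g : Fn n (W.1 ⊓ V)) :
    Fn.extend ψ hψ W (Fn.res (inf_le_left : W.1 ⊓ V ≤ W.1) f * g) = f * Fn.extend ψ hψ W g := by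
  ext x
  change Fn.zext ψ x * Fn.zext (Fn.res (inf_le_left : W.1 ⊓ V ≤ W.1) f * g) x =
    f x * (Fn.zext ψ x * Fn.zext g x)
  by_cases hx : (x : M) ∈ V
  · have hx' : (x : M) ∈ W.1 ⊓ V := ⟨x.2, hx⟩
    rw [Fn.zext_of_mem _ hx', Fn.zext_of_mem g hx']
    exact mul_left_comm _ _ _
  · have hx' : (x : M) ∉ W.1 ⊓ V := fun h => hx h.2
    rw [Fn.zext_of_notMem _ hx', Fn.zext_of_notMem g hx', mul_zero, mul_zero]

theorem HasOrderLTAt.extend {ψ : Fn n U}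
    (hψ : ∃ C : Set M, IsClosed C ∧ C ∩ U ⊆ V ∧ ∀ x : U, (x : M) ∉ C → ψ x = 0)
    (W : Set.Iic U) {a : Fin k} {r : ℕ} {P : MultiOp 𝓔 k (W.1 ⊓ V)} (h : HasOrderLTAt a r P) :
    HasOrderLTAt a r ((Fn.extend ψ hψ W).compMultilinearMap
      (P.compLinearMap fun _ => Fields.res inf_le_left)) := by
  induction r generalizing P with
  | zero =>
    rw [show P = 0 from h]
    exact MultilinearMap.ext fun φ => map_zero (Fn.extend ψ hψ W)
  | succ r ih =>
    intro f
    convert ih (h (Fn.res inf_le_left f)) using 1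
    refine MultilinearMap.ext fun φ => ?_
    change slotComm a f _ φ = Fn.extend ψ hψ W (slotComm a _ P fun b => Fields.res _ (φ b))
    rw [slotComm_apply, slotComm_apply, map_sub, Fn.extend_mul]
    change f * Fn.extend ψ hψ W (P _) - Fn.extend ψ hψ W (P _) = _
    congr 3
    exact (Fields.res_update inf_le_left φ a (Fields.mulFn f (φ a))).symm

namespace PolyDiffOp

/-- Multiplication of the values of a polydifferential operator on `V` by a function on `U` whose
support is contained in `V`, followed by extension by zero. -/
def extend (ψ : Fn n U)
    (hψ : ∃ C : Set M, IsClosed C ∧ C ∩ U ⊆ V ∧ ∀ x : U, (x : M) ∉ C → ψ x = 0)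
    (P : PolyDiffOp 𝓔 k V) : PolyDiffOp 𝓔 k U :=
  ⟨fun W => (Fn.extend ψ hψ W).compMultilinearMap
      ((P.1 ⟨W.1 ⊓ V, mem_Iic.2 inf_le_right⟩).compLinearMap fun _ => Fields.res inf_le_left), by
    intro W' W h φ
    ext x
    change Fn.zext ψ x * Fn.zext (P.1 ⟨W'.1 ⊓ V, mem_Iic.2 inf_le_right⟩ _) x =
      Fn.zext ψ x * Fn.zext (P.1 ⟨W.1 ⊓ V, mem_Iic.2 inf_le_right⟩ _) x
    by_cases hx : (x : M) ∈ V
    · rw [Fn.zext_of_mem _ (show (x : M) ∈ W'.1 ⊓ V from ⟨x.2, hx⟩),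
        Fn.zext_of_mem _ (show (x : M) ∈ W.1 ⊓ V from ⟨h x.2, hx⟩)]
      have h1 := P.2.1 ⟨W'.1 ⊓ V, mem_Iic.2 inf_le_right⟩ ⟨W.1 ⊓ V, mem_Iic.2 inf_le_right⟩ (inf_le_inf_right V h)
        fun a => Fields.res inf_le_left (φ a)
      have h2 := congrArg (fun f : Fn n (W'.1 ⊓ V) => f ⟨x, x.2, hx⟩) h1
      exact congrArg (Fn.zext ψ x * ·) h2
    · rw [Fn.zext_of_notMem _ fun h : (x : M) ∈ W'.1 ⊓ V => hx h.2,
        Fn.zext_of_notMem _ fun h : (x : M) ∈ W.1 ⊓ V => hx h.2], by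
    intro x hx
    by_cases hxV : x ∈ V
    · obtain ⟨N, hxN, r, hr⟩ := P.2.2 x hxV
      exact ⟨N, hxN, r, fun W hW a => HasOrderLTAt.extend hψ W
        (hr ⟨W.1 ⊓ V, mem_Iic.2 inf_le_right⟩ (le_trans inf_le_left hW) a)⟩
    · obtain ⟨C, hC, hCV, h0⟩ := id hψ
      refine ⟨⟨Cᶜ, hC.isOpen_compl⟩, fun h => hxV (hCV ⟨h, hx⟩), 0, fun W hW a => ?_⟩
      refine MultilinearMap.ext fun φ => ?_
      ext y
      change Fn.zext ψ y * _ = 0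
      rw [Fn.zext_of_mem ψ (iic_le W y.2), h0 _ (hW y.2), zero_mul]⟩

theorem extend_val (ψ : Fn n U)
    (hψ : ∃ C : Set M, IsClosed C ∧ C ∩ U ⊆ V ∧ ∀ x : U, (x : M) ∉ C → ψ x = 0)
    (P : PolyDiffOp 𝓔 k V) (W : Set.Iic U) (φ : Fin k → Fields 𝓔 W.1) (x : W.1) :
    (extend ψ hψ P).1 W φ x = Fn.zext ψ x *
      Fn.zext (P.1 ⟨W.1 ⊓ V, mem_Iic.2 inf_le_right⟩ fun a => Fields.res inf_le_left (φ a)) x := rfl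

/-- Multiplication of the first argument by a smooth function. -/
def precompMul (χ : Fn n V) (P : PolyDiffOp 𝓔 (k + 1) V) : PolyDiffOp 𝓔 (k + 1) V :=
  lmul (Fn.mulOp χ) P - comm 0 χ P

theorem precompMul_val (χ : Fn n V) (P : PolyDiffOp 𝓔 (k + 1) V) (W : Set.Iic V)
    (φ : Fin (k + 1) → Fields 𝓔 W.1) : (precompMul χ P).1 W φ =
      P.1 W (Function.update φ 0 (Fields.mulFn (Fn.res W.2 χ) (φ 0))) := by
  change (lmul (Fn.mulOp χ) P).1 W φ - (comm 0 χ P).1 W φ = _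
  rw [lmul_val, comm_val, slotComm_apply]
  exact sub_sub_cancel _ _

/-- The value of a polydifferential operator at a point depends only on the restrictions of the
arguments to a neighbourhood of the point. -/
theorem val_congr (P : PolyDiffOp 𝓔 k V) {W₁ W₂ : Set.Iic V} {W : Opens M} (h₁ : W ≤ W₁.1)
    (h₂ : W ≤ W₂.1) {φ₁ : Fin k → Fields 𝓔 W₁.1} {φ₂ : Fin k → Fields 𝓔 W₂.1}
    (h : ∀ a, Fields.res h₁ (φ₁ a) = Fields.res h₂ (φ₂ a)) (x : W) :
    P.1 W₁ φ₁ ⟨x, h₁ x.2⟩ = P.1 W₂ φ₂ ⟨x, h₂ x.2⟩ := by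
  have e₁ := P.2.1 ⟨W, h₁.trans (iic_le W₁)⟩ W₁ h₁ φ₁
  have e₂ := P.2.1 ⟨W, h₁.trans (iic_le W₁)⟩ W₂ h₂ φ₂
  rw [funext h] at e₁
  exact congrArg (fun f : Fn n W => f x) (e₁.symm.trans e₂)

variable [T2Space M]

/-- Spreading a functional given by a polydifferential operator amounts to extending the
operator. -/
theorem spread_pairing (hV : V ≤ U) {χ ψ : Fn n U} (h : IsBumpPair χ ψ V) (T : Distribution n U)
    (P : PolyDiffOp 𝓔 (k + 1) V) :
    Functional.spread hV h (pairing (Distribution.res hV T) P) =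
      pairing T (extend ψ h.2 (precompMul (Fn.res hV χ) P)) := by
  refine MultilinearMap.ext fun φ => ?_
  rw [Functional.spread_apply, pairing_apply, pairing_apply, Distribution.res_apply]
  congr 1
  apply Subtype.ext
  ext x
  refine Eq.trans ?_ (extend_val ψ h.2 _ ⟨U, le_refl U⟩ (fun a => (φ a).1) x).symm
  rw [TestFn.ext_apply, Fn.zext_of_mem ψ x.2]
  by_cases hx : (x : M) ∈ V
  · rw [Fn.zext_of_mem _ hx, Fn.zext_of_mem _ (show (x : M) ∈ U ⊓ V from ⟨x.2, hx⟩),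
      precompMul_val]
    obtain ⟨⟨C, N, hC, hCV, h0, hN, h1⟩, -⟩ := id h
    -- near the support of `χ` the factors `ψ` are one, away from it both sides vanish
    by_cases hxC : (x : M) ∈ C
    · have hxN := hN ⟨hxC, x.2⟩
      rw [show ψ ⟨x, x.2⟩ = 1 from h1 x hxN, one_mul]
      refine P.val_congr (W₁ := ⟨V, le_refl V⟩) (W₂ := ⟨U ⊓ V, mem_Iic.2 inf_le_right⟩) (W := V ⊓ N)
        inf_le_left (le_inf (inf_le_left.trans hV) inf_le_left) (fun a => ?_) ⟨x, hx, hxN⟩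
      ext i y
      by_cases ha : a = 0
      · subst ha
        simp only [Function.update_self]
        rfl
      · simp only [Function.update_of_ne ha]
        change ψ ⟨y, _⟩ • (φ a).1.1 i ⟨y, _⟩ = (φ a).1.1 i ⟨y, _⟩
        rw [h1 _ y.2.2, one_smul]
    · have hz : ∀ (W : Set.Iic V) (ξ : Fin (k + 1) → Fields 𝓔 W.1) (hxW : (x : M) ∈ W.1),
          (∀ (i : 𝓔.ι) (y : W.1), (y : M) ∉ C → (ξ 0).1 i y = 0) → P.1 W ξ ⟨x, hxW⟩ = 0 := by
        intro W ξ hxW hξ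
        have e := P.val_congr (W₁ := W) (W₂ := W) (W := W.1 ⊓ ⟨Cᶜ, hC.isOpen_compl⟩) inf_le_left
          inf_le_left (φ₁ := ξ) (φ₂ := Function.update ξ 0 0) (fun a => ?_) ⟨x, hxW, hxC⟩
        · rw [MultilinearMap.map_update_zero] at e
          exact e
        · by_cases ha : a = 0
          · subst ha
            rw [Function.update_self]
            ext i y
            exact hξ i ⟨y, y.2.1⟩ y.2.2
          · rw [Function.update_of_ne ha]
      rw [hz ⟨U ⊓ V, mem_Iic.2 inf_le_right⟩ _ ⟨x.2, hx⟩, mul_zero]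
      · refine hz ⟨V, le_refl V⟩ _ hx fun i y hy => ?_
        simp only [Function.update_self]
        change χ ⟨y, _⟩ • (φ 0).1.1 i ⟨y, _⟩ = 0
        rw [h0 _ hy, zero_smul]
      · intro i y hy
        simp only [Function.update_self]
        change χ ⟨y, _⟩ • (φ 0).1.1 i ⟨y, _⟩ = 0
        rw [h0 _ hy, zero_smul]
  · rw [Fn.zext_of_notMem _ hx, Fn.zext_of_notMem _ fun h : (x : M) ∈ U ⊓ V => hx h.2, mul_zero]

variable [SecondCountableTopology M] [IsManifold (𝓡∂ n) ∞ M]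

/-- A functional supported on the diagonal which is given by polydifferential operators on the
members of a finite cover is given by a polydifferential operator. -/
theorem exists_eq_pairing_of_cover {ι : Type*} [Finite ι] (N : ι → Opens M) (hN : ∀ i, N i ≤ U)
    (hU : ∀ x ∈ U, ∃ i, x ∈ N i) (T : Distribution n U) {I : Functional 𝓔 (k + 1) U}
    (hI : DiagonalSupport I)
    (h : ∀ i, ∃ P, Functional.res (hN i) I = pairing (Distribution.res (hN i) T) P) :
    ∃ P, I = pairing T P := by
  have := Fintype.ofFinite ι
  obtain ⟨p⟩ := exists_bumpPartition (n := n) U N hU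
  choose P hP using h
  refine ⟨∑ i, extend (p.ψ i) (p.pair i).2 (precompMul (Fn.res (hN i) (p.χ i)) (P i)),
    MultilinearMap.ext fun φ => ?_⟩
  rw [p.functional_eq_finsum, finsum_eq_sum_of_fintype, pairing_sum, sum_apply]
  refine Finset.sum_congr rfl fun i _ => ?_
  rw [← spread_pairing (hN i) (p.pair i), ← hP, Functional.spread_res (hN i) (p.pair i) hI]

end PolyDiffOp

end Extend

/-! ### Local functionals and densities in a chart -/

section LocalForm

open Set

variable {n : ℕ} [NeZero n] {M : Type u} [TopologicalSpace M] [T2Space M]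
  [ChartedSpace (EuclideanHalfSpace n) M] {𝓔 : GradedBundle n M} {k : ℕ} {U V : Opens M}
  {c : MChart n M}

omit [T2Space M] in
theorem PolyDiffOp.val_sum {ι : Type*} (s : Finset ι) (P : ι → PolyDiffOp 𝓔 k V) (W : Set.Iic V)
    (φ : Fin k → Fields 𝓔 W.1) : (∑ i ∈ s, P i).1 W φ = ∑ i ∈ s, (P i).1 W φ := by
  classical
  induction s using Finset.induction_on with
  | empty => rw [Finset.sum_empty, Finset.sum_empty]; rfl
  | insert i s hi ih => rw [Finset.sum_insert hi, Finset.sum_insert hi, ← ih]; rfl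

variable [SecondCountableTopology M] [IsManifold (𝓡∂ n) ∞ M]

omit [T2Space M] [SecondCountableTopology M] in
theorem MChart.exists_mem_dom (n : ℕ) [NeZero n] [ChartedSpace (EuclideanHalfSpace n) M]
    [IsManifold (𝓡∂ n) ∞ M] (x : M) : ∃ c : MChart n M, x ∈ c.dom :=
  ⟨⟨chartAt _ x, IsManifold.chart_mem_maximalAtlas x⟩, mem_chart_source _ x⟩

/-- The functional given by a `∂`-smooth density and a graded symmetric polydifferential operator
is local. -/
theorem pairing_mem_localFunctional (w : BdrySmoothDensity n U) {P : PolyDiffOp 𝓔 (k + 1) U}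
    (hP : P ∈ SymPolyDiffOp 𝓔 (k + 1) U) : pairing w.1 P ∈ LocalFunctional 𝓔 k U := by
  refine ⟨fun a b hab p q φ hp hq => ?_, diagonalSupport_pairing _ _, fun x hx => ?_⟩
  · rw [pairing_apply, pairing_apply, ← map_zsmul]
    congr 1
    apply Subtype.ext
    exact hP ⟨U, le_refl U⟩ a b hab p q (fun a => (φ a).1) hp hq
  · obtain ⟨c, hxc⟩ := MChart.exists_mem_dom n x
    obtain ⟨V, h, hV, D, hxV, hD⟩ := MChart.exists_eq_dx_rmul w hx hxc
    obtain ⟨V', h', hxV', hu⟩ :=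
      (PolyDiffOp.lmul D (PolyDiffOp.res h P)).exists_res_mem_uniformOrder hxV
    obtain ⟨N, hxN, ⟨F⟩⟩ := exists_localFrame 𝓔 x
    have h₁ : V' ⊓ N ≤ V' := inf_le_left
    obtain ⟨S, _, D', hD'⟩ := PolyDiffOp.mem_sumsOfProducts (F.restrict inf_le_right)
      ((h₁.trans h').trans hV) (PolyDiffOp.res_mem_uniformOrder h₁ hu)
    refine ⟨V' ⊓ N, (h₁.trans h').trans h, ⟨hxV', hxN⟩, ?_⟩
    have key : Functional.res ((h₁.trans h').trans h) (pairing w.1 P) =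
        ∑ s, pairing (c.dx ((h₁.trans h').trans hV)) (PolyDiffOp.prod (D' s)) := by
      rw [← pairing_sum, ← Functional.res_res h (h₁.trans h'), res_pairing, hD, pairing_rmul,
        res_pairing, MChart.dx_res]
      congr 1
      refine PolyDiffOp.ext fun W φ => ?_
      rw [PolyDiffOp.val_sum]
      exact hD' W φ
    rw [key]
    exact Submodule.sum_mem _ fun s _ => Submodule.subset_span
      (pairing_prod_mem_basicLocal (MChart.isSmoothDensity_dx c _) (D' s))

omit [SecondCountableTopology M] [IsManifold (𝓡∂ n) ∞ M] in
/-- Near every point of a chart, a linear combination of basic local functionals is given by the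
coordinate density and one polydifferential operator. -/
theorem exists_eq_pairing_of_mem_span {I : Functional 𝓔 (k + 1) U}
    (hI : I ∈ Submodule.span ℝ (basicLocal 𝓔 k U)) {x : M} (hx : x ∈ U) (hxc : x ∈ c.dom) :
    ∃ (V : Opens M) (h : V ≤ U) (hV : V ≤ c.dom) (P : PolyDiffOp 𝓔 (k + 1) V), x ∈ V ∧
      Functional.res h I = pairing (c.dx hV) P := by
  induction hI using Submodule.span_induction with
  | mem I hI =>
    obtain ⟨μ, P, hμ, rfl⟩ := exists_eq_pairing_of_mem_basicLocal hI
    obtain ⟨V, h, hV, D, hxV, hD⟩ := MChart.smoothDensity_mem_generated hμ x hx c hxc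
    refine ⟨V, h, hV, PolyDiffOp.lmul D (PolyDiffOp.res h P), hxV, ?_⟩
    rw [res_pairing, hD, pairing_rmul]
  | zero =>
    refine ⟨U ⊓ c.dom, inf_le_left, inf_le_right, 0, ⟨hx, hxc⟩, ?_⟩
    rw [map_zero, ← zero_smul ℝ (0 : PolyDiffOp 𝓔 (k + 1) (U ⊓ c.dom)), pairing_smul, zero_smul]
  | add I J _ _ hI hJ =>
    obtain ⟨V, h, hV, P, hxV, hP⟩ := hI
    obtain ⟨V', h', hV', P', hxV', hP'⟩ := hJ
    refine ⟨V ⊓ V', inf_le_left.trans h, inf_le_left.trans hV, PolyDiffOp.res inf_le_left P +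
      PolyDiffOp.res inf_le_right P', ⟨hxV, hxV'⟩, ?_⟩
    rw [map_add, pairing_add, ← Functional.res_res h inf_le_left, hP,
      ← Functional.res_res h' inf_le_right, hP', res_pairing, res_pairing, MChart.dx_res,
      MChart.dx_res]
  | smul t I _ hI =>
    obtain ⟨V, h, hV, P, hxV, hP⟩ := hI
    exact ⟨V, h, hV, t • P, hxV, by rw [map_smul, hP, pairing_smul]⟩

/-- On relatively compact open subsets of a chart, local functionals are given by graded symmetric
polydifferential operators and the coordinate density. -/
theorem LocalFunctional.exists_eq_pairing {I : Functional 𝓔 (k + 1) U}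
    (hI : I ∈ LocalFunctional 𝓔 k U) {K : Set M} (hK : IsCompact K) (hKU : K ⊆ U)
    (hKc : K ⊆ c.dom) (hVK : (V : Set M) ⊆ K) (hVU : V ≤ U) (hV : V ≤ c.dom) :
    ∃ P ∈ SymPolyDiffOp 𝓔 (k + 1) V, Functional.res hVU I = pairing (c.dx hV) P := by
  -- Glue the operators which exist near the points of `K`, finitely many of which suffice, and
  -- symmetrize the result.
  have hloc : ∀ x ∈ K, ∃ (N : Opens M) (h : N ≤ U) (hN : N ≤ c.dom)
      (P : PolyDiffOp 𝓔 (k + 1) N), x ∈ N ∧ Functional.res h I = pairing (c.dx hN) P := by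
    intro x hx
    obtain ⟨N, hN, hxN, hs⟩ := hI.2.2 x (hKU hx)
    obtain ⟨N', h', hN', P, hxN', hP⟩ := exists_eq_pairing_of_mem_span hs hxN (hKc hx)
    exact ⟨N', h'.trans hN, hN', P, hxN', by rw [← Functional.res_res hN h', hP]⟩
  choose! N hNU hNc P hxN hP using hloc
  obtain ⟨t, htK, ht⟩ := hK.elim_nhds_subcover (fun x => (N x : Set M))
    fun x hx => (N x).isOpen.mem_nhds (hxN x hx)
  have hI' := LocalFunctional.res_mem hVU hI
  obtain ⟨Q, hQ⟩ := PolyDiffOp.exists_eq_pairing_of_cover (fun x : t => N x ⊓ V)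
    (fun _ => inf_le_right) (fun x hx => by
      obtain ⟨y, hy, hxy⟩ := mem_iUnion₂.1 (ht (hVK hx))
      exact ⟨⟨y, hy⟩, hxy, hx⟩) (c.dx hV) hI'.2.1 fun x => by
        refine ⟨PolyDiffOp.res inf_le_left (P x), ?_⟩
        rw [Functional.res_res, ← Functional.res_res (hNU x (htK x x.2)) inf_le_left,
          hP x (htK x x.2), res_pairing, MChart.dx_res, MChart.dx_res]
  refine ⟨PolyDiffOp.symmetrize Q, PolyDiffOp.symmetrize_mem Q, MultilinearMap.ext fun φ => ?_⟩
  exact (PolyDiffOp.apply_testFn_symmetrize (c.dx hV) Q _ hI'.1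
    (fun φ => congrArg (fun J => J φ) hQ) φ).symm

end LocalForm

/-! ### The map from the tensor product to local functionals -/

section Digamma

open Set

variable {n : ℕ} [NeZero n] {M : Type u} [TopologicalSpace M] [T2Space M]
  [ChartedSpace (EuclideanHalfSpace n) M] {𝓔 : GradedBundle n M} {k : ℕ} {U V : Opens M}
  {c : MChart n M}

theorem DTensor.tmul_lmul (w : BdrySmoothDensity n U) (D : DiffOp n U) (P : JetFn 𝓔 U) :
    DTensor.tmul 𝓔 w (JetFn.lmul D P) = DTensor.tmul 𝓔 (w.rmul D) P :=
  ((Submodule.Quotient.eq (tensorRelations 𝓔 U)).2 (Submodule.subset_span ⟨w, D, P, rfl⟩)).symm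

/-- The linear map `P ↦ w ⊗ P`. -/
def DTensor.tmulₗ (w : BdrySmoothDensity n U) : JetFn 𝓔 U →ₗ[ℝ] DTensor 𝓔 U :=
  (tensorRelations 𝓔 U).mkQ ∘ₗ TensorProduct.mk ℝ _ _ w

theorem DTensor.tmulₗ_apply (w : BdrySmoothDensity n U) (P : JetFn 𝓔 U) :
    DTensor.tmulₗ w P = DTensor.tmul 𝓔 w P := rfl

theorem DTensor.zero_tmul (P : JetFn 𝓔 U) : DTensor.tmul 𝓔 0 P = 0 := by
  unfold DTensor.tmul
  rw [TensorProduct.zero_tmul]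
  rfl

theorem DTensor.res_res {W : Opens M} (h : V ≤ U) (h' : W ≤ V) (t : DTensor 𝓔 U) :
    DTensor.res h' (DTensor.res h t) = DTensor.res (h'.trans h) t := by
  suffices e : DTensor.res h' ∘ₗ DTensor.res h = DTensor.res (𝓔 := 𝓔) (h'.trans h) from
    congrArg (fun f : DTensor 𝓔 U →ₗ[ℝ] DTensor 𝓔 W => f t) e
  refine DTensor.hom_ext fun w P => ?_
  rw [LinearMap.comp_apply, DTensor.res_tmul, DTensor.res_tmul, DTensor.res_tmul]
  refine congrArg (fun v => DTensor.tmul 𝓔 v _) (Subtype.ext ?_)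
  exact Distribution.res_res _ _ _

/-- Near every point of a chart, an element of the tensor product is a pure tensor whose first
factor is the coordinate density. -/
theorem DTensor.exists_res_eq_tmul (t : DTensor 𝓔 U) {x : M} (hx : x ∈ U) (hxc : x ∈ c.dom) :
    ∃ (V : Opens M) (h : V ≤ U) (hV : V ≤ c.dom) (P : JetFn 𝓔 V), x ∈ V ∧
      DTensor.res h t = DTensor.tmul 𝓔 (c.dxB hV) P := by
  obtain ⟨t, rfl⟩ := Submodule.Quotient.mk_surjective _ t
  induction t using TensorProduct.induction_on with
  | zero =>
    refine ⟨U ⊓ c.dom, inf_le_left, inf_le_right, 0, ⟨hx, hxc⟩, ?_⟩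
    rw [Submodule.Quotient.mk_zero, map_zero, ← DTensor.tmulₗ_apply, map_zero]
  | tmul w P =>
    obtain ⟨V, h, hV, D, hxV, hD⟩ := MChart.exists_eq_dx_rmul w hx hxc
    refine ⟨V, h, hV, JetFn.lmul D (JetFn.res h P), hxV, ?_⟩
    rw [DTensor.tmul_lmul]
    exact congrArg (fun v => DTensor.tmul 𝓔 v _) (Subtype.ext hD)
  | add s t hs ht =>
    obtain ⟨V, h, hV, P, hxV, hP⟩ := hs
    obtain ⟨V', h', hV', P', hxV', hP'⟩ := ht
    have hdx : ∀ {W : Opens M} (hW : W ≤ c.dom) (hVW : V ⊓ V' ≤ W),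
        BdrySmoothDensity.res hVW (c.dxB hW) = c.dxB (hVW.trans hW) := fun hW hVW =>
      Subtype.ext (MChart.dx_res c hVW hW)
    refine ⟨V ⊓ V', inf_le_left.trans h, inf_le_left.trans hV,
      JetFn.res inf_le_left P + JetFn.res inf_le_right P', ⟨hxV, hxV'⟩, ?_⟩
    rw [Submodule.Quotient.mk_add, map_add, ← DTensor.tmulₗ_apply, map_add,
      ← DTensor.res_res h inf_le_left, hP, ← DTensor.res_res h' inf_le_right, hP',
      DTensor.res_tmul, DTensor.res_tmul, hdx, hdx]
    rfl

variable (𝓔 U) in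
/-- The bilinear map `(w, P) ↦ (φ ↦ w(P_{k+1}(φ)))`. -/
def pairingBilin (k : ℕ) :
    BdrySmoothDensity n U →ₗ[ℝ] JetFn 𝓔 U →ₗ[ℝ] Functional 𝓔 (k + 1) U :=
  LinearMap.mk₂ ℝ (fun w P => pairing w.1 (P (k + 1)).1) (fun _ _ _ => rfl) (fun _ _ _ => rfl)
    (fun w P Q => pairing_add w.1 (P (k + 1)).1 (Q (k + 1)).1)
    (fun t w P => pairing_smul w.1 t (P (k + 1)).1)

/-- The map `w ⊗ P ↦ (φ ↦ w(P_{k+1}(φ)))` over `U`. -/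
def DTensor.functional (k : ℕ) : DTensor 𝓔 U →ₗ[ℝ] Functional 𝓔 (k + 1) U :=
  (tensorRelations 𝓔 U).liftQ (TensorProduct.lift (pairingBilin 𝓔 U k)) (by
    refine Submodule.span_le.2 ?_
    rintro _ ⟨w, D, P, rfl⟩
    rw [SetLike.mem_coe, LinearMap.mem_ker, map_sub, sub_eq_zero]
    rfl)

theorem DTensor.functional_tmul (w : BdrySmoothDensity n U) (P : JetFn 𝓔 U) (k : ℕ) :
    DTensor.functional k (DTensor.tmul 𝓔 w P) = pairing w.1 (P (k + 1)).1 := rfl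

theorem DTensor.functional_res (h : V ≤ U) (t : DTensor 𝓔 U) (k : ℕ) :
    DTensor.functional k (DTensor.res h t) = Functional.res h (DTensor.functional k t) := by
  suffices e : DTensor.functional k ∘ₗ DTensor.res h =
      Functional.res (𝓔 := 𝓔) h ∘ₗ DTensor.functional k from
    congrArg (fun F : DTensor 𝓔 U →ₗ[ℝ] Functional 𝓔 (k + 1) V => F t) e
  refine DTensor.hom_ext fun w P => ?_
  rw [LinearMap.comp_apply, LinearMap.comp_apply, DTensor.res_tmul, DTensor.functional_tmul,
    DTensor.functional_tmul, res_pairing]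
  rfl

variable [SecondCountableTopology M] [IsManifold (𝓡∂ n) ∞ M]

theorem DTensor.functional_mem (k : ℕ) (t : DTensor 𝓔 U) :
    DTensor.functional k t ∈ LocalFunctional 𝓔 k U := by
  obtain ⟨t, rfl⟩ := Submodule.Quotient.mk_surjective _ t
  induction t using TensorProduct.induction_on with
  | zero =>
    rw [Submodule.Quotient.mk_zero, map_zero]
    exact zero_mem _
  | tmul w P => exact pairing_mem_localFunctional w (P (k + 1)).2
  | add s t hs ht =>
    rw [Submodule.Quotient.mk_add, map_add]
    exact add_mem hs ht

/-- A smooth function as a polydifferential operator without arguments. -/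
def PolyDiffOp.ofFn (f : Fn n V) : SymPolyDiffOp 𝓔 0 V :=
  ⟨⟨fun W => MultilinearMap.constOfIsEmpty ℝ _ (Fn.res W.2 f), fun _ _ _ _ => rfl,
    fun _ _ => ⟨⊤, trivial, 0, fun _ _ a => a.elim0⟩⟩, fun _ a => a.elim0⟩

/-- Components without arguments are locally in the image of `∂_0 x_0`, which annihilates the
coordinate density. -/
theorem PolyDiffOp.exists_lmul_ofFn (P : SymPolyDiffOp 𝓔 0 V) (hV : V ≤ c.dom) {x : M}
    (hx : x ∈ V) : ∃ (W : Opens M) (hW : W ≤ V) (R : SymPolyDiffOp 𝓔 0 W), x ∈ W ∧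
      PolyDiffOp.res hW P.1 = PolyDiffOp.lmul
        (c.derivOp 0 (hW.trans hV) * Fn.mulOp (c.coord 0 (hW.trans hV))) R.1 := by
  obtain ⟨W, hW, g, hxW, hg⟩ := MChart.exists_eq_derivFn_coord_mul hV (P.1.app Fin.elim0) hx
  refine ⟨W, hW, PolyDiffOp.ofFn g, hxW, PolyDiffOp.ext fun W' φ => ?_⟩
  have h1 := P.1.2.1 ⟨W'.1, (iic_le W').trans hW⟩ ⟨V, le_refl V⟩ ((iic_le W').trans hW) Fin.elim0
  rw [Subsingleton.elim (fun a => Fields.res ((iic_le W').trans hW) (Fin.elim0 a)) φ] at h1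
  have h2 := (c.derivOp 0 (hW.trans hV) * Fn.mulOp (c.coord 0 (hW.trans hV))).2.1 W'
    ⟨W, le_refl W⟩ (iic_le W') g
  refine Eq.trans ?_ h2.symm
  exact h1.trans (congrArg (Fn.res (iic_le W')) hg)

/-- If the integral of a graded symmetric polydifferential operator vanishes, then the operator is
a sum of compositions of graded symmetric operators with differential operators which annihilate
the coordinate density. -/
theorem PolyDiffOp.exists_eq_sum_lmul_sym (F : LocalFrame 𝓔 V) (hV : V ≤ c.dom)
    {P : PolyDiffOp 𝓔 (k + 1) V} (hs : P ∈ SymPolyDiffOp 𝓔 (k + 1) V)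
    (hPu : P ∈ uniformOrder 𝓔 (k + 1) V) (hP : pairing (c.dx hV) P = 0) :
    ∃ (R : SymPolyDiffOp 𝓔 (k + 1) V) (Q S : {i : Fin n // i ≠ 0} → SymPolyDiffOp 𝓔 (k + 1) V),
      P = lmul (c.derivOp 0 hV * Fn.mulOp (c.coord 0 hV)) R.1 +
        ∑ i, lmul (c.derivOp i.1 hV) (Q i).1 +
        ∑ i, lmul (c.derivOp 0 hV * c.derivOp i.1 hV) (S i).1 := by
  obtain ⟨R, Q, S, h⟩ := exists_eq_sum_lmul F hV hPu fun φ => congrArg (fun J => J φ) hP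
  refine ⟨⟨_, symmetrize_mem R⟩, fun i => ⟨_, symmetrize_mem (Q i)⟩,
    fun i => ⟨_, symmetrize_mem (S i)⟩, ?_⟩
  have h' := congrArg symmetrize h
  simp only [map_add, map_sum, symmetrize_lmul, symmetrize_of_mem hs] at h'
  exact h'

/-- The component of degree `k` of a function on jets. -/
def JetFn.coeff (k : ℕ) : JetFn 𝓔 U →ₗ[ℝ] PolyDiffOp 𝓔 k U where
  toFun P := (P k).1
  map_add' _ _ := rfl
  map_smul' _ _ := rfl

omit [T2Space M] [SecondCountableTopology M] [IsManifold (𝓡∂ n) ∞ M] in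
theorem JetFn.ext_coeff {P Q : JetFn 𝓔 U} (h : ∀ k, JetFn.coeff k P = JetFn.coeff k Q) : P = Q :=
  funext fun k => Subtype.ext (h k)

/-- A pure tensor whose first factor is the coordinate density and whose image is zero vanishes
locally. -/
theorem exists_res_tmul_dxB_eq_zero (hV : V ≤ c.dom) (P : JetFn 𝓔 V)
    (hP : ∀ k, pairing (c.dx hV) (P (k + 1)).1 = 0) {x : M} (hx : x ∈ V) :
    ∃ (W : Opens M) (hW : W ≤ V), x ∈ W ∧
      DTensor.res hW (DTensor.tmul 𝓔 (c.dxB hV) P) = 0 := by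
  have : LocallyCompactSpace M := Manifold.locallyCompact_of_finiteDimensional (𝓡∂ n)
  obtain ⟨V₀, h₀, R₀, hxV₀, hR₀⟩ := PolyDiffOp.exists_lmul_ofFn (P 0) hV hx
  obtain ⟨N, hxN, ⟨F⟩⟩ := exists_localFrame 𝓔 x
  -- On a relatively compact set, the order of each component is bounded. Hence one neighbourhood
  -- serves for all of the infinitely many components.
  obtain ⟨K, hK, hxK, hKV⟩ := exists_compact_subset (V₀ ⊓ N).isOpen
    (show x ∈ V₀ ⊓ N from ⟨hxV₀, hxN⟩)
  let W : Opens M := ⟨interior K, isOpen_interior⟩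
  have hWK : (W : Set M) ⊆ K := interior_subset
  have hW₀ : W ≤ V₀ := fun y hy => (hKV (hWK hy)).1
  have hWN : W ≤ N := fun y hy => (hKV (hWK hy)).2
  have hW : W ≤ V := hW₀.trans h₀
  have key : ∀ k, ∃ (R : SymPolyDiffOp 𝓔 k W) (Q S : {i : Fin n // i ≠ 0} → SymPolyDiffOp 𝓔 k W),
      PolyDiffOp.res hW (P k).1 =
        PolyDiffOp.lmul (c.derivOp 0 (hW.trans hV) * Fn.mulOp (c.coord 0 (hW.trans hV))) R.1 +
        ∑ i, PolyDiffOp.lmul (c.derivOp i.1 (hW.trans hV)) (Q i).1 +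
        ∑ i, PolyDiffOp.lmul (c.derivOp 0 (hW.trans hV) * c.derivOp i.1 (hW.trans hV))
          (S i).1 := by
    rintro (_ | k)
    · refine ⟨⟨PolyDiffOp.res hW₀ R₀.1, fun _ a => a.elim0⟩, fun _ => 0, fun _ => 0, ?_⟩
      have e : ∀ A B C : PolyDiffOp 𝓔 0 W, B = 0 → C = 0 → A = A + B + C := by
        rintro A _ _ rfl rfl
        rw [add_zero, add_zero]
      exact (congrArg (PolyDiffOp.res hW₀) hR₀).trans (e _ _ _
        (Finset.sum_eq_zero fun i _ => map_zero (PolyDiffOp.lmulEnd _))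
        (Finset.sum_eq_zero fun i _ => map_zero (PolyDiffOp.lmulEnd _)))
    · refine PolyDiffOp.exists_eq_sum_lmul_sym (F.restrict hWN) (hW.trans hV)
        (JetFn.res hW P (k + 1)).2 (PolyDiffOp.res_mem_uniformOrder_of_isCompact _ hK
          (fun y hy => h₀ (hKV hy).1) hWK hW) ?_
      have h := congrArg (Functional.res hW) (hP k)
      rwa [res_pairing, MChart.dx_res, map_zero] at h
  obtain ⟨R, Q, S, hRQS⟩ : ∃ (R : JetFn 𝓔 W) (Q S : {i : Fin n // i ≠ 0} → JetFn 𝓔 W),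
      JetFn.res hW P =
        JetFn.lmul (c.derivOp 0 (hW.trans hV) * Fn.mulOp (c.coord 0 (hW.trans hV))) R +
        ∑ i, JetFn.lmul (c.derivOp i.1 (hW.trans hV)) (Q i) +
        ∑ i, JetFn.lmul (c.derivOp 0 (hW.trans hV) * c.derivOp i.1 (hW.trans hV)) (S i) := by
    choose R Q S hRQS using key
    refine ⟨R, fun i k => Q k i, fun i k => S k i, JetFn.ext_coeff fun k => ?_⟩
    simp only [map_add, map_sum]
    exact hRQS k
  refine ⟨W, hW, hxK, ?_⟩
  have hdx : BdrySmoothDensity.res hW (c.dxB hV) = c.dxB (hW.trans hV) :=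
    Subtype.ext (MChart.dx_res c hW hV)
  have hz : ∀ (D : DiffOp n W) (P : JetFn 𝓔 W), (c.dx (hW.trans hV)).rmul D = 0 →
      DTensor.tmulₗ (c.dxB (hW.trans hV)) (JetFn.lmul D P) = 0 := by
    intro D P hD
    rw [DTensor.tmulₗ_apply, DTensor.tmul_lmul,
      show (c.dxB (hW.trans hV)).rmul D = 0 from Subtype.ext hD, DTensor.zero_tmul]
  rw [DTensor.res_tmul, hdx, hRQS, ← DTensor.tmulₗ_apply, map_add, map_add, map_sum, map_sum,
    hz _ _ (MChart.dx_rmul_derivOp_zero_mul _),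
    Finset.sum_eq_zero fun i _ => hz _ _ (MChart.dx_rmul_derivOp _ i.2),
    Finset.sum_eq_zero fun i _ => hz _ _ (MChart.dx_rmul_derivOp_zero_mul_derivOp _ i.2),
    add_zero, add_zero]

/-- An element of the tensor product which defines the zero functional vanishes locally. -/
theorem DTensor.exists_res_eq_zero (t : DTensor 𝓔 U) (ht : ∀ k, DTensor.functional k t = 0) {x : M}
    (hx : x ∈ U) : ∃ (W : Opens M) (hW : W ≤ U), x ∈ W ∧ DTensor.res hW t = 0 := by
  obtain ⟨c, hxc⟩ := MChart.exists_mem_dom n x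
  obtain ⟨V, h, hV, P, hxV, hP⟩ := DTensor.exists_res_eq_tmul t hx hxc
  obtain ⟨W, hW, hxW, h0⟩ := exists_res_tmul_dxB_eq_zero hV P (fun k => by
    have h1 := DTensor.functional_res h t k
    rwa [hP, DTensor.functional_tmul, ht, map_zero] at h1) hxV
  exact ⟨W, hW.trans h, hxW, by rw [← DTensor.res_res h hW, hP, h0]⟩

/-- Every sequence of local functionals is locally defined by a pure tensor `dx ⊗ P`. -/
theorem DTensor.exists_functional_eq (I : ∀ k : ℕ, LocalFunctional 𝓔 k U) {x : M} (hx : x ∈ U) :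
    ∃ (V : Opens M) (h : V ≤ U) (t : DTensor 𝓔 V), x ∈ V ∧
      ∀ k, DTensor.functional k t = Functional.res h (I k).1 := by
  have : LocallyCompactSpace M := Manifold.locallyCompact_of_finiteDimensional (𝓡∂ n)
  obtain ⟨c, hxc⟩ := MChart.exists_mem_dom n x
  obtain ⟨K, hK, hxK, hKU⟩ := exists_compact_subset (U ⊓ c.dom).isOpen
    (show x ∈ U ⊓ c.dom from ⟨hx, hxc⟩)
  let V : Opens M := ⟨interior K, isOpen_interior⟩
  have hVK : (V : Set M) ⊆ K := interior_subset
  have hVU : V ≤ U := fun y hy => (hKU (hVK hy)).1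
  have hV : V ≤ c.dom := fun y hy => (hKU (hVK hy)).2
  choose P hPs hP using fun k => LocalFunctional.exists_eq_pairing (I k).2 hK
    (fun y hy => (hKU hy).1) (fun y hy => (hKU hy).2) hVK hVU hV
  let Q : JetFn 𝓔 V := fun k => match k with
    | 0 => 0
    | k + 1 => ⟨P k, hPs k⟩
  exact ⟨V, hVU, DTensor.tmul 𝓔 (c.dxB hV) Q, hxK, fun k => (hP k).symm⟩

end Digamma

/-! ### The isomorphism of sheaves -/

section Iso

open CategoryTheory Opposite

variable {n : ℕ} [NeZero n] {M : Type} [TopologicalSpace M] [T2Space M]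
  [SecondCountableTopology M] [ChartedSpace (EuclideanHalfSpace n) M] [IsManifold (𝓡∂ n) ∞ M]
  (𝓔 : GradedBundle n M)

/-- The morphism of presheaves `w ⊗ P ↦ (φ ↦ w(P_k(φ)))_k`. -/
def digamma : tensorPresheaf 𝓔 ⟶ localFunctionals 𝓔 where
  app U := ModuleCat.ofHom (LinearMap.pi fun k =>
    (DTensor.functional k).codRestrict (LocalFunctional 𝓔 k U.unop) (DTensor.functional_mem k))
  naturality U V f := by
    apply ModuleCat.hom_ext
    apply LinearMap.ext
    intro t
    funext k
    exact Subtype.ext (DTensor.functional_res (leOfHom f.unop) t k)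

theorem isLocallyInjective_digamma :
    Presheaf.IsLocallyInjective (Opens.grothendieckTopology M) (digamma 𝓔) where
  equalizerSieve_mem {U} (s t : DTensor 𝓔 U.unop) h := by
    intro x hx
    obtain ⟨W, hW, hxW, h0⟩ := DTensor.exists_res_eq_zero (s - t)
      (fun k => by
        rw [map_sub, sub_eq_zero]
        exact congrArg Subtype.val (congrFun h k)) hx
    refine ⟨W, homOfLE hW, ?_, hxW⟩
    rw [map_sub, sub_eq_zero] at h0
    exact h0

theorem isLocallySurjective_digamma :
    Presheaf.IsLocallySurjective (Opens.grothendieckTopology M) (digamma 𝓔) where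
  imageSieve_mem {U} (I : ∀ k : ℕ, LocalFunctional 𝓔 k U) := by
    intro x hx
    obtain ⟨V, h, t, hxV, ht⟩ := DTensor.exists_functional_eq I hx
    exact ⟨V, homOfLE h, ⟨t, funext fun k => Subtype.ext (ht k)⟩, hxV⟩

/-- A locally bijective morphism from a presheaf to a sheaf becomes an isomorphism on the
sheafification. -/
theorem isIso_sheafifyLift_digamma :
    IsIso (sheafifyLift (Opens.grothendieckTopology M) (digamma 𝓔)
      (isSheaf_localFunctionals 𝓔)) := by
  let J := Opens.grothendieckTopology M
  have := isLocallyInjective_digamma 𝓔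
  have := isLocallySurjective_digamma 𝓔
  have h1 : J.W (digamma 𝓔) := J.W_of_isLocallyBijective _
  have h2 : J.W (toSheafify J (tensorPresheaf 𝓔)) := J.W_toSheafify _
  rw [← toSheafify_sheafifyLift J (digamma 𝓔) (isSheaf_localFunctionals 𝓔)] at h1
  have h3 := MorphismProperty.of_precomp _ _ _ h2 h1
  let F : Sheaf J (ModuleCat ℝ) := (presheafToSheaf J _).obj (tensorPresheaf 𝓔)
  let G : Sheaf J (ModuleCat ℝ) := ⟨localFunctionals 𝓔, isSheaf_localFunctionals 𝓔⟩
  let f : F ⟶ G := ⟨sheafifyLift J (digamma 𝓔) (isSheaf_localFunctionals 𝓔)⟩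
  have h4 : IsIso f := (J.W_sheafToPresheaf_map_iff_isIso f).1 h3
  exact inferInstanceAs (IsIso ((sheafToPresheaf J _).map f))

end Iso

end BoundaryDMod

end

theorem mainTheorem5 {n : ℕ} [NeZero n] {M : Type} [TopologicalSpace M] [T2Space M]
    [SecondCountableTopology M] [ChartedSpace (EuclideanHalfSpace n) M]
    [IsManifold (𝓡∂ n) ∞ M] (𝓔 : BoundaryDMod.GradedBundle n M) :
    ∃ (hO : CategoryTheory.Presheaf.IsSheaf (Opens.grothendieckTopology M)
          (BoundaryDMod.localFunctionals 𝓔))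
      (digamma : BoundaryDMod.tensorPresheaf 𝓔 ⟶ BoundaryDMod.localFunctionals 𝓔),
      (∀ (U : Opens M) (w : BoundaryDMod.BdrySmoothDensity n U) (P : BoundaryDMod.JetFn 𝓔 U)
          (k : ℕ) (φ : Fin (k + 1) → BoundaryDMod.CFields 𝓔 U),
        ((digamma.app (Opposite.op U)).hom (BoundaryDMod.DTensor.tmul 𝓔 w P) k).1 φ =
          w.1.1 ((P (k + 1)).1.testFn φ)) ∧
      CategoryTheory.IsIso
        (CategoryTheory.sheafifyLift (Opens.grothendieckTopology M) digamma hO) := by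
  refine ⟨BoundaryDMod.isSheaf_localFunctionals 𝓔, BoundaryDMod.digamma 𝓔, fun U w P k φ => ?_,
    BoundaryDMod.isIso_sheafifyLift_digamma 𝓔⟩
  rfl
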